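/- A labelled transition system (LTS) is a tuple $L=(S,\Sigma,\Delta,\hat s)$, where $S$ is a set of states, $\Sigma=\Sigma(L)$ is a set of visible actions (the alphabet) with $\tau\notin\Sigma$, $\Delta\subseteq S\times(\Sigma\cup\{\tau\})\times S$, and $\hat s\in S$. States and alphabets may be infinite, and any object other than $\tau$ may serve as a visible action. The operators are: * action prefix $a.L$ ($a\ne\tau$): a new initial state with the single transition labelled $a$ to $\hat s$; alphabet $\Sigma\cup\{a\}$; * hiding $L\setminus A$: every label in $A$ is replaced by $\tau$; alphabet $\Sigma\setminus A$; * relational renaming $L\Phi$, for a set $\Phi$ of pairs of visible actions: write $\Phi(a,b)$ if $(a,b)\in\Phi$, or $a=b$ and $a$ is not the first component of any pair in $\Phi$; the $\tau$-transitions are kept, each transition $(s,a,s')$ with $a\neq\tau$ is replaced by all $(s,b,s')$ with $\Phi(a,b)$, and the alphabet is $\{b\mid\exists a\in\Sigma:\Phi(a,b)\}$; * parallel composition $L_1\,||\,L_2$: states $S_1\times S_2$, initial state $(\hat s_1,\hat s_2)$, alphabet $\Sigma_1\cup\Sigma_2$; actions in $\Sigma_1\cap\Sigma_2$ are executed by both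 components simultaneously, while $\tau$ and all other actions are executed by one component alone. A congruence is an equivalence relation $\cong$ on LTSs such that $L\cong L'$ implies $a.L\cong a.L'$, $L\setminus A\cong L'\setminus A$, $L\Phi\cong L'\Phi$, $L\,||\,L''\cong L'\,||\,L''$ and $L''\,||\,L\cong L''\,||\,L'$. It preserves a function $X$ on LTSs if $L\cong L'$ implies $X(L)=X(L')$. The equivalence induced by $X_1,\dots,X_k$ relates $L$ and $L'$ if and only if $X_i(L)=X_i(L')$ for all $i$. For $\sigma\in\Sigma^*$ write $s\stackrel{\sigma}{\Rightarrow}s'$ if some finite path from $s$ to $s'$ has $\sigma$ as its sequence of visible labels, and similarly $s\stackrel{\xi}{\Rightarrow}$ for $\xi\in\Sigma^\omega$ and an infinite path. Define $$\begin{aligned} \mathit{Tr}(L)&=\{\sigma\mid\exists s:\hat s\stackrel{\sigma}{\Rightarrow}s\},\\ \mathit{Div}(L)&=\{\sigma\mid\exists s:\hat s\stackrel{\sigma}{\Rightarrow}s\text{ and an infinite path of }\tau\text{-transitions starts at }s\},\\ \mathit{Inf}(L)&=\{\xi\in\Sigma^\omega\mid\hat s\stackrel{\xi}{\Rightarrow}\},\\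 \mathit{Sf}(L)&=\{(\sigma,A)\mid A\subseteq\Sigma,\ \exists s:\hat s\stackrel{\sigma}{\Rightarrow}s\text{ and no transition from }s\text{ has its label in }A\cup\{\tau\}\},\\ \mathit{minD}(L)&=\{\sigma\in\mathit{Div}(L)\mid\text{no proper prefix of }\sigma\text{ is in }\mathit{Div}(L)\},\\ \mathit{extT}(L)&=\{\sigma\in\Sigma^*\mid\text{some (not necessarily proper) prefix of }\sigma\text{ is in }\mathit{minD}(L)\},\\ \mathit{extI}(L)&=\{\xi\in\Sigma^\omega\mid\text{some finite prefix of }\xi\text{ is in }\mathit{minD}(L)\},\\ \mathit{anT}(L)&=\mathit{Tr}(L)\setminus\mathit{extT}(L),\qquad \mathit{anI}(L)=\mathit{Inf}(L)\setminus\mathit{extI}(L),\\ \mathit{eanI}(L)&=\{\xi\in\mathit{Inf}(L)\mid\text{only finitely many prefixes of }\xi\text{ are in }\mathit{Div}(L)\},\\ \mathit{aenI}(L)&=\{\xi\in\mathit{Inf}(L)\mid\text{infinitely many prefixes of }\xi\text{ are not in }\mathit{Div}(L)\},\\ \mathit{sanF}(L)&=\{(\sigma,A)\in\mathit{Sf}(L)\mid\sigma\notin\mathit{extT}(L),\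 \forall a\in A:\sigma a\notin\mathit{minD}(L)\}. \end{aligned}$$ CFFD-equivalence $\doteq$ is the equivalence induced by $\Sigma,\mathit{Sf},\mathit{Div},\mathit{Inf}$. Livelock is the LTS with empty alphabet and one state with a $\tau$-loop; bothlock is the LTS with empty alphabet and two states, where the initial state has a $\tau$-loop and a $\tau$-transition to the other state, which is a deadlock. **Theorem.** Let $\cong$ be a congruence such that $L\doteq L'$ implies $L\cong L'$, such that livelock $\cong$ bothlock, and which does not preserve $\mathit{sanF}$. Then: 1. if $\cong$ preserves $\mathit{minD}$ but not $\mathit{Tr}$, it is the equivalence induced by $\Sigma,\mathit{anT},\mathit{minD},\mathit{anI}$; 2. if $\cong$ preserves $\mathit{Tr}$ and $\mathit{minD}$ but neither $\mathit{Div}$ nor $\mathit{Inf}$, it is the equivalence induced by $\Sigma,\mathit{Tr},\mathit{minD},\mathit{anI}$; 3. if $\cong$ preserves $\mathit{minD}$ and $\mathit{Inf}$ but not $\mathit{Div}$, it is the equivalence induced by $\Sigma,\mathit{Tr},\mathit{minD},\mathit{Inf}$; 4. if $\cong$ preserves $\mathit{Div}$ but not $\mathit{aenI}$, it is the equivalence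 induced by $\Sigma,\mathit{Tr},\mathit{Div},\mathit{eanI}$; 5. if $\cong$ preserves $\mathit{Div}$ and $\mathit{aenI}$ but not $\mathit{Inf}$, it is the equivalence induced by $\Sigma,\mathit{Tr},\mathit{Div},\mathit{aenI}$; 6. if $\cong$ preserves $\mathit{Div}$ and $\mathit{Inf}$, it is the equivalence induced by $\Sigma,\mathit{Tr},\mathit{Div},\mathit{Inf}$. -/

import Mathlib

universe u

/-- Visible actions. Any set may serve as an action name; the invisible action `τ` is kept apart:
transitions are labelled by `Option Act`, with `none` for `τ` and `some a` for the visible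
action `a`. -/
abbrev Act : Type (u + 1) := ZFSet.{u}

/-- A labelled transition system `(S, Σ, Δ, ŝ)`. States and alphabet form sets of any size.
As actions range over the proper class `Act`, the field `small_alphabet` says that the
alphabet is a set rather than a proper class. -/
structure LTS : Type (u + 1) where
  State : Type u
  alphabet : Set Act.{u}
  small_alphabet : Small.{u} alphabet
  trans : State → Option Act.{u} → State → Prop
  trans_mem : ∀ s a s', trans s (some a) s' → a ∈ alphabet
  init : State

attribute [instance] LTS.small_alphabet

namespace LTS

/-! ### The operators -/

/-- Action prefix `a.L`; the new initial state is `none`. -/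
def actPrefix (a : Act.{u}) (L : LTS.{u}) : LTS.{u} where
  State := Option L.State
  alphabet := insert a L.alphabet
  small_alphabet := inferInstance
  trans
    | none, l, some t => l = some a ∧ t = L.init
    | some s, l, some t => L.trans s l t
    | _, _, none => False
  trans_mem := by
    rintro (_ | s) b (_ | t) h
    · exact h.elim
    · exact Or.inl (Option.some.inj h.1)
    · exact h.elim
    · exact Or.inr (L.trans_mem _ _ _ h)
  init := none

/-- Hiding `L \ A`. -/
def hide (L : LTS.{u}) (A : Set Act.{u}) : LTS.{u} where
  State := L.State
  alphabet := L.alphabet \ A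
  small_alphabet := inferInstance
  trans s l s' :=
    (L.trans s l s' ∧ ∀ b ∈ A, l ≠ some b) ∨ (l = none ∧ ∃ b ∈ A, L.trans s (some b) s')
  trans_mem := by
    rintro s a s' (⟨h, hA⟩ | ⟨h, -⟩)
    · exact ⟨L.trans_mem _ _ _ h, fun ha => hA a ha rfl⟩
    · cases h
  init := L.init

/-- `Φ(a, b)`: either `(a, b) ∈ Φ`, or `a = b` and `a` is not in the domain of `Φ`. -/
def RenRel (Φ : Set (Act.{u} × Act.{u})) (a b : Act.{u}) : Prop :=
  (a, b) ∈ Φ ∨ (a = b ∧ ∀ c, (a, c) ∉ Φ)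

theorem small_renRel (S : Set Act.{u}) [Small.{u} S] (Φ : Set (Act.{u} × Act.{u})) [Small.{u} Φ] :
    Small.{u} {b | ∃ a ∈ S, RenRel Φ a b} := by
  have hsub : {b | ∃ a ∈ S, RenRel Φ a b} ⊆ S ∪ Prod.snd '' Φ := by
    rintro b ⟨a, ha, h | ⟨rfl, -⟩⟩
    · exact Or.inr ⟨(a, b), h, rfl⟩
    · exact Or.inl ha
  exact small_subset.{u} hsub

/-- Relational renaming `L Φ`. The invisible action is never renamed. -/
def rename (L : LTS.{u}) (Φ : Set (Act.{u} × Act.{u})) [Small.{u} Φ] : LTS.{u} where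
  State := L.State
  alphabet := {b | ∃ a ∈ L.alphabet, RenRel Φ a b}
  small_alphabet := small_renRel _ _
  trans
    | s, none, s' => L.trans s none s'
    | s, some b, s' => ∃ a, L.trans s (some a) s' ∧ RenRel Φ a b
  trans_mem := by
    rintro s b s' ⟨a, h, hr⟩
    exact ⟨a, L.trans_mem _ _ _ h, hr⟩
  init := L.init

/-- Parallel composition `L₁ || L₂`: synchronisation on the common visible actions. -/
def par (L₁ L₂ : LTS.{u}) : LTS.{u} where
  State := L₁.State × L₂.State
  alphabet := L₁.alphabet ∪ L₂.alphabet
  small_alphabet := inferInstance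
  trans s l s' :=
    ((∀ a ∈ L₂.alphabet, l ≠ some a) ∧ L₁.trans s.1 l s'.1 ∧ s'.2 = s.2) ∨
    ((∀ a ∈ L₁.alphabet, l ≠ some a) ∧ L₂.trans s.2 l s'.2 ∧ s'.1 = s.1) ∨
    (∃ a ∈ L₁.alphabet ∩ L₂.alphabet, l = some a ∧
      L₁.trans s.1 (some a) s'.1 ∧ L₂.trans s.2 (some a) s'.2)
  trans_mem := by
    rintro s a s' (⟨-, h, -⟩ | ⟨-, h, -⟩ | ⟨b, hb, h, -⟩)
    · exact Or.inl (L₁.trans_mem _ _ _ h)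
    · exact Or.inr (L₂.trans_mem _ _ _ h)
    · cases h
      exact Or.inl hb.1
  init := (L₁.init, L₂.init)

/-! ### Livelock and bothlock -/

/-- Livelock: empty alphabet, one state, with a `τ`-loop. -/
def livelock : LTS.{u} where
  State := PUnit
  alphabet := ∅
  small_alphabet := inferInstance
  trans _ l _ := l = none
  trans_mem := by rintro _ _ _ ⟨⟩
  init := PUnit.unit

/-- Bothlock: empty alphabet, an initial state with a `τ`-loop, and a `τ`-transition from
it to a deadlock state. -/
def bothlock : LTS.{u} where
  State := ULift Bool
  alphabet := ∅
  small_alphabet := inferInstance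
  trans s l _ := s.down = false ∧ l = none
  trans_mem := by rintro _ _ _ ⟨-, ⟨⟩⟩
  init := ⟨false⟩

/-! ### Paths -/

/-- `s =ε⇒ s'`: finitely many `τ`-transitions lead from `s` to `s'`. -/
def TauReach (L : LTS.{u}) : L.State → L.State → Prop :=
  Relation.ReflTransGen fun s s' => L.trans s none s'

/-- `s =σ⇒ s'` for a finite sequence `σ` of visible actions. -/
def Reach (L : LTS.{u}) : L.State → List Act.{u} → L.State → Prop
  | s, [], s' => L.TauReach s s'
  | s, a :: σ, s' => ∃ t t', L.TauReach s t ∧ L.trans t (some a) t' ∧ L.Reach t' σ s'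

/-- `s =ξ⇒` for an infinite sequence `ξ` of visible actions. -/
def InfReach (L : LTS.{u}) (s : L.State) (ξ : ℕ → Act.{u}) : Prop :=
  ∃ f : ℕ → L.State, f 0 = s ∧
    ∀ n, ∃ t, L.TauReach (f n) t ∧ L.trans t (some (ξ n)) (f (n + 1))

/-- An infinite sequence of `τ`-transitions starts at `s`. -/
def Diverges (L : LTS.{u}) (s : L.State) : Prop :=
  ∃ f : ℕ → L.State, f 0 = s ∧ ∀ n, L.trans (f n) none (f (n + 1))

/-- The finite prefix consisting of the first `n` actions of `ξ`. -/
def pre (ξ : ℕ → Act.{u}) (n : ℕ) : List Act.{u} := List.ofFn fun i : Fin n => ξ i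

/-! ### Semantic sets -/

/-- Traces. -/
def Tr (L : LTS.{u}) : Set (List Act.{u}) := {σ | ∃ s, L.Reach L.init σ s}

/-- Divergence traces. -/
def Div (L : LTS.{u}) : Set (List Act.{u}) := {σ | ∃ s, L.Reach L.init σ s ∧ L.Diverges s}

/-- Infinite traces. -/
def Inf (L : LTS.{u}) : Set (ℕ → Act.{u}) := {ξ | L.InfReach L.init ξ}

/-- Stable failures. -/
def Sf (L : LTS.{u}) : Set (List Act.{u} × Set Act.{u}) :=
  {p | p.2 ⊆ L.alphabet ∧ ∃ s, L.Reach L.init p.1 s ∧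
    (∀ s', ¬ L.trans s none s') ∧ ∀ a ∈ p.2, ∀ s', ¬ L.trans s (some a) s'}

/-- Minimal divergence traces. -/
def minD (L : LTS.{u}) : Set (List Act.{u}) :=
  {σ | σ ∈ L.Div ∧ ∀ i < σ.length, σ.take i ∉ L.Div}

/-- Finite extensions of minimal divergence traces. -/
def extT (L : LTS.{u}) : Set (List Act.{u}) :=
  {σ | (∀ a ∈ σ, a ∈ L.alphabet) ∧ ∃ i ≤ σ.length, σ.take i ∈ L.minD}

/-- Infinite extensions of minimal divergence traces. -/
def extI (L : LTS.{u}) : Set (ℕ → Act.{u}) :=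
  {ξ | (∀ n, ξ n ∈ L.alphabet) ∧ ∃ i, pre ξ i ∈ L.minD}

/-- Always-nondivergent traces. -/
def anT (L : LTS.{u}) : Set (List Act.{u}) := L.Tr \ L.extT

/-- Always-nondivergent infinite traces. -/
def anI (L : LTS.{u}) : Set (ℕ → Act.{u}) := L.Inf \ L.extI

/-- Eventually-always-nondivergent infinite traces. -/
def eanI (L : LTS.{u}) : Set (ℕ → Act.{u}) :=
  {ξ | ξ ∈ L.Inf ∧ ∃ n, ∀ i ≥ n, pre ξ i ∉ L.Div}

/-- Always-eventually-nondivergent infinite traces. -/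
def aenI (L : LTS.{u}) : Set (ℕ → Act.{u}) :=
  {ξ | ξ ∈ L.Inf ∧ ∀ n, ∃ i ≥ n, pre ξ i ∉ L.Div}

/-- Always nondivergent failures. -/
def anF (L : LTS.{u}) : Set (List Act.{u} × Set Act.{u}) :=
  {p | p ∈ L.Sf ∧ p.1 ∉ L.extT}

/-- Strongly always nondivergent failures. -/
def sanF (L : LTS.{u}) : Set (List Act.{u} × Set Act.{u}) :=
  {p | p ∈ L.anF ∧ ∀ a ∈ p.2, p.1 ++ [a] ∉ L.minD}

/-! ### Equivalences -/

/-- CFFD-equivalence: the equivalence induced by `Σ`, `Sf`, `Div` and `Inf`. -/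
def CFFD (L L' : LTS.{u}) : Prop :=
  L.alphabet = L'.alphabet ∧ L.Sf = L'.Sf ∧ L.Div = L'.Div ∧ L.Inf = L'.Inf

/-- `R` is a congruence: an equivalence that is respected by action prefix, hiding,
relational renaming and parallel composition. -/
structure IsCongruence (R : LTS.{u} → LTS.{u} → Prop) : Prop where
  equiv : Equivalence R
  actPrefix : ∀ (a : Act.{u}) (L L' : LTS.{u}), R L L' → R (L.actPrefix a) (L'.actPrefix a)
  hide : ∀ (A : Set Act.{u}), Small.{u} A →
    ∀ L L' : LTS.{u}, R L L' → R (L.hide A) (L'.hide A)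
  rename : ∀ (Φ : Set (Act.{u} × Act.{u})) [Small.{u} Φ],
    ∀ L L' : LTS.{u}, R L L' → R (L.rename Φ) (L'.rename Φ)
  par_right : ∀ L L' M : LTS.{u}, R L L' → R (L.par M) (L'.par M)
  par_left : ∀ L L' M : LTS.{u}, R L L' → R (M.par L) (M.par L')

/-- `R` preserves the semantic function `X`. -/
def Preserves {β : Type*} (R : LTS.{u} → LTS.{u} → Prop) (X : LTS.{u} → β) : Prop :=
  ∀ L L' : LTS.{u}, R L L' → X L = X L'

end LTS

/-!
# Congruences that do not preserve `sanF`

The semantic sets preserved by a congruence `R` are compared by running a process `X` under a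
controller `N`: in `ctl N X` both run in parallel and the actions of `X` are hidden. As `R` is a
congruence, `R X Y` implies `R (ctl N X) (ctl N Y)`, so each observable difference between these two
is one that `R` makes.

*Lower bounds.* Let the controller execute a trace or an infinite sequence `ξ` of `L` and signal its
progress by a fresh visible action, the mark. If the controller diverges at the end, then a trace of
`L` becomes a divergence; if `ξ` is infinite, then hiding turns an infinite trace of `L` into a
divergence. Hence a congruence that preserves `minD` preserves `anT` and `anI`, and one that
preserves `Div` preserves `Tr` and `eanI` (`preserves_anT`, `preserves_anI`, `preserves_Tr_of_Div`,
`preserves_eanI`). Likewise, a congruence that preserves `Inf` preserves `Tr`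
(`preserves_Tr_of_Inf`). The alphabet is preserved too, since it decides whether an action of a
second process has to be synchronised (`preserves_alphabet`).

*Upper bounds.* If `R` does not preserve a set, then a suitable controller condenses a pair of
processes that shows this into a pair `K`, `K'` of related processes whose only visible action is a
fresh `c` (`separates_sanF`, `separates_Tr`, `separates_Div`, `separates_Inf`, `separates_aenI`).
Now `K` and `K'` serve as components: an arbitrary `L` is enriched with additional behaviour that is
guarded by `c`, in such a way that it contributes nothing new when driven by `K'`, but a whole
family of behaviours when driven by `K`. So `L` is related to a process that is saturated with
these behaviours.

For `sanF`, the process `L` may wait for a `c` after each visible action, where `K` may deadlock and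
`K'` may not. Thus all stable failures can be added, and `R` depends only on `Σ`, `Tr`, `Div` and
`Inf` (`related_of_semantics_eq`). For the other sets the additional behaviours are scripts, which
execute a sequence with marks inserted at positions where `L` diverges anyway, so that divergences
of the components do no harm (`exists_extension`). Thereby `L` can be saturated with all divergence
traces (`exists_extension_Div`), traces (`exists_extension_Tr`) or infinite traces
(`exists_extension_Inf_of_eventually`, `exists_extension_Inf_of_frequently`) that are not determined
by the sets listed in the theorem. Processes that agree on the listed sets have the same saturation,
so they are related.
-/

namespace LTS

variable {L A B : LTS.{u}}

/-! ### Paths -/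

theorem Reach.tau_left {s t u : L.State} {σ : List Act.{u}} (h : L.TauReach s t)
    (h' : L.Reach t σ u) : L.Reach s σ u := by
  cases σ with
  | nil => exact Relation.ReflTransGen.trans h h'
  | cons a σ =>
    obtain ⟨v, w, h1, h2, h3⟩ := h'
    exact ⟨v, w, Relation.ReflTransGen.trans h h1, h2, h3⟩

theorem reach_append_iff {s u : L.State} {σ ρ : List Act.{u}} :
    L.Reach s (σ ++ ρ) u ↔ ∃ t, L.Reach s σ t ∧ L.Reach t ρ u := by
  induction σ generalizing s with
  | nil =>
    exact ⟨fun h => ⟨s, Relation.ReflTransGen.refl, h⟩, fun ⟨t, h, h'⟩ => Reach.tau_left h h'⟩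
  | cons a σ ih =>
    constructor
    · rintro ⟨v, w, h1, h2, h3⟩
      obtain ⟨t, h4, h5⟩ := ih.1 h3
      exact ⟨t, ⟨v, w, h1, h2, h4⟩, h5⟩
    · rintro ⟨t, ⟨v, w, h1, h2, h4⟩, h5⟩
      exact ⟨v, w, h1, h2, ih.2 ⟨t, h4, h5⟩⟩

theorem Reach.append {s t u : L.State} {σ ρ : List Act.{u}} (h : L.Reach s σ t)
    (h' : L.Reach t ρ u) : L.Reach s (σ ++ ρ) u :=
  reach_append_iff.2 ⟨t, h, h'⟩

theorem Reach.refl (s : L.State) : L.Reach s [] s := Relation.ReflTransGen.refl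

theorem Reach.of_tau {s t : L.State} (h : L.trans s none t) : L.Reach s [] t :=
  Relation.ReflTransGen.single h

theorem Reach.of_vis {s t : L.State} {a : Act.{u}} (h : L.trans s (some a) t) :
    L.Reach s [a] t :=
  ⟨s, t, Relation.ReflTransGen.refl, h, Relation.ReflTransGen.refl⟩

theorem Reach.tau_right {s t u : L.State} {σ : List Act.{u}} (h : L.Reach s σ t)
    (h' : L.Reach t [] u) : L.Reach s σ u := by
  simpa using h.append h'

/-- `Reach` is the least relation that contains the empty path and is closed under appending a
single transition. -/
theorem Reach.induction {s : L.State} {P : List Act.{u} → L.State → Prop} (h0 : P [] s)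
    (hτ : ∀ σ t t', P σ t → L.trans t none t' → P σ t')
    (hv : ∀ σ t a t', P σ t → L.trans t (some a) t' → P (σ ++ [a]) t')
    {σ : List Act.{u}} {t : L.State} (h : L.Reach s σ t) : P σ t := by
  have tau : ∀ {σ t t'}, P σ t → L.TauReach t t' → P σ t' := by
    intro σ t t' hP h
    induction h with
    | refl => exact hP
    | tail _ h ih => exact hτ _ _ _ ih h
  induction σ using List.reverseRecOn generalizing t with
  | nil => exact tau h0 h
  | append_singleton σ a ih =>
    obtain ⟨v, h1, w, x, h2, h3, h4⟩ := reach_append_iff.1 h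
    exact tau (hv _ _ _ _ (tau (ih h1) h2) h3) h4

theorem Reach.mem_alphabet {s t : L.State} {σ : List Act.{u}} (h : L.Reach s σ t) :
    ∀ a ∈ σ, a ∈ L.alphabet := by
  refine Reach.induction (P := fun σ _ => ∀ a ∈ σ, a ∈ L.alphabet) ?_ ?_ ?_ h
  · simp
  · exact fun _ _ _ h _ => h
  · intro σ t a t' h h' b hb
    rcases List.mem_append.1 hb with hb | hb
    · exact h b hb
    · rw [List.mem_singleton.1 hb]; exact L.trans_mem _ _ _ h'

theorem nil_mem_Tr (L : LTS.{u}) : [] ∈ L.Tr := ⟨L.init, Reach.refl _⟩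

theorem Div_subset_Tr (L : LTS.{u}) : L.Div ⊆ L.Tr := fun _ ⟨s, h, _⟩ => ⟨s, h⟩

theorem Tr_mem_alphabet {σ : List Act.{u}} (h : σ ∈ L.Tr) : ∀ a ∈ σ, a ∈ L.alphabet :=
  h.elim fun _ h => h.mem_alphabet

theorem Tr_of_append {σ ρ : List Act.{u}} (h : σ ++ ρ ∈ L.Tr) : σ ∈ L.Tr := by
  obtain ⟨s, h⟩ := h
  obtain ⟨t, h, -⟩ := reach_append_iff.1 h
  exact ⟨t, h⟩

theorem Tr_take {σ : List Act.{u}} (h : σ ∈ L.Tr) (i : ℕ) : σ.take i ∈ L.Tr :=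
  Tr_of_append (ρ := σ.drop i) (by rwa [List.take_append_drop])

/-! ### Finite prefixes of infinite sequences -/

theorem pre_succ (ξ : ℕ → Act.{u}) (n : ℕ) : pre ξ (n + 1) = pre ξ n ++ [ξ n] := by
  rw [pre, List.ofFn_succ', List.concat_eq_append]
  rfl

theorem pre_zero (ξ : ℕ → Act.{u}) : pre ξ 0 = [] := by simp [pre]

theorem length_pre (ξ : ℕ → Act.{u}) (n : ℕ) : (pre ξ n).length = n := by simp [pre]

theorem pre_const (c : Act.{u}) (n : ℕ) : pre (fun _ => c) n = List.replicate n c := by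
  simp [pre, List.ofFn_const]

theorem pre_prefix (ξ : ℕ → Act.{u}) {m n : ℕ} (h : m ≤ n) : pre ξ m <+: pre ξ n := by
  induction h with
  | refl => exact List.prefix_refl _
  | step _ ih => exact ih.trans (by rw [pre_succ]; exact List.prefix_append _ _)

theorem take_pre (ξ : ℕ → Act.{u}) {m n : ℕ} (h : m ≤ n) : (pre ξ n).take m = pre ξ m := by
  have := List.prefix_iff_eq_take.1 (pre_prefix ξ h)
  rw [length_pre] at this
  exact this.symm

theorem mem_pre {ξ : ℕ → Act.{u}} {n : ℕ} {a : Act.{u}} :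
    a ∈ pre ξ n ↔ ∃ k < n, ξ k = a := by
  simp only [pre, List.mem_ofFn]
  exact ⟨fun ⟨i, h⟩ => ⟨i, i.2, h⟩, fun ⟨k, hk, h⟩ => ⟨⟨k, hk⟩, h⟩⟩

theorem eq_of_pre_eq {ξ ζ : ℕ → Act.{u}} (h : ∀ n, pre ξ n = pre ζ n) : ξ = ζ := by
  funext n
  have := h (n + 1)
  rw [pre_succ, pre_succ, h n] at this
  simpa using this

/-- The elements of a list as the first entries of an infinite sequence; the remaining entries
are irrelevant. -/
def ofList (σ : List Act.{u}) (n : ℕ) : Act.{u} := σ.getD n ∅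

theorem pre_ofList (σ : List Act.{u}) {n : ℕ} (h : n ≤ σ.length) :
    pre (ofList σ) n = σ.take n := by
  induction n with
  | zero => simp [pre_zero]
  | succ n ih =>
    rw [pre_succ, ih (by omega), List.take_succ_eq_append_getElem (by omega), ofList,
      List.getD_eq_getElem _ _ (show n < σ.length by omega)]

theorem pre_ofList_length (σ : List Act.{u}) : pre (ofList σ) σ.length = σ := by
  rw [pre_ofList σ le_rfl, List.take_length]

theorem ofList_mem {σ : List Act.{u}} {k : ℕ} (hk : k < σ.length) : ofList σ k ∈ σ := by
  rw [ofList, List.getD_eq_getElem _ _ hk]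
  exact List.getElem_mem hk

/-! ### Infinite paths -/

theorem infReach_of_reach {ξ : ℕ → Act.{u}} (x : ℕ → L.State)
    (h : ∀ n, L.Reach (x n) [ξ n] (x (n + 1))) : L.InfReach (x 0) ξ := by
  choose t t' h1 h2 h3 using h
  refine ⟨fun n => n.casesOn (x 0) t', rfl, fun n => ⟨t n, ?_, h2 n⟩⟩
  cases n with
  | zero => exact h1 0
  | succ n => exact Relation.ReflTransGen.trans (h3 n) (h1 (n + 1))

theorem InfReach.exists_reach {s : L.State} {ξ : ℕ → Act.{u}} (h : L.InfReach s ξ) :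
    ∃ x : ℕ → L.State, x 0 = s ∧ ∀ n, L.Reach (x n) [ξ n] (x (n + 1)) := by
  obtain ⟨f, h0, h⟩ := h
  refine ⟨f, h0, fun n => ?_⟩
  obtain ⟨t, h1, h2⟩ := h n
  exact Reach.tau_left h1 (Reach.of_vis h2)

theorem reach_pre {x : ℕ → L.State} {ξ : ℕ → Act.{u}}
    (h : ∀ n, L.Reach (x n) [ξ n] (x (n + 1))) (n : ℕ) : L.Reach (x 0) (pre ξ n) (x n) := by
  induction n with
  | zero => rw [pre_zero]; exact Reach.refl _
  | succ n ih => rw [pre_succ]; exact ih.append (h n)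

theorem pre_mem_Tr {ξ : ℕ → Act.{u}} (h : ξ ∈ L.Inf) (n : ℕ) : pre ξ n ∈ L.Tr := by
  obtain ⟨x, h0, h⟩ := InfReach.exists_reach h
  exact ⟨x n, h0 ▸ reach_pre h n⟩

theorem Inf_mem_alphabet {ξ : ℕ → Act.{u}} (h : ξ ∈ L.Inf) (n : ℕ) : ξ n ∈ L.alphabet :=
  Tr_mem_alphabet (pre_mem_Tr h (n + 1)) _ (mem_pre.2 ⟨n, n.lt_succ_self, rfl⟩)

/-- Coinduction for infinite paths: `P n` is an invariant that holds after `n` actions. -/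
theorem infReach_coind {ξ : ℕ → Act.{u}} (P : ℕ → L.State → Prop)
    (h : ∀ n s, P n s → ∃ s', L.Reach s [ξ n] s' ∧ P (n + 1) s') {s : L.State} (hs : P 0 s) :
    L.InfReach s ξ := by
  choose! g hg hP using h
  let x : ℕ → L.State := fun n => n.rec s g
  have hx : ∀ n, P n (x n) := fun n => by
    induction n with
    | zero => exact hs
    | succ n ih => exact hP n _ ih
  exact infReach_of_reach x fun n => hg n _ (hx n)

/-- An infinite sequence may be executed piece by piece, in finite (possibly empty) portions of
unbounded total length. -/
theorem infReach_concat {ξ : ℕ → Act.{u}} (x : ℕ → L.State) (i : ℕ → ℕ) (hi0 : i 0 = 0)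
    (hi : ∀ N, ∃ m, N ≤ i m)
    (h : ∀ m, ∃ ρ, pre ξ (i m) ++ ρ = pre ξ (i (m + 1)) ∧ L.Reach (x m) ρ (x (m + 1))) :
    L.InfReach (x 0) ξ := by
  have hmono : Monotone i := monotone_nat_of_le_succ fun m => by
    obtain ⟨ρ, h, -⟩ := h m
    have := congrArg List.length h
    simp only [List.length_append, length_pre] at this
    omega
  have hle : ∀ m m', m ≤ m' → ∃ ρ, pre ξ (i m) ++ ρ = pre ξ (i m') ∧ L.Reach (x m) ρ (x m') := by
    intro m m' hm
    induction hm with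
    | refl => exact ⟨[], by simp, Reach.refl _⟩
    | step _ ih =>
      obtain ⟨ρ, h1, h2⟩ := ih
      obtain ⟨ρ', h3, h4⟩ := h _
      exact ⟨ρ ++ ρ', by rw [← List.append_assoc, h1, h3], h2.append h4⟩
  refine infReach_coind
    (fun n s => ∃ m ρ, pre ξ n ++ ρ = pre ξ (i m) ∧ L.Reach s ρ (x m)) ?_
    ⟨0, [], by simp [hi0], Reach.refl _⟩
  rintro n s ⟨m, ρ, h1, h2⟩
  have : ∃ m', m ≤ m' ∧ n + 1 ≤ i m' := by
    obtain ⟨m', h⟩ := hi (n + 1)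
    exact ⟨max m m', le_max_left _ _, h.trans (hmono (le_max_right _ _))⟩
  obtain ⟨m', hm, hn⟩ := this
  obtain ⟨ρ', h3, h4⟩ := hle m m' hm
  obtain ⟨θ, hθ⟩ := pre_prefix ξ hn
  have hρ : ρ ++ ρ' = [ξ n] ++ θ := by
    apply List.append_cancel_left (as := pre ξ n)
    rw [← List.append_assoc, h1, h3, ← List.append_assoc, ← pre_succ, hθ]
  obtain ⟨t, h5, h6⟩ := reach_append_iff.1 (hρ ▸ h2.append h4)
  exact ⟨t, h5, m', θ, hθ, h6⟩

theorem infReach_cons {s t : L.State} {ξ : ℕ → Act.{u}} (h : L.Reach s [ξ 0] t)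
    (ht : L.InfReach t fun n => ξ (n + 1)) : L.InfReach s ξ := by
  obtain ⟨x, rfl, hx⟩ := ht.exists_reach
  refine infReach_of_reach (fun n => n.casesOn s x) fun n => ?_
  cases n with
  | zero => exact h
  | succ n => exact hx n

theorem InfReach.tau_left {s t : L.State} {ξ : ℕ → Act.{u}} (h : L.TauReach s t)
    (ht : L.InfReach t ξ) : L.InfReach s ξ := by
  obtain ⟨f, rfl, hf⟩ := ht
  refine ⟨fun n => n.casesOn s fun n => f (n + 1), rfl, fun n => ?_⟩
  cases n with
  | zero =>
    obtain ⟨v, h1, h2⟩ := hf 0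
    exact ⟨v, Relation.ReflTransGen.trans h h1, h2⟩
  | succ n => exact hf (n + 1)

theorem InfReach.cases {s : L.State} {ξ : ℕ → Act.{u}} (h : L.InfReach s ξ) :
    (∃ t, L.trans s none t ∧ L.InfReach t ξ) ∨
      ∃ t, L.trans s (some (ξ 0)) t ∧ L.InfReach t fun n => ξ (n + 1) := by
  obtain ⟨f, rfl, h⟩ := h
  obtain ⟨t, h1, h2⟩ := h 0
  rcases Relation.ReflTransGen.cases_head h1 with h3 | ⟨v, h3, h4⟩
  · exact Or.inr ⟨f 1, h3 ▸ h2, fun n => f (n + 1), rfl, fun n => h (n + 1)⟩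
  · refine Or.inl ⟨v, h3, InfReach.tau_left h4 ⟨fun n => n.casesOn t fun n => f (n + 1), rfl, ?_⟩⟩
    intro n
    cases n with
    | zero => exact ⟨t, Relation.ReflTransGen.refl, h2⟩
    | succ n => exact h (n + 1)

/-! ### Divergence -/

theorem diverges_iff_not_acc {s : L.State} :
    L.Diverges s ↔ ¬ Acc (fun t' t => L.trans t none t') s := by
  rw [not_acc_iff_exists_descending_chain]
  rfl

theorem Diverges.of_tau {s t : L.State} (h : L.trans s none t) (ht : L.Diverges t) :
    L.Diverges s := by
  rw [diverges_iff_not_acc] at *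
  exact fun hs => ht (hs.inv h)

theorem exists_stable {s : L.State} (h : ¬ L.Diverges s) :
    ∃ t, L.TauReach s t ∧ ∀ t', ¬ L.trans t none t' := by
  rw [diverges_iff_not_acc, not_not] at h
  induction h with
  | intro s _ ih =>
    by_cases hs : ∃ t, L.trans s none t
    · obtain ⟨t, ht⟩ := hs
      obtain ⟨v, h1, h2⟩ := ih t ht
      exact ⟨v, Relation.ReflTransGen.head ht h1, h2⟩
    · exact ⟨s, Relation.ReflTransGen.refl, fun t ht => hs ⟨t, ht⟩⟩

theorem Diverges.step {s : L.State} (h : L.Diverges s) : ∃ t, L.trans s none t ∧ L.Diverges t := by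
  obtain ⟨f, rfl, h⟩ := h
  exact ⟨f 1, h 0, fun n => f (n + 1), rfl, fun n => h (n + 1)⟩

theorem diverges_coind (P : L.State → Prop)
    (h : ∀ s, P s → ∃ s', L.trans s none s' ∧ P s') {s : L.State} (hs : P s) : L.Diverges s := by
  choose! g hg hP using h
  let x : ℕ → L.State := fun n => n.rec s fun _ => g
  have hx : ∀ n, P (x n) := fun n => by
    induction n with
    | zero => exact hs
    | succ n ih => exact hP _ ih
  exact ⟨x, rfl, fun n => hg _ (hx n)⟩

/-! ### Weak simulation -/

theorem Reach.simulate {r : A.State → B.State → Prop}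
    (hτ : ∀ a b a', r a b → A.trans a none a' → ∃ b', B.Reach b [] b' ∧ r a' b')
    (hv : ∀ a b l a', r a b → A.trans a (some l) a' → ∃ b', B.Reach b [l] b' ∧ r a' b')
    {a a' : A.State} {b : B.State} {σ : List Act.{u}} (hr : r a b) (h : A.Reach a σ a') :
    ∃ b', B.Reach b σ b' ∧ r a' b' := by
  refine Reach.induction (P := fun σ t => ∃ b', B.Reach b σ b' ∧ r t b')
    ⟨b, Reach.refl b, hr⟩ ?_ ?_ h
  · rintro σ t t' ⟨b', h1, h2⟩ h
    obtain ⟨b'', h3, h4⟩ := hτ _ _ _ h2 h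
    exact ⟨b'', h1.tau_right h3, h4⟩
  · rintro σ t a t' ⟨b', h1, h2⟩ h
    obtain ⟨b'', h3, h4⟩ := hv _ _ _ _ h2 h
    exact ⟨b'', h1.append h3, h4⟩

theorem InfReach.simulate {r : A.State → B.State → Prop}
    (hτ : ∀ a b a', r a b → A.trans a none a' → ∃ b', B.Reach b [] b' ∧ r a' b')
    (hv : ∀ a b l a', r a b → A.trans a (some l) a' → ∃ b', B.Reach b [l] b' ∧ r a' b')
    {a : A.State} {b : B.State} {ξ : ℕ → Act.{u}} (hr : r a b) (h : A.InfReach a ξ) :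
    B.InfReach b ξ := by
  obtain ⟨x, rfl, hx⟩ := h.exists_reach
  exact infReach_coind (fun n b => r (x n) b)
    (fun n s hs => Reach.simulate hτ hv hs (hx n)) hr

theorem Diverges.map {f : A.State → B.State}
    (hf : ∀ s s', A.trans s none s' → B.trans (f s) none (f s')) {s : A.State}
    (h : A.Diverges s) : B.Diverges (f s) := by
  obtain ⟨g, rfl, h⟩ := h
  exact ⟨f ∘ g, rfl, fun n => hf _ _ (h n)⟩

theorem Reach.map (f : A.State → B.State)
    (hf : ∀ s l s', A.trans s l s' → B.trans (f s) l (f s')) {s t : A.State} {σ : List Act.{u}}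
    (h : A.Reach s σ t) : B.Reach (f s) σ (f t) := by
  obtain ⟨b, h1, rfl⟩ := Reach.simulate (B := B) (r := fun a b => b = f a)
    (by rintro a _ a' rfl h; exact ⟨_, Reach.of_tau (hf _ _ _ h), rfl⟩)
    (by rintro a _ l a' rfl h; exact ⟨_, Reach.of_vis (hf _ _ _ h), rfl⟩) rfl h
  exact h1

/-- A map that preserves transitions, and whose value at the initial state is reachable
silently, embeds traces, divergence traces and infinite traces. -/
theorem semantics_subset_of_hom (f : A.State → B.State)
    (hf : ∀ s l s', A.trans s l s' → B.trans (f s) l (f s'))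
    (hi : B.TauReach B.init (f A.init)) :
    A.Tr ⊆ B.Tr ∧ A.Div ⊆ B.Div ∧ A.Inf ⊆ B.Inf := by
  refine ⟨fun σ ⟨s, h⟩ => ⟨f s, Reach.tau_left hi (h.map f hf)⟩,
    fun σ ⟨s, h, hd⟩ => ⟨f s, Reach.tau_left hi (h.map f hf), hd.map fun _ _ => hf _ _ _⟩,
    fun ξ h => ?_⟩
  obtain ⟨x, h0, hx⟩ := InfReach.exists_reach h
  refine InfReach.tau_left hi ?_
  rw [← h0]
  exact infReach_of_reach (fun n => f (x n)) fun n => (hx n).map f hf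

/-! ### Minimal divergence traces -/

theorem exists_take_mem_minD {σ : List Act.{u}} {i : ℕ} (h : σ.take i ∈ L.Div) :
    ∃ j ≤ σ.length, j ≤ i ∧ σ.take j ∈ L.minD := by
  classical
  have hex : ∃ j, σ.take j ∈ L.Div := ⟨i, h⟩
  have hle : Nat.find hex ≤ σ.length := by
    by_contra hlt
    have hspec := Nat.find_spec hex
    rw [List.take_of_length_le (not_le.1 hlt).le] at hspec
    exact Nat.find_min hex (not_le.1 hlt) (by rwa [List.take_length])
  refine ⟨Nat.find hex, hle, Nat.find_min' hex h, Nat.find_spec hex, fun k hk => ?_⟩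
  rw [List.length_take] at hk
  rw [List.take_take, min_eq_left (by omega)]
  exact Nat.find_min hex (by omega)

theorem mem_extT_iff {σ : List Act.{u}} :
    σ ∈ L.extT ↔ (∀ a ∈ σ, a ∈ L.alphabet) ∧ ∃ i, σ.take i ∈ L.Div := by
  constructor
  · rintro ⟨h, i, -, hi⟩; exact ⟨h, i, hi.1⟩
  · rintro ⟨h, i, hi⟩
    obtain ⟨j, h1, -, h2⟩ := exists_take_mem_minD hi
    exact ⟨h, j, h1, h2⟩

theorem mem_extI_iff {ξ : ℕ → Act.{u}} :
    ξ ∈ L.extI ↔ (∀ n, ξ n ∈ L.alphabet) ∧ ∃ i, pre ξ i ∈ L.Div := by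
  constructor
  · rintro ⟨h, i, hi⟩; exact ⟨h, i, hi.1⟩
  · rintro ⟨h, i, hi⟩
    have : (pre ξ i).take i ∈ L.Div := by rwa [take_pre _ le_rfl]
    obtain ⟨j, h1, h3, h2⟩ := exists_take_mem_minD this
    rw [take_pre _ h3] at h2
    exact ⟨h, j, h2⟩

theorem Div_subset_extT (L : LTS.{u}) : L.Div ⊆ L.extT := fun σ h =>
  mem_extT_iff.2 ⟨Tr_mem_alphabet (L.Div_subset_Tr h), σ.length, by rwa [List.take_length]⟩

theorem extT_congr (hal : A.alphabet = B.alphabet) (h : A.minD = B.minD) : A.extT = B.extT := by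
  simp only [extT, hal, h]

theorem extI_congr (hal : A.alphabet = B.alphabet) (h : A.minD = B.minD) : A.extI = B.extI := by
  simp only [extI, hal, h]

theorem minD_congr (h : A.Div = B.Div) : A.minD = B.minD := by
  simp only [minD, h]

/-- No set contains all actions. -/
theorem exists_fresh (S : Set Act.{u}) [Small.{u} S] : ∃ c, c ∉ S := by
  let x : ZFSet.{u} := ZFSet.range fun y : Shrink.{u} S => ((equivShrink S).symm y).1
  refine ⟨x, fun h => ZFSet.mem_irrefl x ?_⟩
  refine ZFSet.mem_range.2 ⟨equivShrink S ⟨x, h⟩, ?_⟩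
  rw [Equiv.symm_apply_apply]

/-! ### Controllers -/

/-- The controller `N` drives the component `X`: both run in parallel and all actions of `X` are
hidden. This is used when the alphabet of `X` is contained in that of `N`; the remaining actions of
`N` are the visible ones. -/
def ctl (N X : LTS.{u}) : LTS.{u} := (N.par X).hide X.alphabet

variable {N X : LTS.{u}}

theorem ctl_alphabet : (ctl N X).alphabet = N.alphabet \ X.alphabet :=
  Set.union_sdiff_right

theorem ctl_trans_none (hX : X.alphabet ⊆ N.alphabet) {n n' : N.State} {x x' : X.State} :
    (ctl N X).trans (n, x) none (n', x') ↔
      (N.trans n none n' ∧ x' = x) ∨ (X.trans x none x' ∧ n' = n) ∨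
        ∃ b ∈ X.alphabet, N.trans n (some b) n' ∧ X.trans x (some b) x' := by
  constructor
  · rintro (⟨⟨-, h, h'⟩ | ⟨-, h, h'⟩ | ⟨a, -, h, -⟩, -⟩ | ⟨-, b, hb, h | h | h⟩)
    · exact Or.inl ⟨h, h'⟩
    · exact Or.inr (Or.inl ⟨h, h'⟩)
    · cases h
    · exact absurd rfl (h.1 b hb)
    · exact absurd rfl (h.1 b (hX hb))
    · obtain ⟨a, -, h, h1, h2⟩ := h
      cases h
      exact Or.inr (Or.inr ⟨b, hb, h1, h2⟩)
  · rintro (⟨h, h'⟩ | ⟨h, h'⟩ | ⟨b, hb, h1, h2⟩)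
    · exact Or.inl ⟨Or.inl ⟨fun _ _ => nofun, h, h'⟩, fun _ _ => nofun⟩
    · exact Or.inl ⟨Or.inr (Or.inl ⟨fun _ _ => nofun, h, h'⟩), fun _ _ => nofun⟩
    · exact Or.inr ⟨rfl, b, hb, Or.inr (Or.inr ⟨b, ⟨hX hb, hb⟩, rfl, h1, h2⟩)⟩

theorem ctl_trans_some (hX : X.alphabet ⊆ N.alphabet) {n n' : N.State} {x x' : X.State}
    {a : Act.{u}} :
    (ctl N X).trans (n, x) (some a) (n', x') ↔
      a ∉ X.alphabet ∧ N.trans n (some a) n' ∧ x' = x := by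
  constructor
  · rintro (⟨⟨-, h, h'⟩ | ⟨h, h', -⟩ | ⟨b, hb, h, -⟩, ha⟩ | ⟨h, -⟩)
    · exact ⟨fun hm => ha a hm rfl, h, h'⟩
    · exact absurd rfl (h a (hX (X.trans_mem _ _ _ h')))
    · cases h
      exact absurd rfl (ha a hb.2)
    · cases h
  · rintro ⟨ha, h, h'⟩
    have : ∀ b ∈ X.alphabet, some a ≠ some b := by
      rintro b hb ⟨⟩
      exact ha hb
    exact Or.inl ⟨Or.inl ⟨this, h, h'⟩, this⟩

theorem ctl_tauReach_right (hX : X.alphabet ⊆ N.alphabet) (n : N.State) {x x' : X.State}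
    (h : X.TauReach x x') : (ctl N X).TauReach (n, x) (n, x') :=
  Relation.ReflTransGen.lift (p := fun s s' => (ctl N X).trans s none s') (fun x => (n, x))
    (fun _ _ h => (ctl_trans_none hX).2 (Or.inr (Or.inl ⟨h, rfl⟩))) _ _ h

theorem ctl_reach_of_tau (hX : X.alphabet ⊆ N.alphabet) {n n' : N.State} (x : X.State)
    (h : N.trans n none n') : (ctl N X).Reach (n, x) [] (n', x) :=
  Reach.of_tau (L := ctl N X) (s := (n, x)) (t := (n', x))
    ((ctl_trans_none hX).2 (Or.inl ⟨h, rfl⟩))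

theorem ctl_reach_of_sync (hX : X.alphabet ⊆ N.alphabet) {n n' : N.State} {x x' : X.State}
    {b : Act.{u}} (h : N.trans n (some b) n') (h' : X.trans x (some b) x') :
    (ctl N X).Reach (n, x) [] (n', x') :=
  Reach.of_tau (L := ctl N X) (s := (n, x)) (t := (n', x'))
    ((ctl_trans_none hX).2 (Or.inr (Or.inr ⟨b, X.trans_mem _ _ _ h', h, h'⟩)))

theorem ctl_reach_of_vis (hX : X.alphabet ⊆ N.alphabet) {n n' : N.State} (x : X.State)
    {a : Act.{u}} (ha : a ∉ X.alphabet) (h : N.trans n (some a) n') :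
    (ctl N X).Reach (n, x) [a] (n', x) :=
  Reach.of_vis (L := ctl N X) (s := (n, x)) (t := (n', x))
    ((ctl_trans_some hX).2 ⟨ha, h, rfl⟩)

open Classical in
/-- A path of a controlled component is a path of the controller whose projection to the actions of
the component is executed by the component. -/
theorem ctl_reach_iff (hX : X.alphabet ⊆ N.alphabet) {n n' : N.State} {x x' : X.State}
    {σ : List Act.{u}} :
    (ctl N X).Reach (n, x) σ (n', x') ↔
      ∃ ρ, N.Reach n ρ n' ∧ X.Reach x (ρ.filter (· ∈ X.alphabet)) x' ∧
        σ = ρ.filter (· ∉ X.alphabet) := by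
  constructor
  · intro h
    refine Reach.induction (L := ctl N X) (s := (n, x)) (P := fun σ t =>
      ∃ ρ, N.Reach n ρ t.1 ∧ X.Reach x (ρ.filter (· ∈ X.alphabet)) t.2 ∧
        σ = ρ.filter (· ∉ X.alphabet)) ?_ ?_ ?_ h
    · exact ⟨[], Reach.refl _, Reach.refl _, rfl⟩
    · rintro σ ⟨t, y⟩ ⟨t', y'⟩ ⟨ρ, h1, h2, rfl⟩ h
      rcases (ctl_trans_none hX).1 h with ⟨h3, rfl⟩ | ⟨h3, rfl⟩ | ⟨b, hb, h3, h4⟩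
      · exact ⟨ρ, h1.tau_right (Reach.of_tau h3), h2, rfl⟩
      · exact ⟨ρ, h1, h2.tau_right (Reach.of_tau h3), rfl⟩
      · refine ⟨ρ ++ [b], h1.append (Reach.of_vis h3), ?_, by simp [hb]⟩
        simpa [hb] using h2.append (Reach.of_vis h4)
    · rintro σ ⟨t, y⟩ a ⟨t', y'⟩ ⟨ρ, h1, h2, rfl⟩ h
      obtain ⟨ha, h3, rfl⟩ := (ctl_trans_some hX).1 h
      exact ⟨ρ ++ [a], h1.append (Reach.of_vis h3), by simpa [ha] using h2, by simp [ha]⟩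
  · rintro ⟨ρ, h1, h2, rfl⟩
    refine Reach.induction (L := N) (s := n) (P := fun ρ t => ∀ y,
      X.Reach x (ρ.filter (· ∈ X.alphabet)) y →
        (ctl N X).Reach (n, x) (ρ.filter (· ∉ X.alphabet)) (t, y)) ?_ ?_ ?_ h1 x' h2
    · exact fun y hy => ctl_tauReach_right hX n hy
    · intro ρ t t' ih h y hy
      exact Reach.tau_right (ih y hy) (ctl_reach_of_tau hX y h)
    · intro ρ t a t' ih h y hy
      by_cases ha : a ∈ X.alphabet
      · have hy' : X.Reach x (ρ.filter (· ∈ X.alphabet) ++ [a]) y := by simpa [ha] using hy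
        obtain ⟨z, h3, v, w, h4, h5, h6⟩ := reach_append_iff.1 hy'
        have h7 := Reach.tau_right (ih z h3) (ctl_tauReach_right hX t h4)
        have h8 := Reach.tau_right h7 (ctl_reach_of_sync hX h h5)
        simpa [ha] using Reach.tau_right h8 (ctl_tauReach_right hX t' h6)
      · have h7 := Reach.append (ih y (by simpa [ha] using hy)) (ctl_reach_of_vis hX y ha h)
        simpa [ha] using h7

theorem ctl_diverges_right (hX : X.alphabet ⊆ N.alphabet) (n : N.State) {x : X.State}
    (h : X.Diverges x) : (ctl N X).Diverges (n, x) :=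
  Diverges.map (B := ctl N X) (f := fun x => (n, x)) (h := h) fun _ _ h =>
    (ctl_trans_none hX).2 (Or.inr (Or.inl ⟨h, rfl⟩))

/-- A controlled component diverges only if the component does so after some silent steps, or
the controller alone can perform infinitely many silent or hidden steps. -/
theorem ctl_diverges (hX : X.alphabet ⊆ N.alphabet) {n : N.State} {x : X.State}
    (h : (ctl N X).Diverges (n, x)) :
    (N.hide X.alphabet).Diverges n ∨
      ∃ n' x', (ctl N X).TauReach (n, x) (n', x') ∧ X.Diverges x' := by
  by_contra! hcon
  obtain ⟨h0, h2⟩ := hcon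
  have h1 := not_not.1 (mt diverges_iff_not_acc.2 h0)
  suffices h3 : Acc (fun t' t => (ctl N X).trans t none t') (n, x) from
    diverges_iff_not_acc.1 h h3
  clear h h0
  revert x
  induction h1 with
  | intro n _ ihn =>
  intro x h2
  have hx := h2 n x Relation.ReflTransGen.refl
  rw [diverges_iff_not_acc, not_not] at hx
  induction hx with
  | intro x _ ihx =>
  refine Acc.intro _ ?_
  rintro ⟨n', x'⟩ ht
  have h2' : ∀ n'' x'', (ctl N X).TauReach (n', x') (n'', x'') → ¬ X.Diverges x'' :=
    fun n'' x'' h => h2 n'' x'' (Relation.ReflTransGen.head ht h)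
  rcases (ctl_trans_none hX).1 ht with ⟨h, rfl⟩ | ⟨h, rfl⟩ | ⟨b, hb, h3, h4⟩
  · exact ihn n' (Or.inl ⟨h, fun _ _ => nofun⟩) h2'
  · exact ihx x' h h2'
  · exact ihn n' (Or.inr ⟨rfl, b, hb, h3⟩) h2'

theorem ctl_mem_Div (hX : X.alphabet ⊆ N.alphabet) {σ : List Act.{u}} (h : σ ∈ (ctl N X).Div) :
    ∃ n x, (ctl N X).Reach (ctl N X).init σ (n, x) ∧
      ((N.hide X.alphabet).Diverges n ∨ X.Diverges x) := by
  obtain ⟨⟨n, x⟩, h1, h2⟩ := h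
  rcases ctl_diverges hX h2 with h | ⟨n', x', h3, h4⟩
  · exact ⟨n, x, h1, Or.inl h⟩
  · exact ⟨n', x', h1.tau_right h3, Or.inr h4⟩

theorem IsCongruence.ctl {R : LTS.{u} → LTS.{u} → Prop} (hR : IsCongruence R)
    (N : LTS.{u}) {X Y : LTS.{u}} (hXY : X.alphabet = Y.alphabet) (h : R X Y) :
    R (N.ctl X) (N.ctl Y) := by
  rw [LTS.ctl, LTS.ctl, hXY]
  exact hR.hide _ inferInstance _ _ (hR.par_left _ _ _ h)

/-! ### Action prefix -/

variable {L : LTS.{u}} {c : Act.{u}}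

theorem actPrefix_reach_some {s t : L.State} {σ : List Act.{u}} (h : L.Reach s σ t) :
    (L.actPrefix c).Reach (some s) σ (some t) := by
  obtain ⟨b, h1, rfl⟩ := Reach.simulate (B := L.actPrefix c)
    (r := fun (a : L.State) (b : (L.actPrefix c).State) => b = some a)
    (by
      rintro a _ a' rfl h
      exact ⟨_, Reach.of_tau (L := L.actPrefix c) (s := some a) (t := some a') h, rfl⟩)
    (by
      rintro a _ l a' rfl h
      exact ⟨_, Reach.of_vis (L := L.actPrefix c) (s := some a) (t := some a') h, rfl⟩) rfl h
  exact h1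

theorem actPrefix_reach {σ : List Act.{u}} {s : Option L.State}
    (h : (L.actPrefix c).Reach none σ s) :
    (σ = [] ∧ s = none) ∨ ∃ ρ t, σ = c :: ρ ∧ s = some t ∧ L.Reach L.init ρ t := by
  refine Reach.induction (L := L.actPrefix c) (s := none) (P := fun σ s =>
    (σ = [] ∧ s = none) ∨ ∃ ρ t, σ = c :: ρ ∧ s = some t ∧ L.Reach L.init ρ t) ?_ ?_ ?_ h
  · exact Or.inl ⟨rfl, rfl⟩
  · rintro σ t (_ | t') (⟨rfl, rfl⟩ | ⟨ρ, t, rfl, rfl, h⟩) h'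
    · exact Or.inl ⟨rfl, rfl⟩
    · exact h'.elim
    · cases h'.1
    · exact Or.inr ⟨ρ, t', rfl, rfl, h.tau_right (Reach.of_tau h')⟩
  · rintro σ t a (_ | t') (⟨rfl, rfl⟩ | ⟨ρ, t, rfl, rfl, h⟩) h'
    · exact h'.elim
    · exact h'.elim
    · cases h'.1
      exact Or.inr ⟨[], t', rfl, rfl, h'.2 ▸ Reach.refl _⟩
    · exact Or.inr ⟨ρ ++ [a], t', rfl, rfl, h.append (Reach.of_vis h')⟩

theorem actPrefix_reach_cons {σ : List Act.{u}} {s : L.State} (h : L.Reach L.init σ s) :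
    (L.actPrefix c).Reach none (c :: σ) (some s) :=
  Reach.append (σ := [c]) (Reach.of_vis (L := L.actPrefix c) (t := some L.init) ⟨rfl, rfl⟩)
    (actPrefix_reach_some h)

theorem cons_mem_Tr_actPrefix {σ : List Act.{u}} : c :: σ ∈ (L.actPrefix c).Tr ↔ σ ∈ L.Tr := by
  constructor
  · rintro ⟨s, h⟩
    rcases actPrefix_reach h with ⟨h, -⟩ | ⟨ρ, t, h1, -, h2⟩
    · cases h
    · cases h1; exact ⟨t, h2⟩
  · rintro ⟨s, h⟩
    exact ⟨some s, actPrefix_reach_cons h⟩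

theorem actPrefix_diverges_some {s : L.State} :
    (L.actPrefix c).Diverges (some s) ↔ L.Diverges s := by
  constructor
  · rintro ⟨f, h0, h⟩
    have hs : ∀ n, ∃ t, f n = some t := by
      intro n
      cases n with
      | zero => exact ⟨s, h0⟩
      | succ n =>
        have := h n
        cases hf : f (n + 1) with
        | some t => exact ⟨t, rfl⟩
        | none => rw [hf] at this; cases hfn : f n <;> rw [hfn] at this <;> exact False.elim this
    choose g hg using hs
    refine ⟨g, Option.some.inj ((hg 0).symm.trans h0), fun n => ?_⟩
    have := h n
    rwa [hg, hg] at this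
  · exact fun h => Diverges.map (B := L.actPrefix c) (f := fun t => some t) (h := h) fun _ _ h => h

theorem cons_mem_Div_actPrefix {σ : List Act.{u}} :
    c :: σ ∈ (L.actPrefix c).Div ↔ σ ∈ L.Div := by
  constructor
  · rintro ⟨s, h, hd⟩
    rcases actPrefix_reach h with ⟨h, -⟩ | ⟨ρ, t, h1, rfl, h2⟩
    · cases h
    · cases h1; exact ⟨t, h2, actPrefix_diverges_some.1 hd⟩
  · rintro ⟨s, h, hd⟩
    exact ⟨some s, actPrefix_reach_cons h, actPrefix_diverges_some.2 hd⟩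

theorem nil_not_mem_Div_actPrefix : [] ∉ (L.actPrefix c).Div := by
  rintro ⟨s, h, f, hf, hd⟩
  rcases actPrefix_reach h with ⟨-, rfl⟩ | ⟨ρ, t, h1, -⟩
  · have := hd 0
    rw [hf] at this
    cases hf1 : f (0 + 1) with
    | none => rw [hf1] at this; exact this.elim
    | some t => rw [hf1] at this; cases this.1
  · cases h1

theorem const_mem_Inf_actPrefix :
    (fun _ => c) ∈ (L.actPrefix c).Inf ↔ (fun _ => c) ∈ L.Inf := by
  constructor
  · intro h
    obtain ⟨x, h0, h⟩ := InfReach.exists_reach h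
    have hs : ∀ n, ∃ t, x (n + 1) = some t ∧ L.Reach L.init (pre (fun _ => c) n) t := by
      intro n
      have h1 := reach_pre h (n + 1)
      rw [h0] at h1
      rcases actPrefix_reach h1 with ⟨h2, -⟩ | ⟨ρ, t, h2, h3, h4⟩
      · simpa [length_pre] using congrArg List.length h2
      · refine ⟨t, h3, ?_⟩
        rw [pre_const, List.replicate_succ] at h2
        cases h2
        rwa [pre_const]
    choose y hy hr using hs
    have hy0 : L.TauReach L.init (y 0) := by have := hr 0; rwa [pre_zero] at this
    refine InfReach.tau_left hy0 (infReach_of_reach y fun n => ?_)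
    have h1 := h (n + 1)
    rw [hy, hy] at h1
    obtain ⟨b, h2, h3⟩ := Reach.simulate (B := L)
      (r := fun (a : (L.actPrefix c).State) (b : L.State) => a = some b)
      (by
        rintro _ b (_ | a') rfl h
        · exact h.elim
        · exact ⟨a', Reach.of_tau h, rfl⟩)
      (by
        rintro _ b l (_ | a') rfl h
        · exact h.elim
        · exact ⟨a', Reach.of_vis h, rfl⟩) rfl h1
    cases h3
    exact h2
  · intro h
    obtain ⟨x, h0, h⟩ := InfReach.exists_reach h
    refine infReach_of_reach (L := L.actPrefix c)
      (fun n => n.casesOn none fun n => some (x n)) fun n => ?_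
    cases n with
    | zero =>
      exact Reach.of_vis (L := L.actPrefix c) (t := some (x 0)) ⟨rfl, h0⟩
    | succ n => exact actPrefix_reach_some (h n)

/-! ### Scripts -/

/-- The transitions of `script`. In the position `(i, p)`, the first `i` actions of `ξ` and `p` of
the marks that precede the next action have been executed. -/
inductive ScriptTrans (S : Set Act.{u}) (c : Act.{u}) (ξ : ℕ → Act.{u}) (q : ℕ → ℕ) (len : ℕ∞)
    (d : Prop) : ℕ × ℕ → Option Act.{u} → ℕ × ℕ → Prop
  | mark {i p : ℕ} (h : p < q i) : ScriptTrans S c ξ q len d (i, p) (some c) (i, p + 1)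
  | act {i : ℕ} (hm : ξ i ∈ S) (h : (i : ℕ∞) < len) :
      ScriptTrans S c ξ q len d (i, q i) (some (ξ i)) (i + 1, 0)
  | spin {i : ℕ} (hd : d) (h : (i : ℕ∞) = len) :
      ScriptTrans S c ξ q len d (i, q i) none (i, q i)

theorem ScriptTrans.of_none {S : Set Act.{u}} {c : Act.{u}} {ξ : ℕ → Act.{u}} {q : ℕ → ℕ}
    {len : ℕ∞} {d : Prop} {s s' : ℕ × ℕ} (h : ScriptTrans S c ξ q len d s none s') :
    d ∧ (s.1 : ℕ∞) = len ∧ s.2 = q s.1 := by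
  cases h with
  | spin hd h => exact ⟨hd, h, rfl⟩

theorem ScriptTrans.of_some {S : Set Act.{u}} {c : Act.{u}} {ξ : ℕ → Act.{u}} {q : ℕ → ℕ}
    {len : ℕ∞} {d : Prop} {s s' : ℕ × ℕ} {b : Act.{u}}
    (h : ScriptTrans S c ξ q len d s (some b) s') : b = c ∨ s'.1 = s.1 + 1 := by
  cases h with
  | mark h => exact Or.inl rfl
  | act hm h => exact Or.inr rfl

/-- The linear process that executes the first `len` actions of `ξ`, preceding the `i`-th one by
`q i` occurrences of the mark `c`. The marks belonging to the position `len` come last, and are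
followed by a `τ`-loop if `d` holds. -/
def script (S : Set Act.{u}) [Small.{u} S] (c : Act.{u}) (ξ : ℕ → Act.{u}) (q : ℕ → ℕ) (len : ℕ∞)
    (d : Prop) : LTS.{u} where
  State := ULift.{u} (ℕ × ℕ)
  alphabet := insert c S
  small_alphabet := inferInstance
  trans s l s' := ScriptTrans S c ξ q len d s.down l s'.down
  trans_mem := by
    rintro ⟨s⟩ a ⟨s'⟩ h
    cases h with
    | mark h => exact Set.mem_insert _ _
    | act hm h => exact Set.mem_insert_of_mem _ hm
  init := ⟨(0, 0)⟩

/-- The number of marks executed by a script before it reaches the position `(i, p)`. -/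
def cnt (q : ℕ → ℕ) (i p : ℕ) : ℕ := (∑ k ∈ Finset.range i, q k) + p

theorem cnt_zero (q : ℕ → ℕ) (p : ℕ) : cnt q 0 p = p := by simp [cnt]

theorem cnt_succ (q : ℕ → ℕ) (i p : ℕ) : cnt q (i + 1) p = cnt q i (q i) + p := by
  simp [cnt, Finset.sum_range_succ]

theorem cnt_add (q : ℕ → ℕ) (i p r : ℕ) : cnt q i (p + r) = cnt q i p + r :=
  (Nat.add_assoc _ _ _).symm

theorem cnt_succ_zero (q : ℕ → ℕ) (i : ℕ) : cnt q (i + 1) 0 = cnt q i 0 + q i := by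
  simp [cnt, Finset.sum_range_succ]

theorem cnt_mono (q : ℕ → ℕ) {i j p : ℕ} (h : i ≤ j) : cnt q i p ≤ cnt q j p :=
  Nat.add_le_add_right (Finset.sum_le_sum_of_subset (Finset.range_mono h)) p

theorem cnt_eq_of_forall_eq_zero {q : ℕ → ℕ} {i : ℕ} (h : ∀ k < i, q k = 0) (p : ℕ) :
    cnt q i p = p := by
  rw [cnt, Finset.sum_eq_zero fun k hk => h k (Finset.mem_range.1 hk), zero_add]

theorem cnt_unbounded {q : ℕ → ℕ} (hq : ∀ n, ∃ i ≥ n, 0 < q i) (B : ℕ) : ∃ i, B ≤ cnt q i 0 := by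
  induction B with
  | zero => exact ⟨0, Nat.zero_le _⟩
  | succ B ih =>
    obtain ⟨i, hi⟩ := ih
    obtain ⟨j, hj, hq⟩ := hq i
    refine ⟨j + 1, ?_⟩
    have h1 : cnt q i 0 ≤ cnt q j 0 := cnt_mono q hj
    rw [cnt_succ_zero]
    omega

/-- `q` inserts `r` marks at position `n`, and none elsewhere. -/
def markAt (n r : ℕ) (i : ℕ) : ℕ := if i = n then r else 0

theorem markAt_self (n r : ℕ) : markAt n r n = r := if_pos rfl

theorem markAt_of_ne {n r i : ℕ} (h : i ≠ n) : markAt n r i = 0 := if_neg h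

theorem cnt_markAt_of_le {n r i p : ℕ} (h : i ≤ n) : cnt (markAt n r) i p = p :=
  cnt_eq_of_forall_eq_zero (fun _ hk => markAt_of_ne (by omega)) p

theorem cnt_markAt_of_lt {n r i p : ℕ} (h : n < i) : cnt (markAt n r) i p = r + p := by
  simp only [cnt, markAt]
  rw [Finset.sum_ite_eq' (Finset.range i) n, if_pos (Finset.mem_range.2 h)]

section Script

variable {S : Set Act.{u}} [Small.{u} S] {c : Act.{u}} {ξ : ℕ → Act.{u}} {q : ℕ → ℕ} {len : ℕ∞}
  {d : Prop}

/-- The trace of a script between two positions, projected to the scripted actions and to the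
marks. -/
theorem script_reach {P Q : Act.{u} → Bool} (hPS : ∀ a ∈ S, P a = true) (hPc : P c = false)
    (hQS : ∀ a ∈ S, Q a = false) (hQc : Q c = true) {i p i' p' : ℕ} {ρ : List Act.{u}}
    (hp : p ≤ q i) (hi : (i : ℕ∞) ≤ len)
    (h : (script S c ξ q len d).Reach ⟨(i, p)⟩ ρ ⟨(i', p')⟩) :
    p' ≤ q i' ∧ (i' : ℕ∞) ≤ len ∧ pre ξ i ++ ρ.filter P = pre ξ i' ∧
      ∃ b, ρ.filter Q = List.replicate b c ∧ cnt q i p + b = cnt q i' p' := by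
  refine Reach.induction (L := script S c ξ q len d) (s := ⟨(i, p)⟩) (P := fun ρ s =>
    s.down.2 ≤ q s.down.1 ∧ (s.down.1 : ℕ∞) ≤ len ∧ pre ξ i ++ ρ.filter P = pre ξ s.down.1 ∧
      ∃ b, ρ.filter Q = List.replicate b c ∧ cnt q i p + b = cnt q s.down.1 s.down.2) ?_ ?_ ?_ h
  · exact ⟨hp, hi, by simp, 0, rfl, rfl⟩
  · rintro ρ ⟨s⟩ ⟨s'⟩ ih h
    cases h with
    | spin hd h => exact ih
  · rintro ρ ⟨s⟩ a ⟨s'⟩ ⟨h1, h2, h3, b, h4, h5⟩ h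
    cases h with
    | mark h =>
      refine ⟨h, h2, by simpa [hPc] using h3, b + 1, ?_, ?_⟩
      · simp [hQc, h4, List.replicate_succ']
      · rw [cnt_add, ← h5, Nat.add_assoc]
    | act hm h =>
      refine ⟨Nat.zero_le _, ?_, ?_, b, ?_, ?_⟩
      · simpa using Order.add_one_le_of_lt h
      · rw [pre_succ, ← h3]
        simp [hPS _ hm]
      · simpa [hQS _ hm] using h4
      · rw [cnt_succ]; exact h5

theorem script_reach_mark (i : ℕ) {p : ℕ} (hp : p ≤ q i) :
    (script S c ξ q len d).Reach ⟨(i, 0)⟩ (List.replicate p c) ⟨(i, p)⟩ := by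
  induction p with
  | zero => exact Reach.refl _
  | succ p ih =>
    rw [List.replicate_succ']
    exact (ih (by omega)).append (Reach.of_vis (L := script S c ξ q len d) (s := ⟨(i, p)⟩)
      (t := ⟨(i, p + 1)⟩) (ScriptTrans.mark hp))

theorem script_reach_act {i : ℕ} (hm : ξ i ∈ S) (h : (i : ℕ∞) < len) :
    (script S c ξ q len d).Reach ⟨(i, q i)⟩ [ξ i] ⟨(i + 1, 0)⟩ :=
  Reach.of_vis (L := script S c ξ q len d) (s := ⟨(i, q i)⟩)
    (t := ⟨(i + 1, 0)⟩) (ScriptTrans.act hm h)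

theorem exists_script_reach {i p : ℕ} (hp : p ≤ q i) (hi : (i : ℕ∞) ≤ len)
    (hm : ∀ k < i, ξ k ∈ S) : ∃ ρ, (script S c ξ q len d).Reach ⟨(0, 0)⟩ ρ ⟨(i, p)⟩ := by
  induction i generalizing p with
  | zero => exact ⟨_, script_reach_mark 0 hp⟩
  | succ i ih =>
    have hlt : (i : ℕ∞) < len := lt_of_lt_of_le (by exact_mod_cast i.lt_succ_self) hi
    obtain ⟨ρ, h⟩ := ih (p := q i) le_rfl hlt.le fun k hk => hm k (by omega)
    exact ⟨_, (h.append (script_reach_act (hm i (by omega)) hlt)).append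
      (script_reach_mark (i + 1) hp)⟩

end Script

/-! ### Scripts whose actions are executed by the component and whose marks are visible -/

section Runner

variable {L : LTS.{u}} {c : Act.{u}} {ξ : ℕ → Act.{u}} {q : ℕ → ℕ} {len : ℕ∞} {d : Prop}

/-- `L` follows the script `ξ`; only the marks `c` are visible. -/
def runner (L : LTS.{u}) (c : Act.{u}) (ξ : ℕ → Act.{u}) (q : ℕ → ℕ) (len : ℕ∞) (d : Prop) :
    LTS.{u} :=
  ctl (script L.alphabet c ξ q len d) L

theorem runner_subset : L.alphabet ⊆ (script L.alphabet c ξ q len d).alphabet :=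
  Set.subset_insert _ _

theorem insert_sdiff_eq_singleton {S : Set Act.{u}} {c : Act.{u}} (hc : c ∉ S) :
    insert c S \ S = {c} := by
  rw [Set.insert_sdiff_of_notMem _ hc, Set.sdiff_self, insert_empty_eq]

theorem runner_alphabet (hc : c ∉ L.alphabet) : (runner L c ξ q len d).alphabet = {c} := by
  rw [runner, ctl_alphabet]
  exact insert_sdiff_eq_singleton hc

theorem runner_reach (hc : c ∉ L.alphabet) {i p i' p' : ℕ} {x x' : L.State} {σ : List Act.{u}}
    (hp : p ≤ q i) (hi : (i : ℕ∞) ≤ len)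
    (h : (runner L c ξ q len d).Reach (⟨(i, p)⟩, x) σ (⟨(i', p')⟩, x')) :
    p' ≤ q i' ∧ (i' : ℕ∞) ≤ len ∧ ∃ ρ b, pre ξ i ++ ρ = pre ξ i' ∧ L.Reach x ρ x' ∧
      σ = List.replicate b c ∧ cnt q i p + b = cnt q i' p' := by
  classical
  obtain ⟨ρ, h1, h2, rfl⟩ := (ctl_reach_iff runner_subset).1 h
  obtain ⟨h3, h4, h5, b, h6, h7⟩ := script_reach (P := fun a => decide (a ∈ L.alphabet))
    (Q := fun a => decide (a ∉ L.alphabet)) (by simp) (by simpa using hc) (by simp)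
    (by simpa using hc) hp hi h1
  exact ⟨h3, h4, _, b, h5, h2, h6, h7⟩

theorem runner_reach_of_reach (hc : c ∉ L.alphabet) {i p : ℕ} {x : L.State} (hp : p ≤ q i)
    (hi : (i : ℕ∞) ≤ len) (h : L.Reach L.init (pre ξ i) x) :
    (runner L c ξ q len d).Reach (runner L c ξ q len d).init (List.replicate (cnt q i p) c)
      (⟨(i, p)⟩, x) := by
  classical
  obtain ⟨ρ, h1⟩ := exists_script_reach (S := L.alphabet) (c := c) (ξ := ξ) (d := d) hp hi
    fun k hk => h.mem_alphabet _ (mem_pre.2 ⟨k, hk, rfl⟩)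
  obtain ⟨-, -, h5, b, h6, h7⟩ := script_reach (P := fun a => decide (a ∈ L.alphabet))
    (Q := fun a => decide (a ∉ L.alphabet)) (by simp) (by simpa using hc) (by simp)
    (by simpa using hc) (Nat.zero_le _) (zero_le) h1
  refine (ctl_reach_iff runner_subset).2 ⟨ρ, h1, ?_, ?_⟩
  · rw [pre_zero, List.nil_append] at h5
    rwa [h5]
  · rw [cnt_zero, zero_add] at h7
    rw [h6, h7]

theorem mem_Tr_runner (hc : c ∉ L.alphabet) {σ : List Act.{u}} :
    σ ∈ (runner L c ξ q len d).Tr ↔ ∃ i p : ℕ, p ≤ q i ∧ (i : ℕ∞) ≤ len ∧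
      σ = List.replicate (cnt q i p) c ∧ pre ξ i ∈ L.Tr := by
  constructor
  · rintro ⟨⟨⟨i, p⟩, x⟩, h⟩
    obtain ⟨h1, h2, ρ, b, h3, h4, h5, h6⟩ := runner_reach hc (Nat.zero_le _) (zero_le) h
    rw [pre_zero, List.nil_append] at h3
    rw [cnt_zero, zero_add] at h6
    exact ⟨i, p, h1, h2, h6 ▸ h5, x, h3 ▸ h4⟩
  · rintro ⟨i, p, h1, h2, rfl, x, h3⟩
    exact ⟨_, runner_reach_of_reach hc h1 h2 h3⟩

theorem mem_Div_runner_of_mem (hc : c ∉ L.alphabet) {i p : ℕ} (hp : p ≤ q i)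
    (hi : (i : ℕ∞) ≤ len) (h : pre ξ i ∈ L.Div) :
    List.replicate (cnt q i p) c ∈ (runner L c ξ q len d).Div := by
  obtain ⟨x, h1, h2⟩ := h
  exact ⟨_, runner_reach_of_reach hc hp hi h1, ctl_diverges_right runner_subset _ h2⟩

/-- A runner diverges because the component does, because the script spins at its end, or because
the component executes the whole infinite script and only finitely many marks make it visible. -/
theorem mem_Div_runner (hc : c ∉ L.alphabet) {σ : List Act.{u}}
    (h : σ ∈ (runner L c ξ q len d).Div) :
    (∃ i p : ℕ, p ≤ q i ∧ (i : ℕ∞) ≤ len ∧ σ = List.replicate (cnt q i p) c ∧ pre ξ i ∈ L.Div) ∨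
    (len = ⊤ ∧ (∃ B, ∀ i, cnt q i 0 ≤ B) ∧ ξ ∈ L.Inf) ∨
    (d ∧ ∃ n : ℕ, len = n ∧ σ = List.replicate (cnt q n (q n)) c) := by
  obtain ⟨s0, h0, f, hf0, hf⟩ := h
  have hr : ∀ m, (runner L c ξ q len d).Reach (f 0) [] (f m) := by
    intro m
    induction m with
    | zero => exact Reach.refl _
    | succ m ih => exact ih.tau_right (Reach.of_tau (hf m))
  have hr0 : ∀ m, (runner L c ξ q len d).Reach (⟨(0, 0)⟩, L.init) σ (f m) := fun m =>
    Reach.tau_right (L := runner L c ξ q len d) h0 (hf0 ▸ hr m)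
  let i : ℕ → ℕ := fun m => (f m).1.down.1
  let p : ℕ → ℕ := fun m => (f m).1.down.2
  let x : ℕ → L.State := fun m => (f m).2
  have hinit : ∀ m, p m ≤ q (i m) ∧ (i m : ℕ∞) ≤ len ∧ ∃ ρ b, pre ξ 0 ++ ρ = pre ξ (i m) ∧
      L.Reach L.init ρ (x m) ∧ σ = List.replicate b c ∧ cnt q 0 0 + b = cnt q (i m) (p m) :=
    fun m => runner_reach hc (Nat.zero_le _) (zero_le) (hr0 m)
  have hstep : ∀ m, ∃ ρ, pre ξ (i m) ++ ρ = pre ξ (i (m + 1)) ∧ L.Reach (x m) ρ (x (m + 1)) := by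
    intro m
    obtain ⟨h1, h2, -⟩ := hinit m
    obtain ⟨-, -, ρ, b, h3, h4, -⟩ := runner_reach (i' := i (m + 1)) (p' := p (m + 1)) hc h1 h2
      (Reach.of_tau (hf m))
    exact ⟨ρ, h3, h4⟩
  have hmono : Monotone i := monotone_nat_of_le_succ fun m => by
    obtain ⟨ρ, h, -⟩ := hstep m
    have := congrArg List.length h
    simp only [List.length_append, length_pre] at this
    omega
  by_cases hub : ∀ N, ∃ m, N ≤ i m
  · refine Or.inr (Or.inl ⟨?_, ⟨σ.length, fun j => ?_⟩, ?_⟩)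
    · refine ENat.eq_top_iff_forall_ge.2 fun N => ?_
      obtain ⟨m, hm⟩ := hub N
      exact le_trans (by exact_mod_cast hm) (hinit m).2.1
    · obtain ⟨m, hm⟩ := hub j
      obtain ⟨-, -, ρ, b, -, -, h1, h2⟩ := hinit m
      rw [h1, List.length_replicate]
      rw [cnt_zero, zero_add] at h2
      rw [h2]
      exact le_trans (cnt_mono q hm) (Nat.add_le_add_left (Nat.zero_le _) _)
    · obtain ⟨-, -, ρ, b, h1, h2, -⟩ := hinit 0
      exact infReach_concat (fun m => m.casesOn L.init x) (fun m => m.casesOn 0 i) rfl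
        (fun N => (hub N).elim fun m hm => ⟨m + 1, hm⟩)
        (fun m => by
          cases m with
          | zero => exact ⟨ρ, h1, h2⟩
          | succ m => exact hstep m)
  · push Not at hub
    obtain ⟨N, hN⟩ := hub
    -- From some point on, the script does not advance.
    obtain ⟨M, hM⟩ : ∃ M, ∀ m ≥ M, i m = i M := by
      have hbdd : BddAbove (Set.range i) := ⟨N, by rintro _ ⟨m, rfl⟩; exact (hN m).le⟩
      obtain ⟨M, hM⟩ := Nat.sSup_mem (Set.range_nonempty i) hbdd
      exact ⟨M, fun m hm => le_antisymm (hM ▸ le_csSup hbdd ⟨m, rfl⟩) (hmono hm)⟩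
    have htail : ∀ m ≥ M, L.trans (x m) none (x (m + 1)) ∨
        (d ∧ (i m : ℕ∞) = len ∧ p m = q (i m)) := by
      intro m hm
      rcases (ctl_trans_none runner_subset).1 (hf m) with ⟨h, -⟩ | ⟨h, -⟩ | ⟨b, hb, h, -⟩
      · exact Or.inr (ScriptTrans.of_none h)
      · exact Or.inl h
      · rcases ScriptTrans.of_some h with rfl | h1
        · exact absurd hb hc
        · have h2 : i (m + 1) = i m + 1 := h1
          have h3 := hM m hm
          have h4 := hM (m + 1) (by omega)
          omega
    by_cases hspin : ∃ m ≥ M, d ∧ (i m : ℕ∞) = len ∧ p m = q (i m)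
    · obtain ⟨m, -, hd, h1, h2⟩ := hspin
      obtain ⟨-, -, ρ, b, -, -, h3, h4⟩ := hinit m
      rw [cnt_zero, zero_add, h2] at h4
      exact Or.inr (Or.inr ⟨hd, i m, h1.symm, h4 ▸ h3⟩)
    · left
      obtain ⟨h1, h2, ρ, b, h3, h4, h5, h6⟩ := hinit M
      rw [cnt_zero, zero_add] at h6
      rw [pre_zero, List.nil_append] at h3
      refine ⟨i M, p M, h1, h2, h6 ▸ h5, x M, h3 ▸ h4, fun m => x (M + m), rfl, fun m => ?_⟩
      exact (htail (M + m) (by omega)).resolve_right fun h => hspin ⟨M + m, by omega, h⟩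

theorem const_mem_Inf_runner (hc : c ∉ L.alphabet) (hq : ∀ n, ∃ i ≥ n, 0 < q i) :
    (fun _ => c) ∈ (runner L c ξ q ⊤ d).Inf ↔ ξ ∈ L.Inf := by
  constructor
  · intro h
    obtain ⟨f, h0, hf⟩ := InfReach.exists_reach h
    let i : ℕ → ℕ := fun m => (f m).1.down.1
    let p : ℕ → ℕ := fun m => (f m).1.down.2
    let x : ℕ → L.State := fun m => (f m).2
    have hinit : ∀ m, p m ≤ q (i m) ∧ m = cnt q (i m) (p m) := by
      intro m
      have h1 := reach_pre hf m
      rw [h0] at h1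
      obtain ⟨h2, -, ρ, b, -, -, h3, h4⟩ :=
        runner_reach (i' := i m) (p' := p m) hc (Nat.zero_le _) le_top h1
      have := congrArg List.length h3
      rw [length_pre, List.length_replicate] at this
      rw [cnt_zero, zero_add] at h4
      exact ⟨h2, this.trans h4⟩
    have hx0 : x 0 = L.init := congrArg Prod.snd h0
    have hi0 : i 0 = 0 := congrArg (fun s : ULift.{u} (ℕ × ℕ) × L.State => s.1.down.1) h0
    show L.InfReach L.init ξ
    rw [← hx0]
    refine infReach_concat x i hi0 (fun N => ?_) fun m => ?_
    · by_contra! hN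
      have h1 := (hinit (cnt q N 0 + 1))
      have h2 := hN (cnt q N 0 + 1)
      have h3 : cnt q (i (cnt q N 0 + 1) + 1) 0 ≤ cnt q N 0 := cnt_mono q h2
      rw [cnt_succ] at h3
      have h4 : cnt q (i (cnt q N 0 + 1)) (p (cnt q N 0 + 1)) ≤
        cnt q (i (cnt q N 0 + 1)) (q (i (cnt q N 0 + 1))) := Nat.add_le_add_left h1.1 _
      omega
    · obtain ⟨-, -, ρ, b, h1, h2, -⟩ :=
        runner_reach (i' := i (m + 1)) (p' := p (m + 1)) hc (hinit m).1 le_top (hf m)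
      exact ⟨ρ, h1, h2⟩
  · intro h
    have hal := Inf_mem_alphabet h
    obtain ⟨x, h0, hx⟩ := InfReach.exists_reach h
    have h1 : (runner L c ξ q ⊤ d).InfReach (⟨(0, 0)⟩, x 0) (fun _ => c) := by
      refine infReach_concat (L := runner L c ξ q ⊤ d) (fun m => (⟨(m, 0)⟩, x m))
        (fun m => cnt q m 0) (cnt_zero q 0) (cnt_unbounded hq) fun m => ?_
      refine ⟨List.replicate (q m) c, ?_, ?_⟩
      · rw [pre_const, pre_const, List.replicate_append_replicate, cnt_succ_zero]
      · have h2 := (script_reach_mark (S := L.alphabet) (q := q) (c := c) (ξ := ξ) (len := ⊤)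
          (d := d) m le_rfl).append (script_reach_act (hal m) (by simp))
        classical
        refine (ctl_reach_iff runner_subset).2 ⟨_, h2, ?_, ?_⟩
        · simpa [hc, hal m, List.filter_replicate] using hx m
        · simp [hc, hal m]
    rwa [h0] at h1

/-- A single mark before the `n`-th action: if `L` executes all of `ξ`, then the part after the
mark turns into a divergence. -/
theorem singleton_mem_Div_runner (hc : c ∉ L.alphabet) (n : ℕ) (h : ξ ∈ L.Inf) :
    [c] ∈ (runner L c ξ (markAt n 1) ⊤ d).Div := by
  have hal := Inf_mem_alphabet h
  obtain ⟨x, h0, hx⟩ := InfReach.exists_reach h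
  have h1 := reach_pre hx n
  rw [h0] at h1
  have h2 := runner_reach_of_reach (q := markAt n 1) (p := 1) (len := ⊤) (d := d) hc
    (by rw [markAt_self]) le_top h1
  rw [cnt_markAt_of_le le_rfl] at h2
  refine ⟨_, h2, ?_⟩
  refine diverges_coind (L := runner L c ξ (markAt n 1) ⊤ d)
    (fun s => ∃ k ≥ n, s.1 = ⟨(k, markAt n 1 k)⟩ ∧ L.InfReach s.2 fun m => ξ (k + m)) ?_
    ⟨n, le_rfl, by rw [markAt_self], infReach_of_reach (fun m => x (n + m)) fun m => hx (n + m)⟩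
  rintro ⟨_, y⟩ ⟨k, hk, rfl, hy⟩
  rcases hy.cases with ⟨t, h3, h4⟩ | ⟨t, h3, h4⟩
  · exact ⟨(_, t), (ctl_trans_none runner_subset).2 (Or.inr (Or.inl ⟨h3, rfl⟩)), k, hk, rfl, h4⟩
  · refine ⟨(⟨(k + 1, 0)⟩, t), (ctl_trans_none runner_subset).2
      (Or.inr (Or.inr ⟨ξ k, hal k, ScriptTrans.act (hal k) (by simp), h3⟩)),
      k + 1, by omega, ?_, ?_⟩
    · rw [markAt_of_ne (show k + 1 ≠ n by omega)]
    · convert h4 using 2 with m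
      congr 1
      omega

end Runner

/-! ### Scripts whose marks are executed by the component and whose actions are visible -/

theorem notMem_of_alphabet_eq_singleton {K : LTS.{u}} {S : Set Act.{u}} {c : Act.{u}}
    (hK : K.alphabet = {c}) (hc : c ∉ S) : ∀ a ∈ S, a ∉ K.alphabet := by
  rw [hK]
  exact fun a ha => ne_of_mem_of_not_mem ha hc

section Feeder

variable {K : LTS.{u}} {S : Set Act.{u}} [Small.{u} S] {c : Act.{u}} {ξ : ℕ → Act.{u}} {q : ℕ → ℕ}
  {len : ℕ∞}

theorem feeder_subset (hK : K.alphabet = {c}) :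
    K.alphabet ⊆ (script S c ξ q len False).alphabet := by
  rw [hK, Set.singleton_subset_iff]
  exact Set.mem_insert _ _

theorem feeder_reach (hK : K.alphabet = {c}) (hc : c ∉ S) {i p i' p' : ℕ} {x x' : K.State}
    {σ : List Act.{u}} (hp : p ≤ q i) (hi : (i : ℕ∞) ≤ len)
    (h : (ctl (script S c ξ q len False) K).Reach (⟨(i, p)⟩, x) σ (⟨(i', p')⟩, x')) :
    p' ≤ q i' ∧ (i' : ℕ∞) ≤ len ∧ pre ξ i ++ σ = pre ξ i' ∧
      ∃ b, K.Reach x (List.replicate b c) x' ∧ cnt q i p + b = cnt q i' p' := by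
  classical
  obtain ⟨ρ, h1, h2, rfl⟩ := (ctl_reach_iff (feeder_subset hK)).1 h
  obtain ⟨h3, h4, h5, b, h6, h7⟩ := script_reach (P := fun a => decide (a ∉ K.alphabet))
    (Q := fun a => decide (a ∈ K.alphabet)) (by simpa using notMem_of_alphabet_eq_singleton hK hc)
    (by simp [hK]) (by simpa using notMem_of_alphabet_eq_singleton hK hc)
    (by simp [hK]) hp hi h1
  exact ⟨h3, h4, h5, b, h6 ▸ h2, h7⟩

theorem feeder_reach_of_reach (hK : K.alphabet = {c}) (hc : c ∉ S) {i p : ℕ} {x : K.State}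
    (hp : p ≤ q i) (hi : (i : ℕ∞) ≤ len) (hm : ∀ k < i, ξ k ∈ S)
    (h : K.Reach K.init (List.replicate (cnt q i p) c) x) :
    (ctl (script S c ξ q len False) K).Reach (ctl (script S c ξ q len False) K).init (pre ξ i)
      (⟨(i, p)⟩, x) := by
  classical
  obtain ⟨ρ, h1⟩ := exists_script_reach (S := S) (c := c) (ξ := ξ) (d := False) hp hi hm
  obtain ⟨h3, h4, h5, b, h6, h7⟩ := script_reach (P := fun a => decide (a ∉ K.alphabet))
    (Q := fun a => decide (a ∈ K.alphabet)) (by simpa using notMem_of_alphabet_eq_singleton hK hc)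
    (by simp [hK]) (by simpa using notMem_of_alphabet_eq_singleton hK hc)
    (by simp [hK]) (Nat.zero_le _) (zero_le) h1
  refine (ctl_reach_iff (feeder_subset hK)).2 ⟨ρ, h1, ?_, ?_⟩
  · rw [cnt_zero, zero_add] at h7
    rwa [h6, h7]
  · rw [pre_zero, List.nil_append] at h5
    exact h5.symm

theorem script_mem_of_reach {d : Prop} {i p : ℕ} {ρ : List Act.{u}}
    (h : (script S c ξ q len d).Reach ⟨(0, 0)⟩ ρ ⟨(i, p)⟩) : ∀ k < i, ξ k ∈ S := by
  refine Reach.induction (L := script S c ξ q len d) (s := ⟨(0, 0)⟩)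
    (P := fun ρ s => ∀ k < s.down.1, ξ k ∈ S) ?_ ?_ ?_ h
  · exact fun k hk => absurd hk (Nat.not_lt_zero k)
  · rintro ρ ⟨s⟩ ⟨s'⟩ ih h
    cases h with
    | spin hd h => exact ih
  · rintro ρ ⟨s⟩ a ⟨s'⟩ ih h
    cases h with
    | mark h => exact ih
    | act hm h =>
      intro k hk
      rcases Nat.lt_succ_iff_lt_or_eq.1 hk with hk | rfl
      · exact ih k hk
      · exact hm

theorem mem_Tr_feeder (hK : K.alphabet = {c}) (hc : c ∉ S) {σ : List Act.{u}} :
    σ ∈ (ctl (script S c ξ q len False) K).Tr ↔ ∃ i p : ℕ, p ≤ q i ∧ (i : ℕ∞) ≤ len ∧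
      (∀ k < i, ξ k ∈ S) ∧ σ = pre ξ i ∧ List.replicate (cnt q i p) c ∈ K.Tr := by
  constructor
  · rintro ⟨⟨⟨i, p⟩, x⟩, h⟩
    obtain ⟨h1, h2, h3, b, h4, h5⟩ := feeder_reach hK hc (Nat.zero_le _) (zero_le) h
    obtain ⟨ρ, h6, -⟩ := (ctl_reach_iff (feeder_subset hK)).1 h
    rw [pre_zero, List.nil_append] at h3
    rw [cnt_zero, zero_add] at h5
    exact ⟨i, p, h1, h2, script_mem_of_reach h6, h3, x, h5 ▸ h4⟩
  · rintro ⟨i, p, h1, h2, h3, rfl, x, h4⟩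
    exact ⟨_, feeder_reach_of_reach hK hc h1 h2 h3 h4⟩

theorem script_hide_mark_not_diverges (hc : c ∉ S) (s : (script S c ξ q len False).State) :
    ¬ ((script S c ξ q len False).hide {c}).Diverges s := by
  intro h
  obtain ⟨f, -, hf⟩ := h
  have key : ∀ m, (f (m + 1)).down.1 = (f m).down.1 ∧ (f (m + 1)).down.2 = (f m).down.2 + 1 ∧
      (f (m + 1)).down.2 ≤ q (f m).down.1 := by
    intro m
    rcases hf m with ⟨h, -⟩ | ⟨-, b, hb, h⟩
    · have h' : ScriptTrans S c ξ q len False (f m).down none (f (m + 1)).down := h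
      generalize (f m).down = s at h'
      generalize (f (m + 1)).down = s' at h'
      cases h' with
      | spin hd h => exact hd.elim
    · have h' : ScriptTrans S c ξ q len False (f m).down (some b) (f (m + 1)).down := h
      rw [Set.mem_singleton_iff.1 hb] at h'
      generalize (f m).down = s at h'
      generalize (f (m + 1)).down = s' at h'
      generalize hcb : some c = l at h'
      cases h' with
      | mark h => exact ⟨rfl, rfl, h⟩
      | act hm h => cases hcb; exact absurd hm hc
      | spin hd h => exact hd.elim
  have h1 : ∀ m, (f m).down.1 = (f 0).down.1 ∧ m ≤ (f m).down.2 := by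
    intro m
    induction m with
    | zero => exact ⟨rfl, Nat.zero_le _⟩
    | succ m ih =>
      obtain ⟨h2, h3, -⟩ := key m
      exact ⟨h2.trans ih.1, by omega⟩
  have h2 := key (q (f 0).down.1)
  have h3 := h1 (q (f 0).down.1)
  rw [h3.1] at h2
  omega

theorem mem_Div_feeder (hK : K.alphabet = {c}) (hc : c ∉ S) {σ : List Act.{u}} :
    σ ∈ (ctl (script S c ξ q len False) K).Div ↔ ∃ i p : ℕ, p ≤ q i ∧ (i : ℕ∞) ≤ len ∧
      (∀ k < i, ξ k ∈ S) ∧ σ = pre ξ i ∧ List.replicate (cnt q i p) c ∈ K.Div := by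
  constructor
  · intro h
    obtain ⟨⟨i, p⟩, x, h, hd | hd⟩ := ctl_mem_Div (feeder_subset hK) h
    · rw [hK] at hd
      exact absurd hd (script_hide_mark_not_diverges hc _)
    · obtain ⟨h1, h2, h3, b, h4, h5⟩ := feeder_reach hK hc (Nat.zero_le _) (zero_le) h
      obtain ⟨ρ, h6, -⟩ := (ctl_reach_iff (feeder_subset hK)).1 h
      rw [pre_zero, List.nil_append] at h3
      rw [cnt_zero, zero_add] at h5
      exact ⟨i, p, h1, h2, script_mem_of_reach h6, h3, x, h5 ▸ h4, hd⟩
  · rintro ⟨i, p, h1, h2, h3, rfl, x, h4, hd⟩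
    exact ⟨_, feeder_reach_of_reach hK hc h1 h2 h3 h4, ctl_diverges_right (feeder_subset hK) _ hd⟩

theorem Inf_feeder_subset (hK : K.alphabet = {c}) (hc : c ∉ S) {ζ : ℕ → Act.{u}}
    (h : ζ ∈ (ctl (script S c ξ q len False) K).Inf) :
    ζ = ξ ∧ len = ⊤ ∧ (∀ k, ξ k ∈ S) ∧ ∀ m, ∃ p, List.replicate (cnt q m p) c ∈ K.Tr := by
  have key : ∀ m, pre ζ m = pre ξ m ∧ (m : ℕ∞) ≤ len ∧ (∀ k < m, ξ k ∈ S) ∧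
      ∃ p, List.replicate (cnt q m p) c ∈ K.Tr := by
    intro m
    obtain ⟨i, p, h1, h2, h3, h4, h5⟩ := (mem_Tr_feeder hK hc).1 (pre_mem_Tr h m)
    have := congrArg List.length h4
    rw [length_pre, length_pre] at this
    subst this
    exact ⟨h4, h2, h3, p, h5⟩
  exact ⟨eq_of_pre_eq fun m => (key m).1, ENat.eq_top_iff_forall_ge.2 fun m => (key m).2.1,
    fun k => (key (k + 1)).2.2.1 k k.lt_succ_self, fun m => (key m).2.2.2⟩

theorem const_mem_Inf_of_feeder (hK : K.alphabet = {c}) (hc : c ∉ S)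
    (hq : ∀ n, ∃ i ≥ n, 0 < q i) {ζ : ℕ → Act.{u}}
    (h : ζ ∈ (ctl (script S c ξ q len False) K).Inf) : (fun _ => c) ∈ K.Inf := by
  obtain ⟨rfl, rfl, -⟩ := Inf_feeder_subset hK hc h
  obtain ⟨f, h0, hf⟩ := InfReach.exists_reach h
  let i : ℕ → ℕ := fun m => (f m).1.down.1
  let p : ℕ → ℕ := fun m => (f m).1.down.2
  let x : ℕ → K.State := fun m => (f m).2
  have hinit : ∀ m, p m ≤ q (i m) ∧ i m = m := by
    intro m
    have h1 := reach_pre hf m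
    rw [h0] at h1
    obtain ⟨h2, -, h3, -⟩ :=
      feeder_reach (i' := i m) (p' := p m) hK hc (Nat.zero_le _) le_top h1
    have := congrArg List.length h3
    rw [pre_zero, List.nil_append, length_pre, length_pre] at this
    exact ⟨h2, this.symm⟩
  have hx0 : x 0 = K.init := congrArg Prod.snd h0
  have hc0 : cnt q (i 0) (p 0) = 0 :=
    congrArg (fun s : ULift.{u} (ℕ × ℕ) × K.State => cnt q s.1.down.1 s.1.down.2) h0
  show K.InfReach K.init _
  rw [← hx0]
  refine infReach_concat x (fun m => cnt q (i m) (p m)) hc0 (fun N => ?_) fun m => ?_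
  · obtain ⟨m, hm⟩ := cnt_unbounded hq N
    refine ⟨m, hm.trans ?_⟩
    rw [(hinit m).2]
    exact Nat.add_le_add_left (Nat.zero_le _) _
  · obtain ⟨-, -, -, b, h1, h2⟩ :=
      feeder_reach (i' := i (m + 1)) (p' := p (m + 1)) hK hc (hinit m).1 le_top (hf m)
    refine ⟨_, ?_, h1⟩
    rw [pre_const, pre_const, List.replicate_append_replicate, h2]

theorem mem_Inf_feeder (hK : K.alphabet = {c}) (hc : c ∉ S) (hm : ∀ k, ξ k ∈ S)
    (y : ℕ → K.State) (h0 : y 0 = K.init)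
    (hy : ∀ m, K.Reach (y m) (List.replicate (q m) c) (y (m + 1))) :
    ξ ∈ (ctl (script S c ξ q ⊤ False) K).Inf := by
  have h1 : (ctl (script S c ξ q ⊤ False) K).InfReach (⟨(0, 0)⟩, y 0) ξ := by
    refine infReach_of_reach (L := ctl (script S c ξ q ⊤ False) K)
      (fun m => (⟨(m, 0)⟩, y m)) fun m => ?_
    have h2 := (script_reach_mark (S := S) (q := q) (c := c) (ξ := ξ) (len := ⊤) (d := False) m
      le_rfl).append (script_reach_act (hm m) (by simp))
    have h3 : ξ m ≠ c := ne_of_mem_of_not_mem (hm m) hc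
    classical
    refine (ctl_reach_iff (feeder_subset hK)).2 ⟨_, h2, ?_, ?_⟩
    · simpa [hK, h3, List.filter_replicate] using hy m
    · simp [hK, h3]
  rwa [h0] at h1

end Feeder

/-! ### Preserved semantic sets -/

/-- The deadlock with alphabet `{b}`. -/
def deadlock (b : Act.{u}) : LTS.{u} where
  State := PUnit
  alphabet := {b}
  small_alphabet := inferInstance
  trans _ _ _ := False
  trans_mem := fun _ _ _ => False.elim
  init := PUnit.unit

/-- `b.L || deadlock b`, which has the alphabet of `L` but cannot do anything. -/
def block (L : LTS.{u}) (b : Act.{u}) : LTS.{u} := (L.actPrefix b).par (deadlock b)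

theorem block_not_trans (L : LTS.{u}) (b : Act.{u}) (l : Option Act.{u})
    (s : (block L b).State) : ¬ (block L b).trans (block L b).init l s := by
  obtain ⟨s, t⟩ := s
  rintro (⟨h1, h2, -⟩ | ⟨-, ⟨⟩, -⟩ | ⟨-, -, -, -, ⟨⟩⟩)
  cases s with
  | none => exact h2
  | some s => exact h1 b rfl h2.1

/-- A single `a`, followed by divergence. -/
def actDiv (a : Act.{u}) : LTS.{u} := script ∅ a (fun _ => a) (markAt 0 1) 0 True

/-- As `block L b` does nothing, the `a` can be executed if and only if it does not have to be
synchronised. -/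
theorem mem_minD_block_par {L : LTS.{u}} {a b : Act.{u}} (hab : a ≠ b) :
    [a] ∈ ((block L b).par (actDiv a)).minD ↔ a ∉ L.alphabet := by
  have hτ : ∀ s, ¬ ((block L b).par (actDiv a)).trans ((block L b).par (actDiv a)).init none s := by
    rintro s (⟨-, h, -⟩ | ⟨-, h, -⟩ | ⟨_, -, h, -⟩)
    · exact block_not_trans L b _ _ h
    · have h1 : 0 = markAt 0 1 0 := (ScriptTrans.of_none h).2.2
      rw [markAt_self] at h1
      cases h1
    · cases h
  have hreach : ∀ {s}, ((block L b).par (actDiv a)).TauReach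
      ((block L b).par (actDiv a)).init s → s = ((block L b).par (actDiv a)).init := by
    intro s h
    rcases Relation.ReflTransGen.cases_head h with h | ⟨t, h, -⟩
    · exact h.symm
    · exact absurd h (hτ t)
  have hal : a ∈ (block L b).alphabet ↔ a ∈ L.alphabet := by
    constructor
    · rintro ((h | h) | h)
      · exact absurd h hab
      · exact h
      · exact absurd h hab
    · exact fun h => Or.inl (Or.inr h)
  constructor
  · rintro ⟨⟨s, ⟨t, t', h1, h2, -⟩, -⟩, -⟩ ha
    rw [hreach h1] at h2
    rcases h2 with ⟨-, h, -⟩ | ⟨h, -⟩ | ⟨_, -, -, h, -⟩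
    · exact block_not_trans L b _ _ h
    · exact h a (hal.2 ha) rfl
    · exact block_not_trans L b _ _ h
  · intro ha
    refine ⟨⟨((block L b).init, ⟨(0, 1)⟩), Reach.of_vis (L := (block L b).par (actDiv a))
      (s := ((block L b).init, ⟨(0, 0)⟩)) (t := ((block L b).init, ⟨(0, 1)⟩)) ?_,
      fun _ => ((block L b).init, ⟨(0, 1)⟩), rfl, fun _ => ?_⟩, ?_⟩
    · refine Or.inr (Or.inl ⟨?_, ScriptTrans.mark (by rw [markAt_self]; exact one_pos), rfl⟩)
      rintro c hc ⟨⟩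
      exact ha (hal.1 hc)
    · refine Or.inr (Or.inl ⟨fun _ _ => nofun, ?_, rfl⟩)
      exact ScriptTrans.spin (S := ∅) (c := a) (ξ := fun _ => a) (q := markAt 0 1) (i := 0)
        trivial rfl
    · intro i hi h
      obtain rfl : i = 0 := by simpa using hi
      obtain ⟨s, h1, f, h2, h3⟩ := h
      rw [hreach h1] at h2
      have := h3 0
      rw [h2] at this
      exact hτ _ this

section Lower

variable {R : LTS.{u} → LTS.{u} → Prop}

theorem preserves_alphabet (hR : IsCongruence R) (h : Preserves R minD) : Preserves R alphabet := by
  have key : ∀ L L', R L L' → L.alphabet ⊆ L'.alphabet := by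
    intro L L' hLL a ha
    obtain ⟨b, hb⟩ := exists_fresh L.alphabet
    have hab : a ≠ b := ne_of_mem_of_not_mem ha hb
    by_contra ha'
    have h1 := h _ _ (hR.par_right _ _ (actDiv a) (hR.par_right _ _ (deadlock b)
      (hR.actPrefix b _ _ hLL)))
    exact (mem_minD_block_par hab).1 (h1 ▸ (mem_minD_block_par hab).2 ha') ha
  exact fun L L' hLL => (key _ _ hLL).antisymm (key _ _ (hR.equiv.symm hLL))

theorem IsCongruence.runner (hR : IsCongruence R) {L L' : LTS.{u}}
    (hal : L.alphabet = L'.alphabet) (h : R L L')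
    (c : Act.{u}) (ξ : ℕ → Act.{u}) (q : ℕ → ℕ) (len : ℕ∞) (d : Prop) :
    R (L.runner c ξ q len d) (L'.runner c ξ q len d) := by
  have : ∀ (S T : Set Act.{u}) (hS : Small.{u} S) (hT : Small.{u} T), S = T →
      script S c ξ q len d = script T c ξ q len d := by
    rintro S _ hS hT rfl
    rfl
  rw [LTS.runner, LTS.runner, this _ _ _ _ hal]
  exact hR.ctl _ hal h

end Lower

/-- `L` executes the finite sequence `σ`, which is then reported by a single mark. -/
def report (L : LTS.{u}) (c : Act.{u}) (σ : List Act.{u}) (d : Prop) : LTS.{u} :=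
  L.runner c (ofList σ) (markAt σ.length 1) σ.length d

section Report

variable {L : LTS.{u}} {c : Act.{u}} {σ : List Act.{u}} {d : Prop}

theorem report_position {i p : ℕ} (hp : p ≤ markAt σ.length 1 i) (hi : (i : ℕ∞) ≤ σ.length)
    (h : [c] = List.replicate (cnt (markAt σ.length 1) i p) c) :
    pre (ofList σ) i = σ := by
  have hi' : i ≤ σ.length := by exact_mod_cast hi
  have h1 := congrArg List.length h
  rw [List.length_replicate, List.length_singleton, cnt_markAt_of_le hi'] at h1
  have h2 : i = σ.length := by
    by_contra hne
    rw [markAt_of_ne hne] at hp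
    omega
  rw [h2, pre_ofList_length]

theorem mem_Tr_report (hc : c ∉ L.alphabet) : [c] ∈ (report L c σ d).Tr ↔ σ ∈ L.Tr := by
  constructor
  · intro h
    obtain ⟨i, p, hp, hi, h1, h2⟩ := (mem_Tr_runner hc).1 h
    rwa [report_position hp hi h1] at h2
  · intro h
    refine (mem_Tr_runner hc).2 ⟨σ.length, 1, (markAt_self _ _).ge, le_rfl, ?_, ?_⟩
    · rw [cnt_markAt_of_le le_rfl]; rfl
    · rwa [pre_ofList_length]

theorem mem_Div_report (hc : c ∉ L.alphabet) : [c] ∈ (report L c σ False).Div ↔ σ ∈ L.Div := by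
  constructor
  · intro h
    rcases mem_Div_runner hc h with ⟨i, p, hp, hi, h1, h2⟩ | ⟨h, -⟩ | ⟨h, -⟩
    · rwa [report_position hp hi h1] at h2
    · exact absurd h (ENat.natCast_ne_top _)
    · exact h.elim
  · intro h
    have h1 := mem_Div_runner_of_mem (ξ := ofList σ) (q := markAt σ.length 1) (i := σ.length)
      (p := 1) (len := σ.length) (d := False) hc (markAt_self _ _).ge le_rfl
      (by rwa [pre_ofList_length])
    rwa [cnt_markAt_of_le le_rfl] at h1

theorem mem_Div_report_spin (hc : c ∉ L.alphabet) (h : σ ∈ L.Tr) :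
    [c] ∈ (report L c σ True).Div := by
  obtain ⟨x, h⟩ := h
  rw [← pre_ofList_length σ] at h
  have h1 := runner_reach_of_reach (q := markAt σ.length 1) (p := 1) (len := σ.length)
    (d := True) hc (markAt_self _ _).ge le_rfl h
  rw [cnt_markAt_of_le le_rfl] at h1
  refine ⟨_, h1, fun _ => _, rfl, fun _ => (ctl_trans_none runner_subset).2 (Or.inl ⟨?_, rfl⟩)⟩
  have h2 := ScriptTrans.spin (S := L.alphabet) (c := c) (ξ := ofList σ)
    (q := markAt σ.length 1) (len := σ.length) (i := σ.length) trivial rfl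
  rw [markAt_self] at h2
  exact h2

end Report

section Lower

variable {R : LTS.{u} → LTS.{u} → Prop}

/-- If inclusion of a semantic set can be shown along `R`, then `R` preserves it. -/
theorem preserves_of_subset (hR : IsCongruence R) {β : Type*} {X : LTS.{u} → Set β}
    (h : ∀ L L', R L L' → X L ⊆ X L') : Preserves R X :=
  fun L L' hLL => (h L L' hLL).antisymm (h L' L (hR.equiv.symm hLL))

theorem exists_of_not_preserves (hR : IsCongruence R) {β : Type*} {X : LTS.{u} → Set β}
    (h : ¬ Preserves R X) :
    ∃ L L' x, R L L' ∧ x ∈ X L ∧ x ∉ X L' := by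
  by_contra! hcon
  exact h (preserves_of_subset hR fun L L' hLL x hx => hcon L L' x hLL hx)

/-- A spinning `report` turns an always-nondivergent trace into a minimal divergence trace. -/
theorem preserves_anT (hR : IsCongruence R) (h : Preserves R minD) : Preserves R anT := by
  refine preserves_of_subset hR fun L L' hLL σ hσ => ?_
  have hal := preserves_alphabet hR h _ _ hLL
  have hext := extT_congr hal (h _ _ hLL)
  refine ⟨?_, hext ▸ hσ.2⟩
  obtain ⟨c, hc⟩ := exists_fresh L.alphabet
  have hc' : c ∉ L'.alphabet := hal ▸ hc
  have hm := h _ _ (hR.runner hal hLL c (ofList σ) (markAt σ.length 1) σ.length True)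
  have h1 : [c] ∈ (report L c σ True).Div := mem_Div_report_spin hc hσ.1
  obtain ⟨j, hj, -, h2⟩ := exists_take_mem_minD (i := 1) (σ := [c]) h1
  have h3 : [c].take j ∈ (report L' c σ True).Div := (hm ▸ h2 : _ ∈ (report L' c σ True).minD).1
  rcases Nat.le_one_iff_eq_zero_or_eq_one.1 hj with rfl | rfl
  · exfalso
    rcases mem_Div_runner hc' h3 with ⟨i, p, hp, hi, h4, h5⟩ | ⟨h, -⟩ | ⟨-, n, hn, h4⟩
    · rw [pre_ofList σ (by exact_mod_cast hi)] at h5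
      exact hσ.2 (hext ▸ mem_extT_iff.2 ⟨hal ▸ Tr_mem_alphabet hσ.1, i, h5⟩)
    · exact absurd h (ENat.natCast_ne_top _)
    · have hn' : σ.length = n := by exact_mod_cast hn
      rw [← hn', cnt_markAt_of_le le_rfl, markAt_self] at h4
      cases h4
  · exact (mem_Tr_report hc').1 (Div_subset_Tr _ h3)

/-- When its actions are hidden, an always-nondivergent infinite trace turns into the divergence
trace that consists of a single initial mark. -/
theorem preserves_anI (hR : IsCongruence R) (h : Preserves R minD) : Preserves R anI := by
  refine preserves_of_subset hR fun L L' hLL ξ hξ => ?_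
  have hal := preserves_alphabet hR h _ _ hLL
  have hext := extI_congr hal (h _ _ hLL)
  refine ⟨?_, hext ▸ hξ.2⟩
  obtain ⟨c, hc⟩ := exists_fresh L.alphabet
  have hm := h _ _ (hR.runner hal hLL c ξ (markAt 0 1) ⊤ False)
  have h1 := singleton_mem_Div_runner (d := False) hc 0 hξ.1
  obtain ⟨j, hj, -, h2⟩ := exists_take_mem_minD (i := 1) (σ := [c]) h1
  rw [hm] at h2
  rcases mem_Div_runner (hal ▸ hc) h2.1 with ⟨i, p, hp, hi, h4, h5⟩ | ⟨-, -, h⟩ | ⟨h, -⟩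
  · exact absurd (hext ▸ mem_extI_iff.2 ⟨hal ▸ Inf_mem_alphabet hξ.1, i, h5⟩) hξ.2
  · exact h
  · exact h.elim

theorem preserves_minD (h : Preserves R Div) : Preserves R minD :=
  fun _ _ hLL => minD_congr (h _ _ hLL)

theorem preserves_Tr_of_Div (hR : IsCongruence R) (h : Preserves R Div) : Preserves R Tr := by
  refine preserves_of_subset hR fun L L' hLL σ hσ => ?_
  have hal := preserves_alphabet hR (preserves_minD h) _ _ hLL
  obtain ⟨c, hc⟩ := exists_fresh L.alphabet
  have hm := h _ _ (hR.runner hal hLL c (ofList σ) (markAt σ.length 1) σ.length True)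
  have h1 : [c] ∈ (report L c σ True).Div := mem_Div_report_spin hc hσ
  exact (mem_Tr_report (hal ▸ hc)).1 (Div_subset_Tr _ (hm ▸ h1 : [c] ∈ (report L' c σ True).Div))

/-- The mark is placed after all divergent prefixes, so that a divergence after the mark reveals the
infinite trace. -/
theorem preserves_eanI (hR : IsCongruence R) (h : Preserves R Div) : Preserves R eanI := by
  refine preserves_of_subset hR fun L L' hLL ξ hξ => ?_
  have hal := preserves_alphabet hR (preserves_minD h) _ _ hLL
  obtain ⟨h0, n, hn⟩ := hξ
  refine ⟨?_, n, h _ _ hLL ▸ hn⟩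
  obtain ⟨c, hc⟩ := exists_fresh L.alphabet
  have hm := h _ _ (hR.runner hal hLL c ξ (markAt n 1) ⊤ False)
  have h1 := singleton_mem_Div_runner (d := False) hc n h0
  rw [hm] at h1
  rcases mem_Div_runner (hal ▸ hc) h1 with ⟨i, p, hp, hi, h4, h5⟩ | ⟨-, -, h⟩ | ⟨h, -⟩
  · exfalso
    refine hn i ?_ (h _ _ hLL ▸ h5)
    by_contra hlt
    rw [markAt_of_ne (by omega), Nat.le_zero] at hp
    rw [cnt_markAt_of_le (by omega), hp] at h4
    cases h4
  · exact h
  · exact h.elim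

/-- Once the mark of `report` is consumed, an infinite sequence of fresh actions can be
executed. -/
theorem preserves_Tr_of_Inf (hR : IsCongruence R) (h : Preserves R minD) (h' : Preserves R Inf) :
    Preserves R Tr := by
  refine preserves_of_subset hR fun L L' hLL σ hσ => ?_
  have hal := preserves_alphabet hR h _ _ hLL
  obtain ⟨c, hc⟩ := exists_fresh L.alphabet
  have hc' : c ∉ L'.alphabet := hal ▸ hc
  obtain ⟨b, hb⟩ := exists_fresh.{u} {c}
  have hcb : c ∉ ({b} : Set Act.{u}) := fun h => hb (Set.mem_singleton_iff.1 h).symm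
  have hK : (report L c σ False).alphabet = {c} := runner_alphabet hc
  have hK' : (report L' c σ False).alphabet = {c} := runner_alphabet hc'
  have hm := h' _ _ (hR.ctl (script {b} c (fun _ => b) (markAt 0 1) ⊤ False) (hK.trans hK'.symm)
    (hR.runner hal hLL c (ofList σ) (markAt σ.length 1) σ.length False))
  obtain ⟨s, hs⟩ := (mem_Tr_report (d := False) hc).2 hσ
  have h1 := mem_Inf_feeder (ξ := fun _ => b) (q := markAt 0 1) hK hcb (fun _ => rfl)
    (fun m => m.casesOn (report L c σ False).init fun _ => s) rfl (fun m => by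
      cases m with
      | zero => exact hs
      | succ m => exact Reach.refl s)
  obtain ⟨-, -, -, h2⟩ := Inf_feeder_subset hK' hcb (hm ▸ h1 :
    (fun _ => b) ∈ (ctl (script {b} c (fun _ => b) (markAt 0 1) ⊤ False)
      (report L' c σ False)).Inf)
  obtain ⟨p, h3⟩ := h2 1
  rw [cnt_markAt_of_lt one_pos, ← List.replicate_append_replicate] at h3
  exact (mem_Tr_report hc').1 (Tr_of_append h3)

end Lower

/-! ### Separating components -/

section Separating

variable {R : LTS.{u} → LTS.{u} → Prop}

/-- `R` relates two processes over the single action `c`, neither of which diverges initially, the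
first having the property `P` and the second the property `P'`. -/
def Separates (R : LTS.{u} → LTS.{u} → Prop) (c : Act.{u}) (P P' : LTS.{u} → Prop) : Prop :=
  ∃ K K', R K K' ∧ K.alphabet = {c} ∧ K'.alphabet = {c} ∧ [] ∉ K.Div ∧ [] ∉ K'.Div ∧ P K ∧ P' K'

/-- The prefix `c` prevents the runner from diverging initially, so one mark more than those of the
script is visible. -/
theorem separates_of_runner (hR : IsCongruence R) (hal : Preserves R alphabet) {L L' : LTS.{u}}
    (h : R L L') {c : Act.{u}} (hc : c ∉ L.alphabet) {P P' : LTS.{u} → Prop} (ξ : ℕ → Act.{u})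
    (q : ℕ → ℕ) (len : ℕ∞) (hP : P ((L.runner c ξ q len False).actPrefix c))
    (hP' : P' ((L'.runner c ξ q len False).actPrefix c)) : Separates R c P P' := by
  have hal' := hal _ _ h
  refine ⟨_, _, hR.actPrefix c _ _ (hR.runner hal' h c ξ q len False), ?_, ?_,
    nil_not_mem_Div_actPrefix, nil_not_mem_Div_actPrefix, hP, hP'⟩
  · show insert c _ = _
    rw [runner_alphabet hc, Set.insert_eq_of_mem (Set.mem_singleton c)]
  · show insert c _ = _
    rw [runner_alphabet (hal' ▸ hc), Set.insert_eq_of_mem (Set.mem_singleton c)]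

theorem separates_Tr (hR : IsCongruence R) (hal : Preserves R alphabet) (h : ¬ Preserves R Tr) :
    ∃ S : Set Act.{u}, Small.{u} S ∧ ∀ c ∉ S,
      Separates R c (fun K => [c, c] ∈ K.Tr) (fun K => [c, c] ∉ K.Tr) := by
  obtain ⟨L, L', σ, hLL, hσ, hσ'⟩ := exists_of_not_preserves hR h
  refine ⟨L.alphabet, inferInstance, fun c hc => separates_of_runner hR hal hLL hc (ofList σ)
    (markAt σ.length 1) σ.length ?_ ?_⟩
  · exact cons_mem_Tr_actPrefix.2 ((mem_Tr_report hc).2 hσ)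
  · exact fun h => hσ' ((mem_Tr_report (hal _ _ hLL ▸ hc)).1 (cons_mem_Tr_actPrefix.1 h))

theorem separates_Div (hR : IsCongruence R) (hal : Preserves R alphabet) (h : ¬ Preserves R Div) :
    ∃ S : Set Act.{u}, Small.{u} S ∧ ∀ c ∉ S,
      Separates R c (fun K => [c, c] ∈ K.Div) (fun K => [c, c] ∉ K.Div) := by
  obtain ⟨L, L', σ, hLL, hσ, hσ'⟩ := exists_of_not_preserves hR h
  refine ⟨L.alphabet, inferInstance, fun c hc => separates_of_runner hR hal hLL hc (ofList σ)
    (markAt σ.length 1) σ.length ?_ ?_⟩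
  · exact cons_mem_Div_actPrefix.2 ((mem_Div_report hc).2 hσ)
  · exact fun h => hσ' ((mem_Div_report (hal _ _ hLL ▸ hc)).1 (cons_mem_Div_actPrefix.1 h))

theorem separates_Inf (hR : IsCongruence R) (hal : Preserves R alphabet) (h : ¬ Preserves R Inf) :
    ∃ S : Set Act.{u}, Small.{u} S ∧ ∀ c ∉ S,
      Separates R c (fun K => (fun _ => c) ∈ K.Inf) (fun K => (fun _ => c) ∉ K.Inf) := by
  obtain ⟨L, L', ξ, hLL, hξ, hξ'⟩ := exists_of_not_preserves hR h
  refine ⟨L.alphabet, inferInstance, fun c hc => separates_of_runner hR hal hLL hc ξ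
    (fun _ => 1) ⊤ ?_ ?_⟩
  · exact const_mem_Inf_actPrefix.2 ((const_mem_Inf_runner hc fun n => ⟨n, le_rfl, one_pos⟩).2 hξ)
  · exact fun h => hξ' ((const_mem_Inf_runner (hal _ _ hLL ▸ hc) fun n => ⟨n, le_rfl, one_pos⟩).1
      (const_mem_Inf_actPrefix.1 h))

/-- Two marks at each nondivergent prefix of `ξ`: between them the number of marks executed,
counting the initial one, is even, and the process does not diverge. -/
theorem separates_aenI (hR : IsCongruence R) (hD : Preserves R Div) (h : ¬ Preserves R aenI) :
    ∃ S : Set Act.{u}, Small.{u} S ∧ ∀ c ∉ S,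
      Separates R c (fun K => (fun _ => c) ∈ K.Inf ∧ ∀ m, List.replicate (2 * m) c ∉ K.Div)
        (fun K => (fun _ => c) ∉ K.Inf ∧ ∀ m, List.replicate (2 * m) c ∉ K.Div) := by
  classical
  have hal := preserves_alphabet hR (preserves_minD hD)
  obtain ⟨L, L', ξ, hLL, hξ, hξ'⟩ := exists_of_not_preserves hR h
  let q : ℕ → ℕ := fun i => if pre ξ i ∈ L.Div then 0 else 2
  have hq : ∀ n, ∃ i ≥ n, 0 < q i := by
    intro n
    obtain ⟨i, hi, h⟩ := hξ.2 n
    exact ⟨i, hi, by simp only [q, if_neg h]; exact two_pos⟩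
  have heven : ∀ i, ∃ k, cnt q i 0 = 2 * k := by
    intro i
    induction i with
    | zero => exact ⟨0, cnt_zero _ _⟩
    | succ i ih =>
      obtain ⟨k, hk⟩ := ih
      rw [cnt_succ_zero, hk]
      by_cases h : pre ξ i ∈ L.Div
      · exact ⟨k, by simp [q, h]⟩
      · exact ⟨k + 1, by simp only [q, if_neg h]; ring⟩
  have hnd : ∀ (M : LTS.{u}) (c : Act.{u}), c ∉ M.alphabet → M.Div = L.Div → ∀ m,
      List.replicate (2 * m) c ∉ ((M.runner c ξ q ⊤ False).actPrefix c).Div := by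
    intro M c hc hM m hm
    cases m with
    | zero => exact nil_not_mem_Div_actPrefix hm
    | succ m =>
      rw [show 2 * (m + 1) = 2 * m + 1 + 1 by ring, List.replicate_succ] at hm
      rcases mem_Div_runner hc (cons_mem_Div_actPrefix.1 hm) with
        ⟨i, p, hp, -, h1, h2⟩ | ⟨-, ⟨B, hB⟩, -⟩ | ⟨h, -⟩
      · have h3 := congrArg List.length h1
        rw [List.length_replicate, List.length_replicate, ← zero_add p, cnt_add] at h3
        obtain ⟨k, hk⟩ := heven i
        rw [hM] at h2
        simp only [q, if_pos h2] at hp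
        omega
      · obtain ⟨i, hi⟩ := cnt_unbounded hq (B + 1)
        have := hB i
        omega
      · exact h
  refine ⟨L.alphabet, inferInstance, fun c hc => ?_⟩
  have hc' : c ∉ L'.alphabet := hal _ _ hLL ▸ hc
  refine separates_of_runner hR hal hLL hc ξ q ⊤ ⟨?_, hnd L c hc rfl⟩
    ⟨?_, hnd L' c hc' (hD _ _ hLL).symm⟩
  · exact const_mem_Inf_actPrefix.2 ((const_mem_Inf_runner hc hq).2 hξ.1)
  · intro h
    refine hξ' ⟨(const_mem_Inf_runner hc' hq).1 (const_mem_Inf_actPrefix.1 h), ?_⟩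
    rw [← hD _ _ hLL]
    exact hξ.2

end Separating

/-! ### Testing a stable failure -/

/-- The transitions of `tester`. -/
inductive TesterTrans (S : Set Act.{u}) (σ : List Act.{u}) (A : Set Act.{u}) (c : Act.{u}) :
    Option ℕ → Option Act.{u} → Option ℕ → Prop
  | step {i : ℕ} (h : i < σ.length) (hm : ofList σ i ∈ S) :
      TesterTrans S σ A c (some i) (some (ofList σ i)) (some (i + 1))
  | escape {i : ℕ} (h : i < σ.length) : TesterTrans S σ A c (some i) (some c) none
  | offer {a : Act.{u}} (ha : a ∈ A) (hm : a ∈ S) :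
      TesterTrans S σ A c (some σ.length) (some a) none
  | run : TesterTrans S σ A c none (some c) none

/-- The process that executes `σ` and then offers `A`. Everywhere but in the state after `σ`
also `c` is possible; after `c` or an action in `A` it executes `c` forever. -/
def tester (S : Set Act.{u}) [Small.{u} S] (σ : List Act.{u}) (A : Set Act.{u}) (c : Act.{u}) :
    LTS.{u} where
  State := ULift.{u} (Option ℕ)
  alphabet := insert c S
  small_alphabet := inferInstance
  trans s l s' := TesterTrans S σ A c s.down l s'.down
  trans_mem := by
    rintro ⟨s⟩ a ⟨s'⟩ h
    cases h with
    | step h hm => exact Set.mem_insert_of_mem _ hm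
    | escape h => exact Set.mem_insert _ _
    | offer ha hm => exact Set.mem_insert_of_mem _ hm
    | run => exact Set.mem_insert _ _
  init := ⟨some 0⟩

section Tester

variable {L : LTS.{u}} {σ : List Act.{u}} {A : Set Act.{u}} {c : Act.{u}}

theorem tester_subset : L.alphabet ⊆ (tester L.alphabet σ A c).alphabet := Set.subset_insert _ _

theorem test_reach (hc : c ∉ L.alphabet) {ρ : List Act.{u}} {s : Option ℕ} {x : L.State}
    (h : (ctl (tester L.alphabet σ A c) L).Reach (⟨some 0⟩, L.init) ρ (⟨s⟩, x)) :
    (∃ i, s = some i ∧ i ≤ σ.length ∧ L.Reach L.init (σ.take i) x) ∨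
    (s = none ∧ ∃ θ, L.Reach L.init θ x ∧ ((∃ i, θ = σ.take i) ∨ ∃ a ∈ A, θ = σ ++ [a])) := by
  refine Reach.induction (L := ctl (tester L.alphabet σ A c) L) (s := (⟨some 0⟩, L.init))
    (P := fun ρ s =>
    (∃ i, s.1.down = some i ∧ i ≤ σ.length ∧ L.Reach L.init (σ.take i) s.2) ∨
    (s.1.down = none ∧
      ∃ θ, L.Reach L.init θ s.2 ∧ ((∃ i, θ = σ.take i) ∨ ∃ a ∈ A, θ = σ ++ [a]))) ?_ ?_ ?_ h
  · exact Or.inl ⟨0, rfl, Nat.zero_le _, Reach.refl _⟩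
  · rintro ρ ⟨⟨s⟩, x⟩ ⟨⟨s'⟩, x'⟩ ih h
    rcases (ctl_trans_none tester_subset).1 h with ⟨h4, -⟩ | ⟨h4, h5⟩ | ⟨b, hb, h4, h5⟩
    · cases h4
    · cases h5
      rcases ih with ⟨i, h1, h2, h3⟩ | ⟨h1, θ, h2, h3⟩
      · exact Or.inl ⟨i, h1, h2, h3.tau_right (Reach.of_tau h4)⟩
      · exact Or.inr ⟨h1, θ, h2.tau_right (Reach.of_tau h4), h3⟩
    · cases h4 with
      | step hi hm =>
        rcases ih with ⟨_, h1, h2, h3⟩ | ⟨h1, -⟩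
        · cases h1
          refine Or.inl ⟨_, rfl, hi, ?_⟩
          rw [← pre_ofList σ hi, pre_succ, pre_ofList σ h2]
          exact h3.append (Reach.of_vis h5)
        · cases h1
      | escape hi => exact absurd hb hc
      | offer ha hm =>
        rcases ih with ⟨_, h1, h2, h3⟩ | ⟨h1, -⟩
        · cases h1
          rw [List.take_length] at h3
          exact Or.inr ⟨rfl, _, h3.append (Reach.of_vis h5), Or.inr ⟨_, ha, rfl⟩⟩
        · cases h1
      | run => exact absurd hb hc
  · rintro ρ ⟨⟨s⟩, x⟩ a ⟨⟨s'⟩, x'⟩ ih h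
    obtain ⟨ha, h4, h5⟩ := (ctl_trans_some tester_subset).1 h
    cases h5
    cases h4 with
    | step hi hm => exact absurd hm ha
    | escape hi =>
      rcases ih with ⟨i, h1, h2, h3⟩ | ⟨h1, -⟩
      · exact Or.inr ⟨rfl, _, h3, Or.inl ⟨i, rfl⟩⟩
      · cases h1
    | offer _ hm => exact absurd hm ha
    | run =>
      rcases ih with ⟨i, h1, -⟩ | ih
      · cases h1
      · exact Or.inr ih

theorem test_reach_of_reach {i : ℕ} {x : L.State} (hi : i ≤ σ.length)
    (h : L.Reach L.init (σ.take i) x) :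
    (ctl (tester L.alphabet σ A c) L).Reach (⟨some 0⟩, L.init) [] (⟨some i⟩, x) := by
  rw [← pre_ofList σ hi] at h
  induction i generalizing x with
  | zero =>
    rw [pre_zero] at h
    exact ctl_tauReach_right tester_subset _ h
  | succ i ih =>
    rw [pre_succ] at h
    obtain ⟨y, h1, z, w, h2, h3, h4⟩ := reach_append_iff.1 h
    have h5 : TesterTrans L.alphabet σ A c (some i) (some (ofList σ i)) (some (i + 1)) :=
      .step (by omega) (L.trans_mem _ _ _ h3)
    have h6 := Reach.tau_right (ih (by omega) h1) (ctl_tauReach_right tester_subset _ h2)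
    have h7 := Reach.tau_right h6 (ctl_reach_of_sync (N := tester L.alphabet σ A c)
      (n := ⟨some i⟩) (n' := ⟨some (i + 1)⟩) tester_subset h5 h3)
    exact Reach.tau_right h7 (ctl_tauReach_right tester_subset _ h4)

theorem tester_not_diverges (hc : c ∉ L.alphabet) (s : Option ℕ) :
    ¬ ((tester L.alphabet σ A c).hide L.alphabet).Diverges ⟨s⟩ := by
  have hstep : ∀ s, ((tester L.alphabet σ A c).hide L.alphabet).Diverges ⟨s⟩ →
      ∃ i s', s = some i ∧ (s' = none ∨ i < σ.length ∧ s' = some (i + 1)) ∧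
        ((tester L.alphabet σ A c).hide L.alphabet).Diverges ⟨s'⟩ := by
    intro s h
    obtain ⟨⟨s'⟩, h1, h2⟩ := h.step
    rcases h1 with ⟨h, -⟩ | ⟨-, b, hb, h⟩
    · cases h
    · cases h with
      | step hi hm => exact ⟨_, _, rfl, Or.inr ⟨hi, rfl⟩, h2⟩
      | escape hi => exact absurd hb hc
      | offer ha hm => exact ⟨_, _, rfl, Or.inl rfl, h2⟩
      | run => exact absurd hb hc
  have hnone : ¬ ((tester L.alphabet σ A c).hide L.alphabet).Diverges ⟨none⟩ := by
    intro h
    obtain ⟨i, -, h1, -⟩ := hstep _ h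
    cases h1
  have hsome : ∀ k i, σ.length ≤ i + k →
      ¬ ((tester L.alphabet σ A c).hide L.alphabet).Diverges ⟨some i⟩ := by
    intro k
    induction k with
    | zero =>
      intro i hi h
      obtain ⟨_, _, h1, rfl | ⟨h2, rfl⟩, h3⟩ := hstep _ h
      · exact hnone h3
      · cases h1; omega
    | succ k ih =>
      intro i hi h
      obtain ⟨_, _, h1, rfl | ⟨h2, rfl⟩, h3⟩ := hstep _ h
      · exact hnone h3
      · cases h1; exact ih (i + 1) (by omega) h3
  cases s with
  | none => exact hnone
  | some i => exact hsome σ.length i (by omega)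

theorem Div_test (hc : c ∉ L.alphabet) (h1 : ∀ i, σ.take i ∉ L.Div)
    (h2 : ∀ a ∈ A, σ ++ [a] ∉ L.Div) : (ctl (tester L.alphabet σ A c) L).Div = ∅ := by
  refine Set.eq_empty_of_forall_notMem fun ρ h => ?_
  obtain ⟨⟨s⟩, x, h, hd | hd⟩ := ctl_mem_Div tester_subset h
  · exact tester_not_diverges hc s hd
  · rcases test_reach hc h with ⟨i, -, -, h3⟩ | ⟨-, θ, h3, ⟨i, rfl⟩ | ⟨a, ha, rfl⟩⟩
    · exact h1 i ⟨x, h3, hd⟩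
    · exact h1 i ⟨x, h3, hd⟩
    · exact h2 a ha ⟨x, h3, hd⟩

theorem mem_Sf_test (hc : c ∉ L.alphabet) (h : (σ, A) ∈ L.Sf) :
    ([], {c}) ∈ (ctl (tester L.alphabet σ A c) L).Sf := by
  obtain ⟨hA, x, h1, h2, h3⟩ := h
  have h1' : L.Reach L.init (σ.take σ.length) x := by rwa [List.take_length]
  refine ⟨?_, _, test_reach_of_reach le_rfl h1', ?_, ?_⟩
  · rw [ctl_alphabet, Set.singleton_subset_iff]
    exact ⟨Set.mem_insert _ _, hc⟩
  · rintro ⟨⟨s⟩, y⟩ h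
    rcases (ctl_trans_none tester_subset).1 h with ⟨h, -⟩ | ⟨h, -⟩ | ⟨b, hb, h, h'⟩
    · cases h
    · exact h2 _ h
    · have h4 : TesterTrans L.alphabet σ A c (some σ.length) (some b) s := h
      cases h4 with
      | step hi hm => omega
      | escape hi => omega
      | offer ha hm => exact h3 _ ha _ h'
  · intro b hb
    rw [Set.mem_singleton_iff.1 hb]
    rintro ⟨⟨s⟩, y⟩ h
    obtain ⟨-, h, -⟩ := (ctl_trans_some tester_subset).1 h
    have h4 : TesterTrans L.alphabet σ A c (some σ.length) (some c) s := h
    generalize hl : some c = l at h4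
    cases h4 with
    | step hi hm => omega
    | escape hi => omega
    | offer ha hm => cases hl; exact hc hm

theorem not_mem_Sf_test (hc : c ∉ L.alphabet) (hA : A ⊆ L.alphabet) (h : (σ, A) ∉ L.Sf)
    (ρ : List Act.{u}) : (ρ, {c}) ∉ (ctl (tester L.alphabet σ A c) L).Sf := by
  rintro ⟨-, ⟨⟨s⟩, x⟩, h1, h2, h3⟩
  have hc' : ∀ s' : Option ℕ, ¬ TesterTrans L.alphabet σ A c s (some c) s' := fun s' h4 =>
    h3 c rfl (⟨s'⟩, x) ((ctl_trans_some tester_subset).2 ⟨hc, h4, rfl⟩)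
  rcases test_reach hc h1 with ⟨i, rfl, hi, h4⟩ | ⟨rfl, -⟩
  · obtain rfl : i = σ.length := by
      by_contra hne
      exact hc' none (.escape (by omega))
    rw [List.take_length] at h4
    refine h ⟨hA, x, h4, fun x' h5 => ?_, fun a ha x' h5 => ?_⟩
    · exact h2 (_, x') ((ctl_trans_none tester_subset).2 (Or.inr (Or.inl ⟨h5, rfl⟩)))
    · exact h2 (⟨none⟩, x') ((ctl_trans_none tester_subset).2
        (Or.inr (Or.inr ⟨a, hA ha, TesterTrans.offer ha (hA ha), h5⟩)))
  · exact hc' none .run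

end Tester

/-- If `sanF` is not preserved, then `R` relates a process that may refuse its only action to one
that may not. -/
theorem separates_sanF {R : LTS.{u} → LTS.{u} → Prop} (hR : IsCongruence R)
    (hD : Preserves R minD) (h : ¬ Preserves R sanF) :
    ∃ S : Set Act.{u}, Small.{u} S ∧ ∀ c ∉ S, ∃ K K', R K K' ∧ K.alphabet = {c} ∧
      K'.alphabet = {c} ∧ K.Div = ∅ ∧ K'.Div = ∅ ∧ ([], {c}) ∈ K.Sf ∧
      ∀ ρ, (ρ, {c}) ∉ K'.Sf := by
  have halR := preserves_alphabet hR hD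
  obtain ⟨L, L', ⟨σ, A⟩, hLL, ⟨⟨hF, hext⟩, hA⟩, h'⟩ := exists_of_not_preserves hR h
  have hal := halR _ _ hLL
  have hext' : σ ∉ L'.extT := extT_congr hal (hD _ _ hLL) ▸ hext
  have hσ : ∀ a ∈ σ, a ∈ L.alphabet := Tr_mem_alphabet (hF.2.elim fun s h => ⟨s, h.1⟩)
  have h1 : ∀ i, σ.take i ∉ L.Div := fun i hi => hext (mem_extT_iff.2 ⟨hσ, i, hi⟩)
  have h1' : ∀ i, σ.take i ∉ L'.Div := fun i hi => hext' (mem_extT_iff.2 ⟨hal ▸ hσ, i, hi⟩)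
  -- An extension of `σ` by one action can only be a minimal divergence trace.
  have key : ∀ M : LTS.{u}, (∀ i, σ.take i ∉ M.Div) → ∀ a, σ ++ [a] ∈ M.Div →
      σ ++ [a] ∈ M.minD := by
    refine fun M hM a ha => ⟨ha, fun i hi h => hM i ?_⟩
    rw [List.length_append, List.length_singleton] at hi
    rwa [List.take_append_of_le_length (by omega)] at h
  have h2 : ∀ a ∈ A, σ ++ [a] ∉ L.Div := fun a ha h => hA a ha (key L h1 a h)
  have h2' : ∀ a ∈ A, σ ++ [a] ∉ L'.Div := fun a ha h =>
    hA a ha (hD _ _ hLL ▸ key L' h1' a h)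
  have hF' : (σ, A) ∉ L'.Sf := fun h => h' ⟨⟨h, hext'⟩, fun a ha => hD _ _ hLL ▸ hA a ha⟩
  refine ⟨L.alphabet, inferInstance, fun c hc => ?_⟩
  have hc' : c ∉ L'.alphabet := hal ▸ hc
  have htest : tester L.alphabet σ A c = tester L'.alphabet σ A c := by
    have : ∀ (S T : Set Act.{u}) (hS : Small.{u} S) (hT : Small.{u} T), S = T →
        tester S σ A c = tester T σ A c := by
      rintro S _ hS hT rfl
      rfl
    exact this _ _ _ _ hal
  have hdiff := insert_sdiff_eq_singleton hc
  refine ⟨_, _, hR.ctl (tester L.alphabet σ A c) hal hLL, ?_, ?_, Div_test hc h1 h2, ?_,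
    mem_Sf_test hc hF, ?_⟩
  · exact ctl_alphabet.trans hdiff
  · exact ctl_alphabet.trans (hal ▸ hdiff)
  · rw [htest]; exact Div_test hc' h1' h2'
  · rw [htest]; exact not_mem_Sf_test hc' (hal ▸ hF.1) hF'

/-! ### Forgetting the stable failures -/

/-- The transitions of `waiter`. -/
inductive WaiterTrans (L : LTS.{u}) (c : Act.{u}) :
    Option (L.State × Bool) → Option Act.{u} → Option (L.State × Bool) → Prop
  | start (b : Bool) : WaiterTrans L c none none (some (L.init, b))
  | tau {s t : L.State} (h : L.trans s none t) :
      WaiterTrans L c (some (s, false)) none (some (t, false))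
  | vis {s t : L.State} {a : Act.{u}} (h : L.trans s (some a) t) (b : Bool) :
      WaiterTrans L c (some (s, false)) (some a) (some (t, b))
  | go (s : L.State) : WaiterTrans L c (some (s, true)) (some c) (some (s, false))

/-- The process that behaves like `L`, but initially and after each visible action may decide to
wait for a `c`. The waiting states are marked by `true`. -/
def waiter (L : LTS.{u}) (c : Act.{u}) : LTS.{u} where
  State := Option (L.State × Bool)
  alphabet := insert c L.alphabet
  small_alphabet := inferInstance
  trans := WaiterTrans L c
  trans_mem := by
    intro s a s' h
    cases h with
    | vis h b => exact Set.mem_insert_of_mem _ (L.trans_mem _ _ _ h)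
    | go s => exact Set.mem_insert _ _
  init := none

section Waiter

variable {L K : LTS.{u}} {c : Act.{u}}

/-- The state of `L` that underlies a state of `waiter L c`. -/
def waiterState (L : LTS.{u}) : Option (L.State × Bool) → L.State
  | none => L.init
  | some (s, _) => s

theorem waiter_subset (hK : K.alphabet = {c}) : K.alphabet ⊆ (waiter L c).alphabet := by
  rw [hK, Set.singleton_subset_iff]
  exact Set.mem_insert _ _

theorem ctl_waiter_alphabet (hK : K.alphabet = {c}) (hc : c ∉ L.alphabet) :
    (ctl (waiter L c) K).alphabet = L.alphabet := by
  rw [ctl_alphabet, hK]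
  exact Set.insert_sdiff_self_of_notMem hc

/-- The underlying state of `L` simulates the silent steps of a controlled waiter. -/
theorem ctl_waiter_sim_tau (hK : K.alphabet = {c}) (hc : c ∉ L.alphabet)
    (a : (ctl (waiter L c) K).State) (b : L.State) (a' : (ctl (waiter L c) K).State)
    (hb : b = waiterState L a.1) (h : (ctl (waiter L c) K).trans a none a') :
    ∃ b', L.Reach b [] b' ∧ b' = waiterState L a'.1 := by
  subst hb
  obtain ⟨w, x⟩ := a
  obtain ⟨w', x'⟩ := a'
  rcases (ctl_trans_none (waiter_subset hK)).1 h with ⟨h1, -⟩ | ⟨-, rfl⟩ | ⟨b, hb, h1, -⟩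
  · cases h1 with
    | start b => exact ⟨_, Reach.refl _, rfl⟩
    | tau ht => exact ⟨_, Reach.of_tau ht, rfl⟩
  · exact ⟨_, Reach.refl _, rfl⟩
  · cases h1 with
    | vis ht =>
      rw [hK] at hb
      exact absurd (L.trans_mem _ _ _ ht) (Set.mem_singleton_iff.1 hb ▸ hc)
    | go s => exact ⟨_, Reach.refl _, rfl⟩

/-- The underlying state of `L` simulates the visible steps of a controlled waiter. -/
theorem ctl_waiter_sim_vis (hK : K.alphabet = {c})
    (a : (ctl (waiter L c) K).State) (b : L.State) (l : Act.{u}) (a' : (ctl (waiter L c) K).State)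
    (hb : b = waiterState L a.1) (h : (ctl (waiter L c) K).trans a (some l) a') :
    ∃ b', L.Reach b [l] b' ∧ b' = waiterState L a'.1 := by
  subst hb
  obtain ⟨w, x⟩ := a
  obtain ⟨w', x'⟩ := a'
  obtain ⟨hl, h1, -⟩ := (ctl_trans_some (waiter_subset hK)).1 h
  cases h1 with
  | vis ht => exact ⟨_, Reach.of_vis ht, rfl⟩
  | go s => exact absurd (hK ▸ rfl) hl

theorem ctl_waiter_reach (hK : K.alphabet = {c}) (hc : c ∉ L.alphabet) {σ : List Act.{u}}
    {w : Option (L.State × Bool)} {x : K.State}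
    (h : (ctl (waiter L c) K).Reach (none, K.init) σ (w, x)) :
    L.Reach L.init σ (waiterState L w) := by
  obtain ⟨b, h1, rfl⟩ := Reach.simulate (B := L) (ctl_waiter_sim_tau hK hc)
    (ctl_waiter_sim_vis hK) rfl h
  exact h1

theorem ctl_waiter_hom (hK : K.alphabet = {c}) (hc : c ∉ L.alphabet) (s : L.State)
    (l : Option Act.{u}) (s' : L.State) (h : L.trans s l s') :
    (ctl (waiter L c) K).trans (some (s, false), K.init) l (some (s', false), K.init) := by
  cases l with
  | none => exact (ctl_trans_none (waiter_subset hK)).2 (Or.inl ⟨.tau h, rfl⟩)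
  | some a =>
    refine (ctl_trans_some (waiter_subset hK)).2 ⟨?_, .vis h false, rfl⟩
    rw [hK]
    exact fun ha => hc (Set.mem_singleton_iff.1 ha ▸ L.trans_mem _ _ _ h)

theorem ctl_waiter_start (hK : K.alphabet = {c}) (b : Bool) :
    (ctl (waiter L c) K).Reach (none, K.init) [] (some (L.init, b), K.init) :=
  ctl_reach_of_tau (N := waiter L c) (waiter_subset hK) K.init (.start b)

theorem waiter_hide_diverges (hc : c ∉ L.alphabet) {w : Option (L.State × Bool)}
    (h : ((waiter L c).hide {c}).Diverges w) : L.Diverges (waiterState L w) := by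
  have hfalse : ∀ s, ((waiter L c).hide {c}).Diverges (some (s, false)) → L.Diverges s := by
    intro s hs
    refine diverges_coind (fun s => ((waiter L c).hide {c}).Diverges (some (s, false)))
      (fun s hs => ?_) hs
    obtain ⟨t, h1, h2⟩ := hs.step
    rcases h1 with ⟨h1, -⟩ | ⟨-, b, hb, h1⟩
    · cases h1 with
      | tau h => exact ⟨_, h, h2⟩
    · cases h1 with
      | vis h => exact absurd (L.trans_mem _ _ _ h) (Set.mem_singleton_iff.1 hb ▸ hc)
  have htrue : ∀ s, ((waiter L c).hide {c}).Diverges (some (s, true)) → L.Diverges s := by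
    intro s hs
    obtain ⟨t, h1, h2⟩ := hs.step
    rcases h1 with ⟨h1, -⟩ | ⟨-, b, hb, h1⟩
    · cases h1
    · cases h1 with
      | go s => exact hfalse _ h2
  rcases w with _ | ⟨s, _ | _⟩
  · obtain ⟨t, h1, h2⟩ := h.step
    rcases h1 with ⟨h1, -⟩ | ⟨-, b, hb, h1⟩
    · cases h1 with
      | start b => cases b with
        | false => exact hfalse _ h2
        | true => exact htrue _ h2
    · cases h1
  · exact hfalse _ h
  · exact htrue _ h

theorem ctl_waiter_semantics (hK : K.alphabet = {c}) (hc : c ∉ L.alphabet) (hKD : K.Div = ∅) :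
    (ctl (waiter L c) K).Tr = L.Tr ∧ (ctl (waiter L c) K).Div = L.Div ∧
      (ctl (waiter L c) K).Inf = L.Inf := by
  obtain ⟨h1, h2, h3⟩ := semantics_subset_of_hom (A := L) (B := ctl (waiter L c) K)
    (fun s => (some (s, false), K.init)) (ctl_waiter_hom hK hc) (ctl_waiter_start hK false)
  refine ⟨Set.Subset.antisymm ?_ h1, Set.Subset.antisymm ?_ h2, Set.Subset.antisymm ?_ h3⟩
  · rintro σ ⟨⟨w, x⟩, h⟩
    exact ⟨_, ctl_waiter_reach hK hc h⟩
  · intro σ h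
    obtain ⟨w, x, h, hd | hd⟩ := ctl_mem_Div (waiter_subset hK) h
    · rw [hK] at hd
      exact ⟨_, ctl_waiter_reach hK hc h, waiter_hide_diverges hc hd⟩
    · classical
      obtain ⟨ρ, -, h4, -⟩ := (ctl_reach_iff (waiter_subset hK)).1 h
      have : ρ.filter (· ∈ K.alphabet) ∈ K.Div := ⟨x, h4, hd⟩
      rw [hKD] at this
      exact this.elim
  · exact fun ξ h => InfReach.simulate (B := L) (ctl_waiter_sim_tau hK hc)
      (ctl_waiter_sim_vis hK) rfl h

/-- If `K` can refuse `c` initially, then the waiting states become deadlocks. -/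
theorem ctl_waiter_Sf_of_refusal (hK : K.alphabet = {c}) (hc : c ∉ L.alphabet)
    (hS : ([], {c}) ∈ K.Sf) :
    (ctl (waiter L c) K).Sf = {p | p.2 ⊆ L.alphabet ∧ p.1 ∈ L.Tr} := by
  ext ⟨σ, A⟩
  constructor
  · rintro ⟨hA, ⟨w, x⟩, h, -⟩
    exact ⟨ctl_waiter_alphabet hK hc ▸ hA, _, ctl_waiter_reach hK hc h⟩
  · rintro ⟨hA, s, hs⟩
    obtain ⟨-, k, hk, hk1, hk2⟩ := hS
    have hr : ∃ t, (ctl (waiter L c) K).Reach (none, K.init) σ (some (t, true), K.init) := by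
      rcases List.eq_nil_or_concat' σ with rfl | ⟨σ, a, rfl⟩
      · exact ⟨_, ctl_waiter_start hK true⟩
      · obtain ⟨t, h1, v, w, h2, h3, -⟩ := reach_append_iff.1 hs
        have h4 := Reach.map (B := ctl (waiter L c) K) (fun s => (some (s, false), K.init))
          (ctl_waiter_hom hK hc) (h1.tau_right h2)
        refine ⟨w, (Reach.tau_left (ctl_waiter_start hK false) h4).append
          (ctl_reach_of_vis (N := waiter L c) (waiter_subset hK) _ ?_ (.vis h3 true))⟩
        rw [hK]
        exact fun ha => hc (Set.mem_singleton_iff.1 ha ▸ L.trans_mem _ _ _ h3)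
    obtain ⟨t, ht⟩ := hr
    refine ⟨(ctl_waiter_alphabet hK hc).symm ▸ hA, _,
      Reach.tau_right ht (ctl_tauReach_right (waiter_subset hK) _ hk), ?_, ?_⟩
    · rintro ⟨w, x⟩ h
      rcases (ctl_trans_none (waiter_subset hK)).1 h with ⟨h1, -⟩ | ⟨h1, -⟩ | ⟨b, hb, -, h2⟩
      · cases h1
      · exact hk1 _ h1
      · exact hk2 b (hK ▸ hb) _ h2
    · rintro a ha ⟨w, x⟩ h
      obtain ⟨-, h1, -⟩ := (ctl_trans_some (waiter_subset hK)).1 h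
      cases h1 with
      | go s => exact hc (hA ha)

/-- If `K` can never refuse `c`, then waiting has no effect. -/
theorem ctl_waiter_Sf_of_offer (hK : K.alphabet = {c}) (hc : c ∉ L.alphabet) (hKD : K.Div = ∅)
    (hS : ∀ ρ, (ρ, {c}) ∉ K.Sf) : (ctl (waiter L c) K).Sf = L.Sf := by
  ext ⟨σ, A⟩
  constructor
  · rintro ⟨hA, ⟨w, x⟩, h, h1, h2⟩
    have hA' : A ⊆ L.alphabet := ctl_waiter_alphabet hK hc ▸ hA
    have hr := ctl_waiter_reach hK hc h
    rcases w with _ | ⟨s, _ | _⟩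
    · exact absurd ((ctl_trans_none (waiter_subset hK)).2 (Or.inl ⟨.start true, rfl⟩)) (h1 (_, x))
    · refine ⟨hA', s, hr, fun t ht => ?_, fun a ha t ht => ?_⟩
      · exact h1 (_, x) ((ctl_trans_none (waiter_subset hK)).2 (Or.inl ⟨.tau ht, rfl⟩))
      · refine h2 a ha (_, x) ((ctl_trans_some (waiter_subset hK)).2 ⟨?_, .vis ht true, rfl⟩)
        rw [hK]
        exact fun hac => hc (Set.mem_singleton_iff.1 hac ▸ hA' ha)
    · exfalso
      classical
      obtain ⟨ρ, -, h4, -⟩ := (ctl_reach_iff (waiter_subset hK)).1 h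
      refine hS _ ⟨hK.ge, x, h4, fun y hy => ?_, ?_⟩
      · exact h1 (_, y) ((ctl_trans_none (waiter_subset hK)).2 (Or.inr (Or.inl ⟨hy, rfl⟩)))
      · rintro b hb y hy
        rw [Set.mem_singleton_iff.1 hb] at hy
        exact h1 (_, y) ((ctl_trans_none (waiter_subset hK)).2
          (Or.inr (Or.inr ⟨c, hK ▸ rfl, .go s, hy⟩)))
  · rintro ⟨hA, s, h, h1, h2⟩
    have hKi : ¬ K.Diverges K.init := fun hd => by
      have : [] ∈ K.Div := ⟨_, Reach.refl _, hd⟩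
      rw [hKD] at this
      exact this
    obtain ⟨k, hk, hk1⟩ := exists_stable hKi
    have h4 := Reach.map (B := ctl (waiter L c) K) (fun s => (some (s, false), K.init))
      (ctl_waiter_hom hK hc) h
    refine ⟨(ctl_waiter_alphabet hK hc).symm ▸ hA, _,
      Reach.tau_right (Reach.tau_left (ctl_waiter_start hK false) h4)
        (ctl_tauReach_right (waiter_subset hK) _ hk), ?_, ?_⟩
    · rintro ⟨w, x⟩ h
      rcases (ctl_trans_none (waiter_subset hK)).1 h with ⟨h5, -⟩ | ⟨h5, -⟩ | ⟨b, hb, h5, -⟩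
      · cases h5 with
        | tau ht => exact h1 _ ht
      · exact hk1 _ h5
      · cases h5 with
        | vis ht =>
          rw [hK] at hb
          exact absurd (L.trans_mem _ _ _ ht) (Set.mem_singleton_iff.1 hb ▸ hc)
    · rintro a ha ⟨w, x⟩ h
      obtain ⟨-, h5, -⟩ := (ctl_trans_some (waiter_subset hK)).1 h
      cases h5 with
      | vis ht => exact h2 a ha _ ht

end Waiter

/-- Without `sanF`, the stable failures are irrelevant: each process is related to one that may
refuse everything after each of its traces. -/
theorem related_of_semantics_eq {R : LTS.{u} → LTS.{u} → Prop} (hR : IsCongruence R)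
    (hCFFD : ∀ L L' : LTS.{u}, CFFD L L' → R L L') (hD : Preserves R minD)
    (h : ¬ Preserves R sanF) {L L' : LTS.{u}} (h0 : L.alphabet = L'.alphabet)
    (h1 : L.Tr = L'.Tr) (h2 : L.Div = L'.Div) (h3 : L.Inf = L'.Inf) : R L L' := by
  obtain ⟨S, hS, hsep⟩ := separates_sanF hR hD h
  obtain ⟨c, hc⟩ := exists_fresh (S ∪ L.alphabet)
  have hcL : c ∉ L.alphabet := fun h => hc (Or.inr h)
  obtain ⟨K, K', hKK, hK, hK', hKD, hKD', hF, hF'⟩ := hsep c fun h => hc (Or.inl h)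
  have key : ∀ M : LTS.{u}, c ∉ M.alphabet → R M (ctl (waiter M c) K) := by
    intro M hcM
    obtain ⟨h4, h5, h6⟩ := ctl_waiter_semantics (L := M) hK' hcM hKD'
    have h7 : R M (ctl (waiter M c) K') := hCFFD _ _ ⟨(ctl_waiter_alphabet hK' hcM).symm,
      (ctl_waiter_Sf_of_offer hK' hcM hKD' hF').symm, h5.symm, h6.symm⟩
    exact hR.equiv.trans h7 (hR.ctl _ (hK'.trans hK.symm) (hR.equiv.symm hKK))
  have hcL' : c ∉ L'.alphabet := h0 ▸ hcL
  refine hR.equiv.trans (key L hcL) (hR.equiv.trans (hCFFD _ _ ?_) (hR.equiv.symm (key L' hcL')))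
  obtain ⟨-, h5, h6⟩ := ctl_waiter_semantics (L := L) hK hcL hKD
  obtain ⟨-, h5', h6'⟩ := ctl_waiter_semantics (L := L') hK hcL' hKD
  refine ⟨?_, ?_, h5.trans (h2.trans h5'.symm), h6.trans (h3.trans h6'.symm)⟩
  · rw [ctl_waiter_alphabet hK hcL, ctl_waiter_alphabet hK hcL', h0]
  · rw [ctl_waiter_Sf_of_refusal hK hcL hF, ctl_waiter_Sf_of_refusal hK hcL' hF, h0, h1]

/-! ### Internal choice between controllers -/

/-- The transitions of `choice`. -/
inductive ChoiceTrans {J : Type u} (F : J → LTS.{u}) :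
    Option (Σ j, (F j).State) → Option Act.{u} → Option (Σ j, (F j).State) → Prop
  | start (j : J) : ChoiceTrans F none none (some ⟨j, (F j).init⟩)
  | step {j : J} {s s' : (F j).State} {l : Option Act.{u}} (h : (F j).trans s l s') :
      ChoiceTrans F (some ⟨j, s⟩) l (some ⟨j, s'⟩)

/-- The internal choice between the processes `F j`. -/
def choice {J : Type u} (F : J → LTS.{u}) : LTS.{u} where
  State := Option (Σ j, (F j).State)
  alphabet := ⋃ j, (F j).alphabet
  small_alphabet := inferInstance
  trans := ChoiceTrans F
  trans_mem := by
    intro s a s' h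
    cases h with
    | step h => exact Set.mem_iUnion.2 ⟨_, (F _).trans_mem _ _ _ h⟩
  init := none

section Choice

variable {J : Type u} {F : J → LTS.{u}} {K : LTS.{u}}

theorem choice_subset [Nonempty J] (hF : ∀ j, K.alphabet ⊆ (F j).alphabet) :
    K.alphabet ⊆ (choice F).alphabet :=
  (hF (Classical.arbitrary J)).trans (Set.subset_iUnion (fun j => (F j).alphabet) _)

theorem ctl_choice_hom [Nonempty J] (hF : ∀ j, K.alphabet ⊆ (F j).alphabet) (j : J)
    (y : (ctl (F j) K).State) (l : Option Act.{u}) (y' : (ctl (F j) K).State)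
    (h : (ctl (F j) K).trans y l y') :
    (ctl (choice F) K).trans (some ⟨j, y.1⟩, y.2) l (some ⟨j, y'.1⟩, y'.2) := by
  obtain ⟨s, x⟩ := y
  obtain ⟨s', x'⟩ := y'
  cases l with
  | none =>
    refine (ctl_trans_none (choice_subset hF)).2 ?_
    rcases (ctl_trans_none (hF j)).1 h with ⟨h1, h2⟩ | ⟨h1, h2⟩ | ⟨b, hb, h1, h2⟩
    · exact Or.inl ⟨.step h1, h2⟩
    · exact Or.inr (Or.inl ⟨h1, by cases h2; rfl⟩)
    · exact Or.inr (Or.inr ⟨b, hb, .step h1, h2⟩)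
  | some a =>
    obtain ⟨h1, h2, h3⟩ := (ctl_trans_some (hF j)).1 h
    exact (ctl_trans_some (choice_subset hF)).2 ⟨h1, .step h2, h3⟩

theorem ctl_choice_trans [Nonempty J] (hF : ∀ j, K.alphabet ⊆ (F j).alphabet) {j : J}
    {s : (F j).State} {x : K.State} {l : Option Act.{u}} {y : (ctl (choice F) K).State}
    (h : (ctl (choice F) K).trans (some ⟨j, s⟩, x) l y) :
    ∃ s' x', y = (some ⟨j, s'⟩, x') ∧ (ctl (F j) K).trans (s, x) l (s', x') := by
  obtain ⟨w, x'⟩ := y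
  cases l with
  | none =>
    rcases (ctl_trans_none (choice_subset hF)).1 h with ⟨h1, h2⟩ | ⟨h1, rfl⟩ | ⟨b, hb, h1, h2⟩
    · cases h1 with
      | step h1 => exact ⟨_, _, rfl, (ctl_trans_none (hF j)).2 (Or.inl ⟨h1, h2⟩)⟩
    · exact ⟨s, x', rfl, (ctl_trans_none (hF j)).2 (Or.inr (Or.inl ⟨h1, rfl⟩))⟩
    · cases h1 with
      | step h1 =>
        exact ⟨_, _, rfl, (ctl_trans_none (hF j)).2 (Or.inr (Or.inr ⟨b, hb, h1, h2⟩))⟩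
  | some a =>
    obtain ⟨h1, h2, h3⟩ := (ctl_trans_some (choice_subset hF)).1 h
    cases h2 with
    | step h2 => exact ⟨_, _, rfl, (ctl_trans_some (hF j)).2 ⟨h1, h2, h3⟩⟩

theorem ctl_choice_trans_none [Nonempty J] (hF : ∀ j, K.alphabet ⊆ (F j).alphabet)
    {x : K.State} {l : Option Act.{u}} {y : (ctl (choice F) K).State}
    (h : (ctl (choice F) K).trans (none, x) l y) :
    l = none ∧ ((∃ j, y = (some ⟨j, (F j).init⟩, x)) ∨ ∃ x', y = (none, x') ∧
      K.trans x none x') := by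
  obtain ⟨w, x'⟩ := y
  cases l with
  | none =>
    rcases (ctl_trans_none (choice_subset hF)).1 h with ⟨h1, rfl⟩ | ⟨h1, rfl⟩ | ⟨b, hb, h1, h2⟩
    · cases h1 with
      | start j => exact ⟨rfl, Or.inl ⟨j, rfl⟩⟩
    · exact ⟨rfl, Or.inr ⟨x', rfl, h1⟩⟩
    · cases h1
  | some a =>
    obtain ⟨h1, h2, h3⟩ := (ctl_trans_some (choice_subset hF)).1 h
    cases h2

theorem ctl_choice_reach [Nonempty J] (hF : ∀ j, K.alphabet ⊆ (F j).alphabet) {σ : List Act.{u}}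
    {y : (ctl (choice F) K).State}
    (h : (ctl (choice F) K).Reach (ctl (choice F) K).init σ y) :
    (σ = [] ∧ ∃ x, y = (none, x) ∧ K.Reach K.init [] x) ∨
      ∃ j s x, y = (some ⟨j, s⟩, x) ∧
        (ctl (F j) K).Reach (ctl (F j) K).init σ (s, x) := by
  refine Reach.induction (L := ctl (choice F) K) (s := (ctl (choice F) K).init) (P := fun σ y =>
    (σ = [] ∧ ∃ x, y = (none, x) ∧ K.Reach K.init [] x) ∨
      ∃ j s x, y = (some ⟨j, s⟩, x) ∧
        (ctl (F j) K).Reach (ctl (F j) K).init σ (s, x)) ?_ ?_ ?_ h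
  · exact Or.inl ⟨rfl, _, rfl, Reach.refl _⟩
  · rintro σ y y' (⟨rfl, x, rfl, h1⟩ | ⟨j, s, x, rfl, h1⟩) h
    · obtain ⟨-, ⟨j, rfl⟩ | ⟨x', rfl, h2⟩⟩ := ctl_choice_trans_none hF h
      · exact Or.inr ⟨j, _, _, rfl, ctl_tauReach_right (hF j) _ h1⟩
      · exact Or.inl ⟨rfl, x', rfl, h1.tau_right (Reach.of_tau h2)⟩
    · obtain ⟨s', x', rfl, h2⟩ := ctl_choice_trans hF h
      exact Or.inr ⟨j, s', x', rfl, h1.tau_right (Reach.of_tau h2)⟩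
  · rintro σ y a y' (⟨rfl, x, rfl, h1⟩ | ⟨j, s, x, rfl, h1⟩) h
    · cases (ctl_choice_trans_none hF h).1
    · obtain ⟨s', x', rfl, h2⟩ := ctl_choice_trans hF h
      exact Or.inr ⟨j, s', x', rfl, h1.append (Reach.of_vis h2)⟩

theorem ctl_choice_diverges [Nonempty J] (hF : ∀ j, K.alphabet ⊆ (F j).alphabet) {j : J}
    {s : (F j).State} {x : K.State} (h : (ctl (choice F) K).Diverges (some ⟨j, s⟩, x)) :
    (ctl (F j) K).Diverges (s, x) := by
  refine diverges_coind (L := ctl (F j) K)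
    (fun y => (ctl (choice F) K).Diverges (some ⟨j, y.1⟩, y.2)) ?_ h
  rintro ⟨s, x⟩ h
  obtain ⟨y, h1, h2⟩ := h.step
  obtain ⟨s', x', rfl, h3⟩ := ctl_choice_trans hF h1
  exact ⟨(s', x'), h3, h2⟩

theorem ctl_choice_diverges_none [Nonempty J] (hF : ∀ j, K.alphabet ⊆ (F j).alphabet)
    {x : K.State} (h : (ctl (choice F) K).Diverges (none, x)) :
    ∃ j, (ctl (F j) K).Diverges ((F j).init, x) := by
  by_cases hx : K.Diverges x
  · exact ⟨Classical.arbitrary J, ctl_diverges_right (hF _) _ hx⟩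
  · have hacc := not_not.1 (mt diverges_iff_not_acc.2 hx)
    clear hx
    induction hacc with
    | intro x _ ih =>
      obtain ⟨y, h1, h2⟩ := h.step
      obtain ⟨-, ⟨j, rfl⟩ | ⟨x', rfl, h3⟩⟩ := ctl_choice_trans_none hF h1
      · exact ⟨j, ctl_choice_diverges hF h2⟩
      · obtain ⟨j, hj⟩ := ih x' h3 h2
        exact ⟨j, Diverges.of_tau (L := ctl (F j) K)
          ((ctl_trans_none (hF j)).2 (Or.inr (Or.inl ⟨h3, rfl⟩))) hj⟩

theorem ctl_choice_semantics [Nonempty J] (hF : ∀ j, K.alphabet ⊆ (F j).alphabet) :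
    (ctl (choice F) K).Tr = ⋃ j, (ctl (F j) K).Tr ∧
      (ctl (choice F) K).Div = ⋃ j, (ctl (F j) K).Div ∧
      (ctl (choice F) K).Inf = ⋃ j, (ctl (F j) K).Inf := by
  have hom := fun j => semantics_subset_of_hom (A := ctl (F j) K) (B := ctl (choice F) K)
    (fun y => (some ⟨j, y.1⟩, y.2)) (ctl_choice_hom hF j)
    (ctl_reach_of_tau (N := choice F) (choice_subset hF) K.init (.start j))
  refine ⟨Set.Subset.antisymm ?_ (Set.iUnion_subset fun j => (hom j).1),
    Set.Subset.antisymm ?_ (Set.iUnion_subset fun j => (hom j).2.1),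
    Set.Subset.antisymm ?_ (Set.iUnion_subset fun j => (hom j).2.2)⟩
  · rintro σ ⟨y, h⟩
    rcases ctl_choice_reach hF h with ⟨rfl, -⟩ | ⟨j, s, x, -, h1⟩
    · exact Set.mem_iUnion.2 ⟨Classical.arbitrary J, nil_mem_Tr _⟩
    · exact Set.mem_iUnion.2 ⟨j, _, h1⟩
  · rintro σ ⟨y, h, hd⟩
    rcases ctl_choice_reach hF h with ⟨rfl, x, rfl, h1⟩ | ⟨j, s, x, rfl, h1⟩
    · obtain ⟨j, hj⟩ := ctl_choice_diverges_none hF hd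
      exact Set.mem_iUnion.2 ⟨j, _, ctl_tauReach_right (hF j) _ h1, hj⟩
    · exact Set.mem_iUnion.2 ⟨j, _, h1, ctl_choice_diverges hF hd⟩
  · intro ξ h
    obtain ⟨z, h0, hz⟩ := InfReach.exists_reach h
    have h1 := hz 0
    rw [h0] at h1
    rcases ctl_choice_reach hF h1 with ⟨h2, -⟩ | ⟨j, s, x, h2, h3⟩
    · cases h2
    · refine Set.mem_iUnion.2 ⟨j, infReach_cons h3 ?_⟩
      have h4 : (ctl (choice F) K).InfReach (z 1) fun n => ξ (n + 1) :=
        infReach_of_reach (fun n => z (n + 1)) fun n => hz (n + 1)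
      refine InfReach.simulate (B := ctl (F j) K)
        (r := fun y b => y = (some ⟨j, b.1⟩, b.2)) ?_ ?_ h2 h4
      · rintro _ b y rfl h
        obtain ⟨s', x', rfl, h5⟩ := ctl_choice_trans hF h
        exact ⟨(s', x'), Reach.of_tau h5, rfl⟩
      · rintro _ b a y rfl h
        obtain ⟨s', x', rfl, h5⟩ := ctl_choice_trans hF h
        exact ⟨(s', x'), Reach.of_vis h5, rfl⟩

end Choice

/-! ### Enlarging the alphabet -/

/-- `L` with `c` added to its alphabet. -/
def widen (L : LTS.{u}) (c : Act.{u}) : LTS.{u} where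
  State := L.State
  alphabet := insert c L.alphabet
  small_alphabet := inferInstance
  trans := L.trans
  trans_mem s a s' h := Set.mem_insert_of_mem _ (L.trans_mem s a s' h)
  init := L.init

section Widen

variable {L K : LTS.{u}} {c : Act.{u}}

theorem widen_subset (hK : K.alphabet = {c}) : K.alphabet ⊆ (widen L c).alphabet := by
  rw [hK, Set.singleton_subset_iff]
  exact Set.mem_insert _ _

theorem ctl_widen_trans (hK : K.alphabet = {c}) (hc : c ∉ L.alphabet) {s s' : L.State}
    {x x' : K.State} {l : Option Act.{u}}
    (h : (ctl (widen L c) K).trans (s, x) l (s', x')) :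
    (L.trans s l s' ∧ x' = x) ∨ (l = none ∧ K.trans x none x' ∧ s' = s) := by
  cases l with
  | none =>
    rcases (ctl_trans_none (widen_subset hK)).1 h with h1 | h1 | ⟨b, hb, h1, -⟩
    · exact Or.inl h1
    · exact Or.inr ⟨rfl, h1⟩
    · rw [hK] at hb
      exact absurd (L.trans_mem _ _ _ h1) (Set.mem_singleton_iff.1 hb ▸ hc)
  | some a => exact Or.inl ((ctl_trans_some (widen_subset hK)).1 h).2

theorem ctl_widen_reach (hK : K.alphabet = {c}) (hc : c ∉ L.alphabet) {σ : List Act.{u}}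
    {y : (ctl (widen L c) K).State}
    (h : (ctl (widen L c) K).Reach (ctl (widen L c) K).init σ y) :
    L.Reach L.init σ y.1 ∧ K.Reach K.init [] y.2 := by
  refine Reach.induction (L := ctl (widen L c) K) (s := (ctl (widen L c) K).init)
    (P := fun σ y => L.Reach L.init σ y.1 ∧ K.Reach K.init [] y.2) ?_ ?_ ?_ h
  · exact ⟨Reach.refl _, Reach.refl _⟩
  · rintro σ ⟨s, x⟩ ⟨s', x'⟩ ⟨h1, h2⟩ h
    rcases ctl_widen_trans hK hc h with ⟨h3, rfl⟩ | ⟨-, h3, rfl⟩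
    · exact ⟨h1.tau_right (Reach.of_tau h3), h2⟩
    · exact ⟨h1, h2.tau_right (Reach.of_tau h3)⟩
  · rintro σ ⟨s, x⟩ a ⟨s', x'⟩ ⟨h1, h2⟩ h
    rcases ctl_widen_trans hK hc h with ⟨h3, rfl⟩ | ⟨h3, -⟩
    · exact ⟨h1.append (Reach.of_vis h3), h2⟩
    · cases h3

theorem ctl_widen_semantics (hK : K.alphabet = {c}) (hc : c ∉ L.alphabet) (hKD : [] ∉ K.Div) :
    (ctl (widen L c) K).Tr = L.Tr ∧ (ctl (widen L c) K).Div = L.Div ∧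
      (ctl (widen L c) K).Inf = L.Inf := by
  obtain ⟨h1, h2, h3⟩ := semantics_subset_of_hom (A := L) (B := ctl (widen L c) K)
    (fun s => (s, K.init)) (fun s l s' h => by
      cases l with
      | none => exact (ctl_trans_none (widen_subset hK)).2 (Or.inl ⟨h, rfl⟩)
      | some a =>
        refine (ctl_trans_some (widen_subset hK)).2 ⟨?_, h, rfl⟩
        rw [hK]
        exact fun ha => hc (Set.mem_singleton_iff.1 ha ▸ L.trans_mem _ _ _ h)) (Reach.refl _)
  refine ⟨Set.Subset.antisymm ?_ h1, Set.Subset.antisymm ?_ h2, Set.Subset.antisymm ?_ h3⟩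
  · rintro σ ⟨y, h⟩
    exact ⟨_, (ctl_widen_reach hK hc h).1⟩
  · intro σ h
    obtain ⟨s, x, h, hd | hd⟩ := ctl_mem_Div (widen_subset hK) h
    · refine ⟨s, (ctl_widen_reach hK hc h).1, ?_⟩
      refine Diverges.map (A := (widen L c).hide K.alphabet) (B := L) (f := fun s : L.State => s)
        (fun s s' h => ?_) hd
      rcases h with ⟨h, -⟩ | ⟨-, b, hb, h⟩
      · exact h
      · rw [hK] at hb
        exact absurd (L.trans_mem _ _ _ h) (Set.mem_singleton_iff.1 hb ▸ hc)
    · exact absurd ⟨x, (ctl_widen_reach hK hc h).2, hd⟩ hKD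
  · intro ξ h
    refine InfReach.simulate (B := L) (r := fun (y : L.State × K.State) s => y.1 = s) ?_ ?_ rfl h
    · rintro ⟨s, x⟩ _ ⟨s', x'⟩ rfl h
      rcases ctl_widen_trans hK hc h with ⟨h3, rfl⟩ | ⟨-, h3, rfl⟩
      · exact ⟨s', Reach.of_tau h3, rfl⟩
      · exact ⟨s', Reach.refl _, rfl⟩
    · rintro ⟨s, x⟩ _ a ⟨s', x'⟩ rfl h
      rcases ctl_widen_trans hK hc h with ⟨h3, rfl⟩ | ⟨h3, -⟩
      · exact ⟨s', Reach.of_vis h3, rfl⟩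
      · cases h3

end Widen

/-! ### Extending the semantic sets within a class -/

section Extend

variable {R : LTS.{u} → LTS.{u} → Prop}

/-- `R` depends only on the alphabet and on the traces, divergence traces and infinite traces. -/
def IsLinear (R : LTS.{u} → LTS.{u} → Prop) : Prop :=
  ∀ L L' : LTS.{u}, L.alphabet = L'.alphabet → L.Tr = L'.Tr → L.Div = L'.Div → L.Inf = L'.Inf →
    R L L'

/-- If `K'` adds nothing to `L` when it is driven by certain scripts, then everything that `K` adds
when it is driven by them can be added to `L` without leaving the class of `L`. -/
theorem exists_extension (hR : IsCongruence R) (hlin : IsLinear R) {K K' L : LTS.{u}}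
    {c : Act.{u}} (hKK : R K K') (hK : K.alphabet = {c}) (hK' : K'.alphabet = {c})
    (hKD : [] ∉ K.Div) (hKD' : [] ∉ K'.Div) (hc : c ∉ L.alphabet) {J : Type u}
    (ξ : J → ℕ → Act.{u}) (q : J → ℕ → ℕ) (len : J → ℕ∞)
    (hTr : ∀ j, (ctl (script L.alphabet c (ξ j) (q j) (len j) False) K').Tr ⊆ L.Tr)
    (hDiv : ∀ j, (ctl (script L.alphabet c (ξ j) (q j) (len j) False) K').Div ⊆ L.Div)
    (hInf : ∀ j, (ctl (script L.alphabet c (ξ j) (q j) (len j) False) K').Inf ⊆ L.Inf) :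
    ∃ M, R L M ∧ M.alphabet = L.alphabet ∧
      M.Tr = L.Tr ∪ ⋃ j, (ctl (script L.alphabet c (ξ j) (q j) (len j) False) K).Tr ∧
      M.Div = L.Div ∪ ⋃ j, (ctl (script L.alphabet c (ξ j) (q j) (len j) False) K).Div ∧
      M.Inf = L.Inf ∪ ⋃ j, (ctl (script L.alphabet c (ξ j) (q j) (len j) False) K).Inf := by
  let F : Option J → LTS.{u} := fun o =>
    o.casesOn (widen L c) fun j => script L.alphabet c (ξ j) (q j) (len j) False
  have hal : ∀ o, (F o).alphabet = insert c L.alphabet := fun o => by cases o <;> rfl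
  have hF : ∀ N : LTS.{u}, N.alphabet = {c} → ∀ o, N.alphabet ⊆ (F o).alphabet := by
    intro N hN o
    rw [hN, hal, Set.singleton_subset_iff]
    exact Set.mem_insert _ _
  have halF : ∀ N : LTS.{u}, N.alphabet = {c} → (ctl (choice F) N).alphabet = L.alphabet := by
    intro N hN
    rw [ctl_alphabet, hN]
    show (⋃ o, (F o).alphabet) \ {c} = _
    simp only [hal, Set.iUnion_const]
    exact Set.insert_sdiff_self_of_notMem hc
  have hsem : ∀ N : LTS.{u}, N.alphabet = {c} → [] ∉ N.Div →
      (ctl (choice F) N).Tr = L.Tr ∪ ⋃ j, (ctl (F (some j)) N).Tr ∧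
      (ctl (choice F) N).Div = L.Div ∪ ⋃ j, (ctl (F (some j)) N).Div ∧
      (ctl (choice F) N).Inf = L.Inf ∪ ⋃ j, (ctl (F (some j)) N).Inf := by
    intro N hN hND
    obtain ⟨h1, h2, h3⟩ := ctl_choice_semantics (hF N hN)
    obtain ⟨h4, h5, h6⟩ := ctl_widen_semantics (L := L) hN hc hND
    rw [h1, h2, h3, Set.iUnion_option, Set.iUnion_option, Set.iUnion_option]
    exact ⟨congrArg₂ _ h4 rfl, congrArg₂ _ h5 rfl, congrArg₂ _ h6 rfl⟩
  obtain ⟨h1, h2, h3⟩ := hsem K' hK' hKD'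
  refine ⟨ctl (choice F) K, ?_, halF K hK, hsem K hK hKD⟩
  refine hR.equiv.trans (hlin _ _ (halF K' hK').symm ?_ ?_ ?_)
    (hR.ctl _ (hK'.trans hK.symm) (hR.equiv.symm hKK))
  · rw [h1, Set.union_eq_left.2 (Set.iUnion_subset hTr)]
  · rw [h2, Set.union_eq_left.2 (Set.iUnion_subset hDiv)]
  · rw [h3, Set.union_eq_left.2 (Set.iUnion_subset hInf)]

theorem small_lists (S : Set Act.{u}) [Small.{u} S] (W : Set (List Act.{u}))
    (hW : ∀ σ ∈ W, ∀ a ∈ σ, a ∈ S) : Small.{u} W := by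
  have : W ⊆ Set.range (List.map (Subtype.val : S → Act.{u})) := fun σ hσ =>
    ⟨σ.attachWith (· ∈ S) (hW σ hσ), by simp⟩
  exact small_subset.{u} this

theorem small_sequences (S : Set Act.{u}) [Small.{u} S] (W : Set (ℕ → Act.{u}))
    (hW : ∀ ξ ∈ W, ∀ n, ξ n ∈ S) : Small.{u} W := by
  have : W ⊆ Set.range fun (f : ℕ → S) (n : ℕ) => (f n : Act.{u}) := fun ξ hξ =>
    ⟨fun n => ⟨ξ n, hW ξ hξ n⟩, rfl⟩
  exact small_subset.{u} this

/-- The number of marks executed by a script that has two marks at position `n` only. -/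
theorem cnt_markAt_two {n i p : ℕ} (hp : p ≤ markAt n 2 i) :
    (i < n ∧ cnt (markAt n 2) i p = 0) ∨
    (i = n ∧ p ≤ 2 ∧ cnt (markAt n 2) i p = p) ∨ (n < i ∧ cnt (markAt n 2) i p = 2) := by
  rcases lt_trichotomy i n with h | h | h
  · rw [markAt_of_ne h.ne, Nat.le_zero] at hp
    exact Or.inl ⟨h, by rw [cnt_markAt_of_le h.le, hp]⟩
  · subst h
    rw [markAt_self] at hp
    exact Or.inr (Or.inl ⟨rfl, hp, cnt_markAt_of_le le_rfl⟩)
  · rw [markAt_of_ne h.ne', Nat.le_zero] at hp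
    exact Or.inr (Or.inr ⟨h, by rw [cnt_markAt_of_lt h, hp]⟩)

/-- If divergence traces are not preserved, all traces that extend a divergence trace can be made
divergent. The scripts execute such a trace, with two marks at its shortest divergent prefix. -/
theorem exists_extension_Div (hR : IsCongruence R) (hlin : IsLinear R)
    (hal : Preserves R alphabet) (hD : ¬ Preserves R Div) (L : LTS.{u}) :
    ∃ M, R L M ∧ M.alphabet = L.alphabet ∧ M.Tr = L.Tr ∧ M.Div = L.Tr ∩ L.extT ∧
      M.Inf = L.Inf := by
  obtain ⟨S, hS, hsep⟩ := separates_Div hR hal hD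
  obtain ⟨c, hc⟩ := exists_fresh (S ∪ L.alphabet)
  have hcL : c ∉ L.alphabet := fun h => hc (Or.inr h)
  obtain ⟨K, K', hKK, hK, hK', hKD, hKD', h2, h2'⟩ := hsep c fun h => hc (Or.inl h)
  have hsmall : Small.{u} ↥(L.Tr ∩ L.extT) :=
    small_lists L.alphabet _ fun σ hσ => Tr_mem_alphabet hσ.1
  let σ : Shrink.{u} ↥(L.Tr ∩ L.extT) → List Act.{u} := fun j => ((equivShrink _).symm j).1
  have hσ : ∀ j, σ j ∈ L.Tr ∩ L.extT := fun j => ((equivShrink _).symm j).2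
  choose n hn hnD using fun j => (hσ j).2.2
  have hTr : ∀ (N : LTS.{u}), N.alphabet = {c} → ∀ j, (ctl (script L.alphabet c (ofList (σ j))
      (markAt (n j) 2) (σ j).length False) N).Tr ⊆ L.Tr := by
    intro N hN j ρ hρ
    obtain ⟨i, p, -, hi, -, rfl, -⟩ := (mem_Tr_feeder hN hcL).1 hρ
    rw [pre_ofList _ (by exact_mod_cast hi)]
    exact Tr_take (hσ j).1 i
  have hInf : ∀ (N : LTS.{u}), N.alphabet = {c} → ∀ j, (ctl (script L.alphabet c (ofList (σ j))
      (markAt (n j) 2) (σ j).length False) N).Inf ⊆ L.Inf := fun N hN j ζ hζ =>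
    absurd (Inf_feeder_subset hN hcL hζ).2.1 (ENat.natCast_ne_top _)
  obtain ⟨M, hM, h3, h4, h5, h6⟩ := exists_extension hR hlin hKK hK hK' hKD hKD' hcL
    (fun j => ofList (σ j)) (fun j => markAt (n j) 2) (fun j => (σ j).length) (hTr K' hK')
    (fun j ρ hρ => by
      obtain ⟨i, p, hp, hi, -, rfl, h⟩ := (mem_Div_feeder hK' hcL).1 hρ
      rw [pre_ofList _ (by exact_mod_cast hi)]
      rcases cnt_markAt_two hp with ⟨-, h0⟩ | ⟨rfl, -, -⟩ | ⟨-, h0⟩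
      · rw [h0] at h; exact absurd h hKD'
      · exact (hnD j).1
      · rw [h0] at h; exact absurd h h2')
    (hInf K' hK')
  refine ⟨M, hM, h3, ?_, ?_, ?_⟩
  · rw [h4, Set.union_eq_left.2 (Set.iUnion_subset (hTr K hK))]
  · rw [h5]
    refine Set.Subset.antisymm (Set.union_subset
      (Set.subset_inter L.Div_subset_Tr L.Div_subset_extT) (Set.iUnion_subset fun j ρ hρ => ?_)) ?_
    · obtain ⟨i, p, hp, hi, -, rfl, h⟩ := (mem_Div_feeder hK hcL).1 hρ
      have hi' : i ≤ (σ j).length := by exact_mod_cast hi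
      rw [pre_ofList _ hi']
      have htr : (σ j).take i ∈ L.Tr := Tr_take (hσ j).1 i
      refine ⟨htr, mem_extT_iff.2 ⟨Tr_mem_alphabet htr, n j, ?_⟩⟩
      rcases cnt_markAt_two hp with ⟨-, h0⟩ | ⟨rfl, -, -⟩ | ⟨hlt, -⟩
      · rw [h0] at h; exact absurd h hKD
      · rw [List.take_take, min_self]; exact (hnD j).1
      · rw [List.take_take, min_eq_left hlt.le]; exact (hnD j).1
    · intro ρ hρ
      refine Or.inr (Set.mem_iUnion.2 ⟨equivShrink _ ⟨ρ, hρ⟩, ?_⟩)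
      generalize hj : equivShrink ↥(L.Tr ∩ L.extT) ⟨ρ, hρ⟩ = j
      obtain rfl : σ j = ρ := by simp only [σ, ← hj, Equiv.symm_apply_apply]
      refine (mem_Div_feeder hK hcL).2 ⟨(σ j).length, markAt (n j) 2 (σ j).length, le_rfl, le_rfl,
        fun k hk => Tr_mem_alphabet hρ.1 _ (ofList_mem hk), (pre_ofList_length _).symm, ?_⟩
      rcases (hn j).lt_or_eq with h | h
      · rw [cnt_markAt_of_lt h, markAt_of_ne h.ne']; exact h2
      · rw [h, cnt_markAt_of_le le_rfl, markAt_self]; exact h2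
  · rw [h6, Set.union_eq_left.2 (Set.iUnion_subset (hInf K hK))]

/-- A nonempty alphabet allows each finite sequence to be continued to an infinite one. -/
theorem exists_continuation {S : Set Act.{u}} {a : Act.{u}} (ha : a ∈ S) {σ : List Act.{u}}
    (hσ : ∀ b ∈ σ, b ∈ S) :
    ∃ ξ : ℕ → Act.{u}, (∀ n, ξ n ∈ S) ∧ ∀ i ≤ σ.length, pre ξ i = σ.take i := by
  refine ⟨fun n => σ.getD n a, fun n => ?_, fun i hi => ?_⟩
  · rcases lt_or_ge n σ.length with h | h
    · simp only [List.getD_eq_getElem _ _ h]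
      exact hσ _ (List.getElem_mem h)
    · simp only [List.getD_eq_default _ _ h]
      exact ha
  · induction i with
    | zero => simp [pre_zero]
    | succ i ih =>
      rw [pre_succ, ih (by omega), List.take_succ_eq_append_getElem (by omega),
        List.getD_eq_getElem _ _ (show i < σ.length by omega)]

/-- If traces are not preserved, all extensions of divergence traces can be made traces. The scripts
execute an infinite sequence, with two marks at its shortest divergent prefix. -/
theorem exists_extension_Tr (hR : IsCongruence R) (hlin : IsLinear R)
    (hal : Preserves R alphabet) (hT : ¬ Preserves R Tr) (L : LTS.{u}) :
    ∃ M, R L M ∧ M.alphabet = L.alphabet ∧ M.Tr = L.Tr ∪ L.extT ∧ M.Inf = L.Inf ∪ L.extI := by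
  obtain ⟨S, hS, hsep⟩ := separates_Tr hR hal hT
  obtain ⟨c, hc⟩ := exists_fresh (S ∪ L.alphabet)
  have hcL : c ∉ L.alphabet := fun h => hc (Or.inr h)
  obtain ⟨K, K', hKK, hK, hK', hKD, hKD', h2, h2'⟩ := hsep c fun h => hc (Or.inl h)
  have hsmall : Small.{u} ↥L.extI := small_sequences L.alphabet _ fun ξ hξ => hξ.1
  let ξ : Shrink.{u} ↥L.extI → ℕ → Act.{u} := fun j => ((equivShrink _).symm j).1
  have hξ : ∀ j, ξ j ∈ L.extI := fun j => ((equivShrink _).symm j).2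
  have hξs : ∀ ζ ∈ L.extI, ∃ j, ξ j = ζ := fun ζ hζ =>
    ⟨equivShrink _ ⟨ζ, hζ⟩, by simp only [ξ, Equiv.symm_apply_apply]⟩
  choose n hnD using fun j => (hξ j).2
  have hpre : ∀ j, ∀ i ≤ n j, pre (ξ j) i ∈ L.Tr := fun j i hi => by
    rw [← take_pre _ hi]; exact Tr_take (L.Div_subset_Tr (hnD j).1) i
  obtain ⟨M, hM, h3, h4, -, h6⟩ := exists_extension hR hlin hKK hK hK' hKD hKD' hcL
    ξ (fun j => markAt (n j) 2) (fun _ => ⊤)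
    (fun j ρ hρ => by
      obtain ⟨i, p, hp, -, -, rfl, h⟩ := (mem_Tr_feeder hK' hcL).1 hρ
      rcases cnt_markAt_two hp with ⟨hlt, -⟩ | ⟨rfl, -, -⟩ | ⟨-, h0⟩
      · exact hpre j i hlt.le
      · exact hpre j _ le_rfl
      · rw [h0] at h; exact absurd h h2')
    (fun j ρ hρ => by
      obtain ⟨i, p, hp, -, -, rfl, h⟩ := (mem_Div_feeder hK' hcL).1 hρ
      rcases cnt_markAt_two hp with ⟨-, h0⟩ | ⟨rfl, -, -⟩ | ⟨-, h0⟩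
      · rw [h0] at h; exact absurd h hKD'
      · exact (hnD j).1
      · rw [h0] at h; exact absurd (Div_subset_Tr _ h) h2')
    (fun j ζ hζ => by
      obtain ⟨p, hp⟩ := (Inf_feeder_subset hK' hcL hζ).2.2.2 (n j + 1)
      rw [cnt_markAt_of_lt (Nat.lt_succ_self _), ← List.replicate_append_replicate] at hp
      exact absurd (Tr_of_append hp) h2')
  have hle : ∀ r ≤ 2, List.replicate r c ∈ K.Tr := by
    intro r hr
    refine Tr_of_append (ρ := List.replicate (2 - r) c) ?_
    rw [List.replicate_append_replicate, Nat.add_sub_cancel' hr]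
    exact h2
  refine ⟨M, hM, h3, ?_, ?_⟩
  · rw [h4]
    refine Set.Subset.antisymm (Set.union_subset Set.subset_union_left
      (Set.iUnion_subset fun j ρ hρ => ?_)) (Set.union_subset Set.subset_union_left ?_)
    · obtain ⟨i, p, hp, -, hm, rfl, h⟩ := (mem_Tr_feeder hK hcL).1 hρ
      rcases le_total i (n j) with h | h
      · exact Or.inl (hpre j i h)
      · refine Or.inr (mem_extT_iff.2 ⟨fun a ha => ?_, n j, ?_⟩)
        · obtain ⟨k, -, rfl⟩ := mem_pre.1 ha
          exact (hξ j).1 k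
        · rw [take_pre _ h]; exact (hnD j).1
    · intro ρ hρ
      rcases L.alphabet.eq_empty_or_nonempty with h | ⟨a, ha⟩
      · obtain rfl : ρ = [] := by
          refine List.eq_nil_iff_forall_not_mem.2 fun a ha => ?_
          have := hρ.1 a ha
          rw [h] at this
          exact this
        exact Or.inl (nil_mem_Tr L)
      · obtain ⟨ζ, hζ, hζρ⟩ := exists_continuation ha hρ.1
        obtain ⟨m, hm, hmD⟩ := hρ.2
        obtain ⟨j, rfl⟩ := hξs ζ ⟨hζ, m, by rwa [hζρ m hm]⟩
        refine Or.inr (Set.mem_iUnion.2 ⟨j, (mem_Tr_feeder hK hcL).2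
          ⟨ρ.length, 0, Nat.zero_le _, le_top, fun k _ => hζ k, ?_, hle _ ?_⟩⟩)
        · rw [hζρ _ le_rfl, List.take_length]
        · rcases cnt_markAt_two (n := n j) (i := ρ.length) (Nat.zero_le _) with
            ⟨-, h⟩ | ⟨-, -, h⟩ | ⟨-, h⟩ <;> omega
  · rw [h6]
    refine Set.Subset.antisymm (Set.union_subset Set.subset_union_left
      (Set.iUnion_subset fun j ζ hζ => ?_)) (Set.union_subset Set.subset_union_left ?_)
    · rw [(Inf_feeder_subset hK hcL hζ).1]
      exact Or.inr (hξ j)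
    · intro ζ hζ
      obtain ⟨j, rfl⟩ := hξs ζ hζ
      obtain ⟨s, hs⟩ := h2
      refine Or.inr (Set.mem_iUnion.2 ⟨j, mem_Inf_feeder hK hcL hζ.1
        (fun m => if m ≤ n j then K.init else s) (if_pos (Nat.zero_le _)) fun m => ?_⟩)
      rcases lt_trichotomy m (n j) with h | h | h
      · rw [if_pos h.le, if_pos (show m + 1 ≤ n j from h), markAt_of_ne h.ne]
        exact Reach.refl _
      · rw [if_pos h.le, if_neg (by omega), h, markAt_self]
        exact hs
      · rw [if_neg (by omega), if_neg (by omega), markAt_of_ne h.ne']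
        exact Reach.refl _

/-- Infinite traces can be added if a component that separates infinite traces is driven by scripts
in which each mark that may lead to a divergence is placed at a divergence trace. -/
theorem exists_extension_Inf (hR : IsCongruence R) (hlin : IsLinear R) {K K' L : LTS.{u}}
    {c : Act.{u}} (hKK : R K K') (hK : K.alphabet = {c}) (hK' : K'.alphabet = {c})
    (hKD : [] ∉ K.Div) (hKD' : [] ∉ K'.Div) (hc : c ∉ L.alphabet)
    (h : (fun _ => c) ∈ K.Inf) (h' : (fun _ => c) ∉ K'.Inf) (W : Set (ℕ → Act.{u}))
    (hW : ∀ ξ ∈ W, (∀ i, pre ξ i ∈ L.Tr) ∧ ∃ q : ℕ → ℕ, (∀ n, ∃ i ≥ n, 0 < q i) ∧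
      ∀ i, ∀ p ≤ q i, List.replicate (cnt q i p) c ∈ K.Div ∪ K'.Div → pre ξ i ∈ L.Div) :
    ∃ M, R L M ∧ M.alphabet = L.alphabet ∧ M.Tr = L.Tr ∧ M.Div = L.Div ∧ M.Inf = L.Inf ∪ W := by
  have hmem : ∀ ξ ∈ W, ∀ k, ξ k ∈ L.alphabet := fun ξ hξ k =>
    Tr_mem_alphabet ((hW ξ hξ).1 (k + 1)) _ (mem_pre.2 ⟨k, k.lt_succ_self, rfl⟩)
  have hsmall : Small.{u} ↥W := small_sequences L.alphabet _ hmem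
  let ξ : Shrink.{u} ↥W → ℕ → Act.{u} := fun j => ((equivShrink _).symm j).1
  have hξ : ∀ j, ξ j ∈ W := fun j => ((equivShrink _).symm j).2
  choose q hq hqD using fun j => (hW _ (hξ j)).2
  have hTr : ∀ (N : LTS.{u}), N.alphabet = {c} → ∀ j,
      (ctl (script L.alphabet c (ξ j) (q j) ⊤ False) N).Tr ⊆ L.Tr := by
    intro N hN j ρ hρ
    obtain ⟨i, p, -, hi, -, rfl, -⟩ := (mem_Tr_feeder hN hc).1 hρ
    exact (hW _ (hξ j)).1 i
  have hDiv : ∀ (N : LTS.{u}), N.alphabet = {c} → N.Div ⊆ K.Div ∪ K'.Div → ∀ j,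
      (ctl (script L.alphabet c (ξ j) (q j) ⊤ False) N).Div ⊆ L.Div := by
    intro N hN hND j ρ hρ
    obtain ⟨i, p, hp, -, -, rfl, h⟩ := (mem_Div_feeder hN hc).1 hρ
    exact hqD j i p hp (hND h)
  obtain ⟨M, hM, h3, h4, h5, h6⟩ := exists_extension hR hlin hKK hK hK' hKD hKD' hc
    ξ q (fun _ => ⊤) (hTr K' hK') (hDiv K' hK' Set.subset_union_right)
    (fun j ζ hζ => absurd (const_mem_Inf_of_feeder hK' hc (hq j) hζ) h')
  refine ⟨M, hM, h3, ?_, ?_, ?_⟩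
  · rw [h4, Set.union_eq_left.2 (Set.iUnion_subset (hTr K hK))]
  · rw [h5, Set.union_eq_left.2 (Set.iUnion_subset (hDiv K hK Set.subset_union_left))]
  · rw [h6]
    congr 1
    refine Set.Subset.antisymm (Set.iUnion_subset fun j ζ hζ => ?_) fun ζ hζ => ?_
    · rw [(Inf_feeder_subset hK hc hζ).1]
      exact hξ j
    · refine Set.mem_iUnion.2 ⟨equivShrink _ ⟨ζ, hζ⟩, ?_⟩
      generalize hj : equivShrink ↥W ⟨ζ, hζ⟩ = j
      obtain rfl : ξ j = ζ := by simp only [ξ, ← hj, Equiv.symm_apply_apply]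
      obtain ⟨x, h0, hx⟩ := InfReach.exists_reach h
      refine mem_Inf_feeder hK hc (hmem _ (hξ j)) (fun m => x (cnt (q j) m 0))
        (by rw [cnt_zero, h0]) fun m => ?_
      rw [cnt_succ_zero]
      have := reach_pre (x := fun k => x (cnt (q j) m 0 + k)) (ξ := fun _ => c)
        (fun k => hx (cnt (q j) m 0 + k)) (q j m)
      rwa [pre_const] at this

/-- If infinite traces are not preserved, all infinite sequences with a divergent tail can be made
infinite traces. -/
theorem exists_extension_Inf_of_eventually (hR : IsCongruence R) (hlin : IsLinear R)
    (hal : Preserves R alphabet) (hI : ¬ Preserves R Inf) (L : LTS.{u}) :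
    ∃ M, R L M ∧ M.alphabet = L.alphabet ∧ M.Tr = L.Tr ∧ M.Div = L.Div ∧
      M.Inf = L.Inf ∪ {ξ | ∃ n, ∀ i ≥ n, pre ξ i ∈ L.Div} := by
  obtain ⟨S, hS, hsep⟩ := separates_Inf hR hal hI
  obtain ⟨c, hc⟩ := exists_fresh (S ∪ L.alphabet)
  obtain ⟨K, K', hKK, hK, hK', hKD, hKD', h, h'⟩ := hsep c fun h => hc (Or.inl h)
  refine exists_extension_Inf hR hlin hKK hK hK' hKD hKD' (fun h => hc (Or.inr h)) h h' _ ?_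
  rintro ξ ⟨n, hn⟩
  refine ⟨fun i => ?_, fun i => if n ≤ i then 1 else 0, fun m => ?_, fun i p hp hD => ?_⟩
  · rw [← take_pre ξ (le_max_left i n)]
    exact Tr_take (L.Div_subset_Tr (hn _ (le_max_right i n))) i
  · exact ⟨max m n, le_max_left _ _, by simp⟩
  · by_cases hi : n ≤ i
    · exact hn i hi
    · exfalso
      simp only [if_neg hi, Nat.le_zero] at hp
      rw [cnt_eq_of_forall_eq_zero (fun k hk => if_neg (by omega)), hp] at hD
      exact hD.elim hKD hKD'

/-- If `Div` but not `aenI` is preserved, all infinite sequences with infinitely many divergent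
prefixes can be made infinite traces. Pairs of marks are placed at these prefixes, so that the
number of marks is even, and the component does not diverge, at all other prefixes. -/
theorem exists_extension_Inf_of_frequently (hR : IsCongruence R) (hlin : IsLinear R)
    (hD : Preserves R Div) (hI : ¬ Preserves R aenI) (L : LTS.{u}) :
    ∃ M, R L M ∧ M.alphabet = L.alphabet ∧ M.Tr = L.Tr ∧ M.Div = L.Div ∧
      M.Inf = L.Inf ∪ {ξ | ∀ n, ∃ i ≥ n, pre ξ i ∈ L.Div} := by
  classical
  obtain ⟨S, hS, hsep⟩ := separates_aenI hR hD hI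
  obtain ⟨c, hc⟩ := exists_fresh (S ∪ L.alphabet)
  obtain ⟨K, K', hKK, hK, hK', hKD, hKD', ⟨h, he⟩, h', he'⟩ := hsep c fun h => hc (Or.inl h)
  refine exists_extension_Inf hR hlin hKK hK hK' hKD hKD' (fun h => hc (Or.inr h)) h h' _ ?_
  intro ξ hξ
  refine ⟨fun i => ?_, fun i => if pre ξ i ∈ L.Div then 2 else 0, fun m => ?_,
    fun i p hp hD => ?_⟩
  · obtain ⟨j, hj, hjD⟩ := hξ i
    rw [← take_pre ξ hj]
    exact Tr_take (L.Div_subset_Tr hjD) i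
  · obtain ⟨j, hj, hjD⟩ := hξ m
    exact ⟨j, hj, by simp [hjD]⟩
  · by_contra hi
    simp only [if_neg hi, Nat.le_zero] at hp
    have heven : ∃ k, cnt (fun i => if pre ξ i ∈ L.Div then 2 else 0) i p = 2 * k := by
      refine ⟨∑ k ∈ Finset.range i, if pre ξ k ∈ L.Div then 1 else 0, ?_⟩
      rw [cnt, hp, Finset.mul_sum, add_zero]
      exact Finset.sum_congr rfl fun k _ => by split_ifs <;> rfl
    obtain ⟨k, hk⟩ := heven
    rw [hk] at hD
    exact hD.elim (he k) (he' k)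

end Extend

/-! ### Upper bounds for the congruences -/

section Classification

variable {R : LTS.{u} → LTS.{u} → Prop}

/-- Each process can be saturated with all extensions of its divergence traces, as traces,
divergence traces and infinite traces. -/
theorem related_of_anT_minD_anI (hR : IsCongruence R) (hlin : IsLinear R) (hD : Preserves R minD)
    (hT : ¬ Preserves R Tr) {L L' : LTS.{u}} (h0 : L.alphabet = L'.alphabet)
    (h1 : L.anT = L'.anT) (h2 : L.minD = L'.minD) (h3 : L.anI = L'.anI) : R L L' := by
  have hal := preserves_alphabet hR hD
  have hDiv : ¬ Preserves R Div := fun h => hT (preserves_Tr_of_Div hR h)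
  have key : ∀ L : LTS.{u}, ∃ N, R L N ∧ N.alphabet = L.alphabet ∧ N.Tr = L.anT ∪ L.extT ∧
      N.Div = L.extT ∧ N.Inf = L.anI ∪ L.extI := by
    intro L
    obtain ⟨M, hM, h4, h5, h6⟩ := exists_extension_Tr hR hlin hal hT L
    obtain ⟨N, hN, h7, h8, h9, h10⟩ := exists_extension_Div hR hlin hal hDiv M
    refine ⟨N, hR.equiv.trans hM hN, h7.trans h4, ?_, ?_, ?_⟩
    · rw [h8, h5]; exact Set.sdiff_union_self.symm
    · rw [h9, h5, ← extT_congr h4.symm (hD _ _ hM)]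
      exact Set.inter_eq_right.2 Set.subset_union_right
    · rw [h10, h6]; exact Set.sdiff_union_self.symm
  obtain ⟨N, hN, h4, h5, h6, h7⟩ := key L
  obtain ⟨N', hN', h4', h5', h6', h7'⟩ := key L'
  have hT' := extT_congr h0 h2
  have hI' := extI_congr h0 h2
  refine hR.equiv.trans hN (hR.equiv.trans (hlin _ _ ?_ ?_ ?_ ?_) (hR.equiv.symm hN'))
  · rw [h4, h4', h0]
  · rw [h5, h5', h1, hT']
  · rw [h6, h6', hT']
  · rw [h7, h7', h3, hI']

/-- Each process can be saturated with the traces in `extT` as divergence traces, and then with all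
infinite sequences whose prefixes are eventually such traces. The latter include the infinite traces
in `extI`. -/
theorem related_of_Tr_minD_anI (hR : IsCongruence R) (hlin : IsLinear R) (hD : Preserves R minD)
    (hDiv : ¬ Preserves R Div) (hI : ¬ Preserves R Inf) {L L' : LTS.{u}}
    (h0 : L.alphabet = L'.alphabet) (h1 : L.Tr = L'.Tr) (h2 : L.minD = L'.minD)
    (h3 : L.anI = L'.anI) : R L L' := by
  have hal := preserves_alphabet hR hD
  have key : ∀ L : LTS.{u}, ∃ N, R L N ∧ N.alphabet = L.alphabet ∧ N.Tr = L.Tr ∧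
      N.Div = L.Tr ∩ L.extT ∧
      N.Inf = L.anI ∪ {ξ | ∃ n, ∀ i ≥ n, pre ξ i ∈ L.Tr ∩ L.extT} := by
    intro L
    obtain ⟨M, hM, h4, h5, h6, h7⟩ := exists_extension_Div hR hlin hal hDiv L
    obtain ⟨N, hN, h8, h9, h10, h11⟩ := exists_extension_Inf_of_eventually hR hlin hal hI M
    refine ⟨N, hR.equiv.trans hM hN, h8.trans h4, h9.trans h5, h10.trans h6, ?_⟩
    rw [h11, h6, h7]
    refine Set.Subset.antisymm (Set.union_subset (fun ξ hξ => ?_) Set.subset_union_right)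
      (Set.union_subset_union_left _ Set.sdiff_subset)
    by_cases hext : ξ ∈ L.extI
    · obtain ⟨-, n, hn⟩ := mem_extI_iff.1 hext
      refine Or.inr ⟨n, fun i hi => ⟨pre_mem_Tr hξ i, mem_extT_iff.2
        ⟨Tr_mem_alphabet (pre_mem_Tr hξ i), n, ?_⟩⟩⟩
      rwa [take_pre ξ hi]
    · exact Or.inl ⟨hξ, hext⟩
  obtain ⟨N, hN, h4, h5, h6, h7⟩ := key L
  obtain ⟨N', hN', h4', h5', h6', h7'⟩ := key L'
  have hT' := extT_congr h0 h2
  refine hR.equiv.trans hN (hR.equiv.trans (hlin _ _ ?_ ?_ ?_ ?_) (hR.equiv.symm hN'))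
  · rw [h4, h4', h0]
  · rw [h5, h5', h1]
  · rw [h6, h6', h1, hT']
  · rw [h7, h7', h1, h3, hT']

theorem related_of_Tr_minD_Inf (hR : IsCongruence R) (hlin : IsLinear R) (hD : Preserves R minD)
    (hDiv : ¬ Preserves R Div) {L L' : LTS.{u}} (h0 : L.alphabet = L'.alphabet)
    (h1 : L.Tr = L'.Tr) (h2 : L.minD = L'.minD) (h3 : L.Inf = L'.Inf) : R L L' := by
  have hal := preserves_alphabet hR hD
  obtain ⟨N, hN, h4, h5, h6, h7⟩ := exists_extension_Div hR hlin hal hDiv L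
  obtain ⟨N', hN', h4', h5', h6', h7'⟩ := exists_extension_Div hR hlin hal hDiv L'
  refine hR.equiv.trans hN (hR.equiv.trans (hlin _ _ ?_ ?_ ?_ ?_) (hR.equiv.symm hN'))
  · rw [h4, h4', h0]
  · rw [h5, h5', h1]
  · rw [h6, h6', h1, extT_congr h0 h2]
  · rw [h7, h7', h3]

theorem related_of_Tr_Div_eanI (hR : IsCongruence R) (hlin : IsLinear R) (hD : Preserves R Div)
    (hI : ¬ Preserves R aenI) {L L' : LTS.{u}} (h0 : L.alphabet = L'.alphabet)
    (h1 : L.Tr = L'.Tr) (h2 : L.Div = L'.Div) (h3 : L.eanI = L'.eanI) : R L L' := by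
  have hean : ∀ L : LTS.{u}, L.Inf ∪ {ξ | ∀ n, ∃ i ≥ n, pre ξ i ∈ L.Div} =
      L.eanI ∪ {ξ | ∀ n, ∃ i ≥ n, pre ξ i ∈ L.Div} := by
    intro L
    refine Set.Subset.antisymm (Set.union_subset (fun ξ hξ => ?_) Set.subset_union_right)
      (Set.union_subset_union_left _ fun ξ hξ => hξ.1)
    by_cases h : ∃ n, ∀ i ≥ n, pre ξ i ∉ L.Div
    · exact Or.inl ⟨hξ, h⟩
    · push Not at h
      exact Or.inr h
  obtain ⟨N, hN, h4, h5, h6, h7⟩ := exists_extension_Inf_of_frequently hR hlin hD hI L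
  obtain ⟨N', hN', h4', h5', h6', h7'⟩ := exists_extension_Inf_of_frequently hR hlin hD hI L'
  refine hR.equiv.trans hN (hR.equiv.trans (hlin _ _ ?_ ?_ ?_ ?_) (hR.equiv.symm hN'))
  · rw [h4, h4', h0]
  · rw [h5, h5', h1]
  · rw [h6, h6', h2]
  · rw [h7, h7', hean, hean, h3, h2]

theorem related_of_Tr_Div_aenI (hR : IsCongruence R) (hlin : IsLinear R)
    (hal : Preserves R alphabet) (hI : ¬ Preserves R Inf) {L L' : LTS.{u}}
    (h0 : L.alphabet = L'.alphabet) (h1 : L.Tr = L'.Tr) (h2 : L.Div = L'.Div)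
    (h3 : L.aenI = L'.aenI) : R L L' := by
  have haen : ∀ L : LTS.{u}, L.Inf ∪ {ξ | ∃ n, ∀ i ≥ n, pre ξ i ∈ L.Div} =
      L.aenI ∪ {ξ | ∃ n, ∀ i ≥ n, pre ξ i ∈ L.Div} := by
    intro L
    refine Set.Subset.antisymm (Set.union_subset (fun ξ hξ => ?_) Set.subset_union_right)
      (Set.union_subset_union_left _ fun ξ hξ => hξ.1)
    by_cases h : ∀ n, ∃ i ≥ n, pre ξ i ∉ L.Div
    · exact Or.inl ⟨hξ, h⟩
    · push Not at h
      exact Or.inr h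
  obtain ⟨N, hN, h4, h5, h6, h7⟩ := exists_extension_Inf_of_eventually hR hlin hal hI L
  obtain ⟨N', hN', h4', h5', h6', h7'⟩ := exists_extension_Inf_of_eventually hR hlin hal hI L'
  refine hR.equiv.trans hN (hR.equiv.trans (hlin _ _ ?_ ?_ ?_ ?_) (hR.equiv.symm hN'))
  · rw [h4, h4', h0]
  · rw [h5, h5', h1]
  · rw [h6, h6', h2]
  · rw [h7, h7', haen, haen, h3, h2]

end Classification

end LTS

theorem mainTheorem10 (R : LTS.{u} → LTS.{u} → Prop) (hR : LTS.IsCongruence R)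
    (hCFFD : ∀ L L' : LTS.{u}, LTS.CFFD L L' → R L L')
    (hlock : R LTS.livelock LTS.bothlock)
    (hsanF : ¬ LTS.Preserves R LTS.sanF) :
    (LTS.Preserves R LTS.minD → ¬ LTS.Preserves R LTS.Tr →
      ∀ L L' : LTS.{u}, R L L' ↔ L.alphabet = L'.alphabet ∧ L.anT = L'.anT ∧
        L.minD = L'.minD ∧ L.anI = L'.anI) ∧
    (LTS.Preserves R LTS.Tr → LTS.Preserves R LTS.minD →
      ¬ LTS.Preserves R LTS.Div → ¬ LTS.Preserves R LTS.Inf →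
      ∀ L L' : LTS.{u}, R L L' ↔ L.alphabet = L'.alphabet ∧ L.Tr = L'.Tr ∧
        L.minD = L'.minD ∧ L.anI = L'.anI) ∧
    (LTS.Preserves R LTS.minD → LTS.Preserves R LTS.Inf → ¬ LTS.Preserves R LTS.Div →
      ∀ L L' : LTS.{u}, R L L' ↔ L.alphabet = L'.alphabet ∧ L.Tr = L'.Tr ∧
        L.minD = L'.minD ∧ L.Inf = L'.Inf) ∧
    (LTS.Preserves R LTS.Div → ¬ LTS.Preserves R LTS.aenI →
      ∀ L L' : LTS.{u}, R L L' ↔ L.alphabet = L'.alphabet ∧ L.Tr = L'.Tr ∧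
        L.Div = L'.Div ∧ L.eanI = L'.eanI) ∧
    (LTS.Preserves R LTS.Div → LTS.Preserves R LTS.aenI → ¬ LTS.Preserves R LTS.Inf →
      ∀ L L' : LTS.{u}, R L L' ↔ L.alphabet = L'.alphabet ∧ L.Tr = L'.Tr ∧
        L.Div = L'.Div ∧ L.aenI = L'.aenI) ∧
    (LTS.Preserves R LTS.Div → LTS.Preserves R LTS.Inf →
      ∀ L L' : LTS.{u}, R L L' ↔ L.alphabet = L'.alphabet ∧ L.Tr = L'.Tr ∧
        L.Div = L'.Div ∧ L.Inf = L'.Inf) := by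

  have hlin : LTS.Preserves R LTS.minD → LTS.IsLinear R := fun hD _ _ =>
    LTS.related_of_semantics_eq hR hCFFD hD hsanF
  have hal : LTS.Preserves R LTS.minD → LTS.Preserves R LTS.alphabet :=
    LTS.preserves_alphabet hR
  refine ⟨?_, ?_, ?_, ?_, ?_, ?_⟩
  · refine fun hD hT L L' => ⟨fun h => ⟨hal hD _ _ h, LTS.preserves_anT hR hD _ _ h, hD _ _ h,
      LTS.preserves_anI hR hD _ _ h⟩, ?_⟩
    rintro ⟨h0, h1, h2, h3⟩
    exact LTS.related_of_anT_minD_anI hR (hlin hD) hD hT h0 h1 h2 h3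
  · refine fun hT hD hDiv hI L L' => ⟨fun h => ⟨hal hD _ _ h, hT _ _ h, hD _ _ h,
      LTS.preserves_anI hR hD _ _ h⟩, ?_⟩
    rintro ⟨h0, h1, h2, h3⟩
    exact LTS.related_of_Tr_minD_anI hR (hlin hD) hD hDiv hI h0 h1 h2 h3
  · refine fun hD hI hDiv L L' => ⟨fun h => ⟨hal hD _ _ h,
      LTS.preserves_Tr_of_Inf hR hD hI _ _ h, hD _ _ h, hI _ _ h⟩, ?_⟩
    rintro ⟨h0, h1, h2, h3⟩
    exact LTS.related_of_Tr_minD_Inf hR (hlin hD) hD hDiv h0 h1 h2 h3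
  · refine fun hDiv hI L L' => ⟨fun h => ⟨hal (LTS.preserves_minD hDiv) _ _ h,
      LTS.preserves_Tr_of_Div hR hDiv _ _ h, hDiv _ _ h, LTS.preserves_eanI hR hDiv _ _ h⟩, ?_⟩
    rintro ⟨h0, h1, h2, h3⟩
    exact LTS.related_of_Tr_Div_eanI hR (hlin (LTS.preserves_minD hDiv)) hDiv hI h0 h1 h2 h3
  · refine fun hDiv haI hI L L' => ⟨fun h => ⟨hal (LTS.preserves_minD hDiv) _ _ h,
      LTS.preserves_Tr_of_Div hR hDiv _ _ h, hDiv _ _ h, haI _ _ h⟩, ?_⟩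
    rintro ⟨h0, h1, h2, h3⟩
    exact LTS.related_of_Tr_Div_aenI hR (hlin (LTS.preserves_minD hDiv))
      (hal (LTS.preserves_minD hDiv)) hI h0 h1 h2 h3
  · refine fun hDiv hI L L' => ⟨fun h => ⟨hal (LTS.preserves_minD hDiv) _ _ h,
      LTS.preserves_Tr_of_Div hR hDiv _ _ h, hDiv _ _ h, hI _ _ h⟩, ?_⟩
    rintro ⟨h0, h1, h2, h3⟩
    exact hlin (LTS.preserves_minD hDiv) _ _ h0 h1 h2 h3
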